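/- Let $\mathbb D$ be the open unit disc, $\mathbb T$ its boundary, $H(\mathbb D)$ the analytic functions in $\mathbb D$, and $dA=\frac{dx\,dy}{\pi}$. A radial weight is a function $\omega:[0,1)\to(0,\infty)$ such that $\omega(z)=\omega(|z|)$ is integrable over $\mathbb D$; write $\omega(E)=\int_E\omega\,dA$ and $$\psi_\omega(r)=\frac1{\omega(r)}\int_r^1\omega(s)\,ds,\quad 0\le r<1,\qquad \omega^\star(z)=\int_{|z|}^1\omega(s)\log\frac{s}{|z|}\,s\,ds,\quad z\in\mathbb D\setminus\{0\}.$$ A continuous radial weight $\omega$ is regular, $\omega\in\mathcal R$, if there are constants $c,C>0$ with $c(1-r)\le\psi_\omega(r)\le C(1-r)$ for all $0\le r<1$, and rapidly increasing, $\omega\in\mathcal I$, if $\lim_{r\to1^-}\psi_\omega(r)/(1-r)=\infty$. A function $h:[0,1)\to(0,\infty)$ is essentially increasing if there is a constant $C>0$ with $h(r)\le C\,h(t)$ for all $0\le r\le t<1$. For an arc $I\subset\mathbb T$ of length $|I|\in(0,2\pi]$ let $S(I)=\{re^{it}\in\mathbb D: e^{it}\in I,\ 1-|I|\le r<1\}$,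 and for $a\in\mathbb D\setminus\{0\}$ let $S(a)=S(I_a)$, where $I_a$ is the closed arc of length $1-|a|$ with midpoint $a/|a|$. For $0<p<\infty$ put $$A^p_\omega=\Big\{f\in H(\mathbb D):\int_{\mathbb D}|f|^p\,\omega\,dA<\infty\Big\},$$ $$\mathcal C^1(\omega^\star)=\Big\{g\in H(\mathbb D):\ |g(0)|^2+\sup_{I\subset\mathbb T}\frac{\int_{S(I)}|g'|^2\,\omega^\star\,dA}{\omega(S(I))}<\infty\Big\},$$ $$\mathrm{BMOA}=\Big\{g\in H(\mathbb D):\ \sup_{a\in\mathbb D\setminus\{0\}}\frac{\int_{S(a)}|g'(z)|^2(1-|z|^2)\,dA(z)}{1-|a|}+|g(0)|^2<\infty\Big\},$$ $$\mathcal B=\Big\{f\in H(\mathbb D):\ \sup_{z\in\mathbb D}|f'(z)|(1-|z|^2)+|f(0)|<\infty\Big\}.$$ Then the following assertions hold. (A) If $\omega\in\mathcal I\cup\mathcal R$, then $\mathcal C^1(\omega^\star)\subset\bigcap_{0<p<\infty}A^p_\omega$. (B) If $\omega\in\mathcal I\cup\mathcal R$, then $\mathrm{BMOA}\subset\mathcal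 C^1(\omega^\star)\subset\mathcal B$. (C) If $\omega\in\mathcal R$, then $\mathcal C^1(\omega^\star)=\mathcal B$. (D) If $\omega\in\mathcal I$, then $\mathcal C^1(\omega^\star)\subsetneq\mathcal B$. (E) If $\omega\in\mathcal I$ and both $\omega(r)$ and $\frac{\psi_\omega(r)}{1-r}$ are essentially increasing on $[0,1)$, then $\mathrm{BMOA}\subsetneq\mathcal C^1(\omega^\star)$. -/

import Mathlib

open MeasureTheory Set Filter Topology
open scoped ENNReal

noncomputable section

namespace RadialBergman

/-- The open unit disc of the complex plane. -/
def disc : Set ℂ := Metric.ball 0 1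

/-- Analytic functions in the unit disc. An element is a function on `ℂ`; only its values on the
disc matter for the spaces below. -/
def AnalyticDisc : Set (ℂ → ℂ) := {f | DifferentiableOn ℂ f disc}

/-- Normalized area measure `dx dy / π` on the unit disc. -/
def areaDisc : Measure ℂ := ENNReal.ofReal (Real.pi⁻¹) • volume.restrict disc

/-- A radial weight, given by its profile `ω : [0,1) → (0,∞)`, so that `ω(z) = ω(|z|)`: it is
positive and integrable over the disc. -/
structure IsRadialWeight (ω : ℝ → ℝ) : Prop where
  pos : ∀ r ∈ Ico (0 : ℝ) 1, 0 < ω r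
  integrable : Integrable (fun z : ℂ => ω ‖z‖) areaDisc

/-- The distortion function `ψ_ω(r) = (1/ω(r)) ∫_r^1 ω(s) ds`. -/
def distortion (ω : ℝ → ℝ) (r : ℝ) : ℝ := (1 / ω r) * ∫ s in r..1, ω s

/-- Regular weights (the class `𝓡`): continuous radial weights with `ψ_ω(r) ≍ 1 - r`. -/
structure IsRegularWeight (ω : ℝ → ℝ) : Prop extends IsRadialWeight ω where
  continuousOn : ContinuousOn ω (Ico 0 1)
  distortion_comparable : ∃ c > 0, ∃ C > 0, ∀ r ∈ Ico (0 : ℝ) 1,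
    c * (1 - r) ≤ distortion ω r ∧ distortion ω r ≤ C * (1 - r)

/-- Rapidly increasing weights (the class `𝓘`): continuous radial weights with
`ψ_ω(r) / (1 - r) → ∞` as `r → 1⁻`. -/
structure IsRapidlyIncreasingWeight (ω : ℝ → ℝ) : Prop extends IsRadialWeight ω where
  continuousOn : ContinuousOn ω (Ico 0 1)
  tendsto_distortion : Tendsto (fun r => distortion ω r / (1 - r)) (𝓝[<] 1) atTop

/-- `h` is essentially increasing on `[0,1)`. -/
def EssentiallyIncreasing (h : ℝ → ℝ) : Prop :=
  ∃ C > 0, ∀ r t : ℝ, 0 ≤ r → r ≤ t → t < 1 → h r ≤ C * h t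

/-- The associated weight `ω⋆(z) = ∫_{|z|}^1 ω(s) log(s/|z|) s ds`, for `z ≠ 0`. -/
def associatedWeight (ω : ℝ → ℝ) (z : ℂ) : ℝ :=
  ∫ s in ‖z‖..1, ω s * Real.log (s / ‖z‖) * s

/-- The Carleson square `S(I)` over the arc `I = {e^{it} : |t - θ| ≤ ℓ/2}` with midpoint `e^{iθ}`
and length `ℓ`: the points `r e^{it}` of the disc with `e^{it} ∈ I` and `1 - ℓ ≤ r < 1`. -/
def carlesonSquare (θ ℓ : ℝ) : Set ℂ :=
  {z | ∃ r t : ℝ, 0 ≤ r ∧ 1 - ℓ ≤ r ∧ r < 1 ∧ |t - θ| ≤ ℓ / 2 ∧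
    z = (r : ℂ) * Complex.exp ((t : ℂ) * Complex.I)}

/-- The Carleson square `S(a)`, `a ≠ 0`, over the arc of length `1 - |a|` with midpoint `a/|a|`. -/
def carlesonSquareAt (a : ℂ) : Set ℂ := carlesonSquare (Complex.arg a) (1 - ‖a‖)

/-- `ω(E) = ∫_E ω dA`. -/
def weightMass (ω : ℝ → ℝ) (E : Set ℂ) : ℝ≥0∞ :=
  ∫⁻ z in E, ENNReal.ofReal (ω ‖z‖) ∂areaDisc

/-- The weighted Bergman space `A^p_ω`, `0 < p < ∞`. -/
def bergmanSpace (p : ℝ) (ω : ℝ → ℝ) : Set (ℂ → ℂ) :=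
  {f | f ∈ AnalyticDisc ∧ ∫⁻ z, ENNReal.ofReal (‖f z‖ ^ p * ω ‖z‖) ∂areaDisc < ∞}

/-- `‖g‖²` in `𝓒¹(ω⋆)`: `|g(0)|² + sup_I (∫_{S(I)} |g'|² ω⋆ dA) / ω(S(I))`, the supremum over all
arcs `I` of the unit circle, of length `ℓ ∈ (0, 2π]`. -/
def cOneNormSq (ω : ℝ → ℝ) (g : ℂ → ℂ) : ℝ≥0∞ :=
  ENNReal.ofReal (‖g 0‖ ^ 2) + ⨆ (θ : ℝ) (ℓ ∈ Ioc (0 : ℝ) (2 * Real.pi)),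
    (∫⁻ z in carlesonSquare θ ℓ,
      ENNReal.ofReal (‖deriv g z‖ ^ 2 * associatedWeight ω z) ∂areaDisc) /
    weightMass ω (carlesonSquare θ ℓ)

/-- The space `𝓒¹(ω⋆)`. -/
def cOneSpace (ω : ℝ → ℝ) : Set (ℂ → ℂ) :=
  {g | g ∈ AnalyticDisc ∧ cOneNormSq ω g < ∞}

/-- `‖g‖²` in `BMOA`:
`sup_a (∫_{S(a)} |g'(z)|² (1 - |z|²) dA(z)) / (1 - |a|) + |g(0)|²`, over `a ∈ 𝔻 ∖ {0}`. -/
def bmoaNormSq (g : ℂ → ℂ) : ℝ≥0∞ :=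
  (⨆ a ∈ disc \ {0},
    (∫⁻ z in carlesonSquareAt a,
      ENNReal.ofReal (‖deriv g z‖ ^ 2 * (1 - ‖z‖ ^ 2)) ∂areaDisc) /
    ENNReal.ofReal (1 - ‖a‖)) + ENNReal.ofReal (‖g 0‖ ^ 2)

/-- The space `BMOA`. -/
def BMOA : Set (ℂ → ℂ) := {g | g ∈ AnalyticDisc ∧ bmoaNormSq g < ∞}

/-- The Bloch norm `sup_z |f'(z)| (1 - |z|²) + |f(0)|`. -/
def blochNorm (f : ℂ → ℂ) : ℝ≥0∞ :=
  (⨆ z ∈ disc, ENNReal.ofReal (‖deriv f z‖ * (1 - ‖z‖ ^ 2))) + ENNReal.ofReal ‖f 0‖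

/-- The Bloch space. -/
def blochSpace : Set (ℂ → ℂ) := {f | f ∈ AnalyticDisc ∧ blochNorm f < ∞}

end RadialBergman

end

open scoped NNReal

namespace RadialBergman

/-! Both classes of weights satisfy a one-sided bound `(1 - r) ω(r) ≤ m ∫_r^1 ω` (`IsAdmissible`),
which says that the tail divided by `(1 - r)^m` increases. The tail is therefore doubling. Hence
ω⋆(z) is comparable to `(1 - |z|) tail ω |z|` away from the origin, and `ω(S(I))` is comparable to
`ℓ tail ω (1 - ℓ)` for short arcs of length `ℓ`. With these two comparisons the inclusions in (B)
and (C) are short. For BMOA, bound the tail by its value at the bottom of the square. For Bloch,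
apply the mean value property to `(g')²` on a small ball inside a Carleson square. For regular
weights, ω⋆ is at most a constant times `(1 - |z|)² ω`, so the Bloch bound gives a pointwise
estimate.

Assertion (A) is an induction on even powers. The Littlewood–Paley inequality `lintegral_sq_le`,
applied to `g^(k+1)`, bounds the integral of `|g|^(2k+2) ω` by that of `|g|^(2k)` against `μ = |g'|²
Φ dA`, where `Φ` is the iterated tail. Membership in 𝓒¹ makes `μ` a Carleson measure relative to
`ω`. What is needed is an embedding for powers of `|g|` only, and `g` is already known to be Bloch.
Averages of a Bloch function over arcs stay within a constant of its values on the top half of the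
square (`bloch_average_sub_le`, by Cauchy's theorem in logarithmic coordinates). A dyadic stopping
argument (`measure_inter_le_of_sector`) then gives a weak-type comparison of `t μ{|g| > t}` with the
`|g| ω dA`-measure of `{4|g| > t}`, and integrating in `t` returns the power `q` on both sides.

Strictness in (D) and (E) comes from Hadamard series `∑ a_k z^(2^k)`. The frequencies from `2^N` on
are all multiples of `2^N`, so Parseval is exact on arcs of length `2π/2^N`
(`lintegral_lacunaryTail`), while the remaining head is bounded by `2^N`. With `a_k = 1` the mean of
`|g'|²` on such arcs is at least of order `(1 - r)⁻²`, which is too large when `ψ_ω(r)/(1 - r)`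
tends to infinity. With `a_k² = 1 - W_(k+1)/W_k`, where `W_k` is the tail at `1 - 2^(-k)`, the sums
of `a_k² W_k` over `k ≥ N` telescope to `W_N`, which is the 𝓒¹ condition, while `∑ a_k²` diverges,
which excludes BMOA. -/

/-- The tail integral `∫_r^1 ω(s) ds` of a weight. -/
noncomputable def tail (ω : ℝ → ℝ) (r : ℝ) : ℝ := ∫ s in r..1, ω s

/-- The iterated tail `∫_r^1 (s - r) ω(s) ds` of a weight. -/
noncomputable def tailMoment (ω : ℝ → ℝ) (r : ℝ) : ℝ := ∫ s in r..1, ω s * (s - r)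

/-- Continuous positive integrable weights on `[0,1)`. -/
structure IsContinuousWeight (ω : ℝ → ℝ) : Prop where
  pos : ∀ r ∈ Ico (0 : ℝ) 1, 0 < ω r
  continuousOn : ContinuousOn ω (Ico 0 1)
  intervalIntegrable : IntervalIntegrable ω volume 0 1

/-- Continuous weights on `[0,1)` with `(1 - r) ω(r) ≤ m ∫_r^1 ω(s) ds`. -/
structure IsAdmissible (ω : ℝ → ℝ) (m : ℕ) : Prop extends IsContinuousWeight ω where
  lower : ∀ r ∈ Ico (0 : ℝ) 1, (1 - r) * ω r ≤ m * tail ω r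

/-! ### Radial weights: tail integrals, admissibility and doubling. -/

theorem IsRadialWeight.intervalIntegrable {ω : ℝ → ℝ} (h : IsRadialWeight ω)
    (hc : ContinuousOn ω (Ico 0 1)) : IntervalIntegrable ω volume 0 1 := by
  have h1 : IntegrableOn (fun z : ℂ => ω ‖z‖) (Metric.ball 0 1) volume := by
    have := h.integrable
    unfold areaDisc disc at this
    rwa [integrable_smul_measure (by simp [Real.pi_pos]) (by simp)] at this
  rw [integrableOn_fun_norm_addHaar] at h1
  simp only [Complex.finrank_real_complex] at h1
  -- Integrability over the disc controls only `r ω(r)`. Near 0 continuity is used instead; on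
  -- `(1/2, 1)` the lost factor `r` costs at most 2.
  have h2 : IntervalIntegrable ω volume 0 (1 / 2) := by
    apply ContinuousOn.intervalIntegrable
    apply hc.mono
    rw [uIcc_of_le (by norm_num)]
    exact fun x hx => ⟨hx.1, by linarith [hx.2]⟩
  refine h2.trans ?_
  rw [intervalIntegrable_iff_integrableOn_Ioo_of_le (by norm_num)]
  have h3 : IntegrableOn (fun y : ℝ => y ^ (2 - 1) • ω y) (Ioo (1 / 2) 1) :=
    h1.mono_set (Ioo_subset_Ioo (by norm_num) le_rfl)
  refine Integrable.mono' (h3.norm.const_mul 2)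
    ((hc.mono (fun x hx => ⟨by linarith [hx.1], hx.2⟩)).aestronglyMeasurable measurableSet_Ioo) ?_
  refine (ae_restrict_iff' measurableSet_Ioo).2 (ae_of_all _ fun x hx => ?_)
  simp only [Nat.add_one_sub_one, pow_one, smul_eq_mul, norm_mul, Real.norm_eq_abs]
  have : (1 : ℝ) / 2 ≤ |x| := by rw [abs_of_pos (by linarith [hx.1])]; exact hx.1.le
  nlinarith [abs_nonneg (ω x)]

theorem IsRadialWeight.isContinuousWeight {ω : ℝ → ℝ} (h : IsRadialWeight ω)
    (hc : ContinuousOn ω (Ico 0 1)) : IsContinuousWeight ω :=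
  ⟨h.pos, hc, h.intervalIntegrable hc⟩

theorem tail_one (ω : ℝ → ℝ) : tail ω 1 = 0 := by simp [tail]

namespace IsContinuousWeight

variable {ω : ℝ → ℝ} (h : IsContinuousWeight ω)
include h

theorem intervalIntegrable_sub {a b : ℝ} (ha : a ∈ Icc (0 : ℝ) 1) (hb : b ∈ Icc (0 : ℝ) 1) :
    IntervalIntegrable ω volume a b :=
  h.intervalIntegrable.mono_set (by
    rw [uIcc_of_le zero_le_one]
    exact uIcc_subset_Icc ha hb)

theorem integral_add_tail {a b : ℝ} (ha : a ∈ Icc (0 : ℝ) 1) (hb : b ∈ Icc (0 : ℝ) 1) :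
    (∫ s in a..b, ω s) + tail ω b = tail ω a :=
  intervalIntegral.integral_add_adjacent_intervals (h.intervalIntegrable_sub ha hb)
    (h.intervalIntegrable_sub hb ⟨zero_le_one, le_rfl⟩)

theorem integral_nonneg {a b : ℝ} (ha : 0 ≤ a) (hab : a ≤ b) (hb : b ≤ 1) :
    0 ≤ ∫ s in a..b, ω s := by
  rw [intervalIntegral.integral_of_le hab, integral_Ioc_eq_integral_Ioo]
  exact setIntegral_nonneg measurableSet_Ioo fun x hx =>
    (h.pos x ⟨ha.trans hx.1.le, hx.2.trans_le hb⟩).le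

theorem tail_anti {a b : ℝ} (ha : 0 ≤ a) (hab : a ≤ b) (hb : b ≤ 1) : tail ω b ≤ tail ω a := by
  have := h.integral_add_tail ⟨ha, hab.trans hb⟩ ⟨ha.trans hab, hb⟩
  linarith [h.integral_nonneg ha hab hb]

theorem tail_nonneg {a : ℝ} (ha : 0 ≤ a) (ha1 : a ≤ 1) : 0 ≤ tail ω a :=
  h.integral_nonneg ha ha1 le_rfl

theorem tail_pos {a : ℝ} (ha : 0 ≤ a) (ha1 : a < 1) : 0 < tail ω a :=
  intervalIntegral.intervalIntegral_pos_of_pos_on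
    (h.intervalIntegrable_sub ⟨ha, ha1.le⟩ ⟨zero_le_one, le_rfl⟩)
    (fun x hx => h.pos x ⟨ha.trans hx.1.le, hx.2⟩) ha1

theorem continuousOn_tail : ContinuousOn (tail ω) (Icc 0 1) := by
  have h1 := intervalIntegral.continuousOn_primitive_interval'
    (h.intervalIntegrable_sub ⟨le_rfl, zero_le_one⟩ ⟨zero_le_one, le_rfl⟩) (left_mem_uIcc)
  rw [uIcc_of_le zero_le_one] at h1
  have h2 : ContinuousOn (fun x => tail ω 0 - ∫ s in (0 : ℝ)..x, ω s) (Icc 0 1) :=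
    continuousOn_const.sub h1
  refine h2.congr fun x hx => ?_
  have := h.integral_add_tail ⟨le_rfl, zero_le_one⟩ hx
  linarith

theorem hasDerivAt_tail {r : ℝ} (hr : r ∈ Ioo (0 : ℝ) 1) : HasDerivAt (tail ω) (-ω r) r := by
  have hn : Ico (0 : ℝ) 1 ∈ 𝓝 r := mem_of_superset (Ioo_mem_nhds hr.1 hr.2) Ioo_subset_Ico_self
  have hn' : Ioo (0 : ℝ) 1 ∈ 𝓝 r := Ioo_mem_nhds hr.1 hr.2
  refine intervalIntegral.integral_hasDerivAt_left
    (h.intervalIntegrable_sub ⟨hr.1.le, hr.2.le⟩ ⟨zero_le_one, le_rfl⟩) ?_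
    (h.continuousOn.continuousAt hn)
  exact (h.continuousOn.mono Ioo_subset_Ico_self).stronglyMeasurableAtFilter isOpen_Ioo r hr

theorem continuousOn_distortion : ContinuousOn (distortion ω) (Ico 0 1) := by
  have : ContinuousOn (fun r => (1 / ω r) * tail ω r) (Ico 0 1) :=
    (continuousOn_const.div h.continuousOn fun x hx => (h.pos x hx).ne').mul
      (h.continuousOn_tail.mono Ico_subset_Icc_self)
  exact this

theorem mul_distortion {r : ℝ} (hr : r ∈ Ico (0 : ℝ) 1) : ω r * distortion ω r = tail ω r := by
  have := (h.pos r hr).ne'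
  unfold distortion tail
  field_simp

/-- Multiplying the bound by `ω r` gives `c (1 - r) ω(r) ≤ tail ω r`, so any integer `m ≥ 1/c`
works. An integer is taken so that only natural powers occur later. -/
theorem isAdmissible_of_distortion {c : ℝ} (hc : 0 < c)
    (hd : ∀ r ∈ Ico (0 : ℝ) 1, c * (1 - r) ≤ distortion ω r) : ∃ m, IsAdmissible ω m := by
  obtain ⟨m, hm⟩ := exists_nat_ge (1 / c)
  refine ⟨m, h, fun r hr => ?_⟩
  have h1 := hd r hr
  have h2 := h.mul_distortion hr
  have h3 := h.pos r hr
  have h4 : 1 ≤ m * c := by rwa [div_le_iff₀ hc] at hm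
  have h5 : c * (1 - r) * ω r ≤ tail ω r := by
    rw [← h2]; nlinarith
  have h6 : 0 ≤ (1 - r) * ω r := mul_nonneg (by linarith [hr.2]) h3.le
  have h7 : (m : ℝ) * (c * (1 - r) * ω r) ≤ m * tail ω r := by gcongr
  nlinarith

end IsContinuousWeight

theorem IsRegularWeight.exists_isAdmissible {ω : ℝ → ℝ} (h : IsRegularWeight ω) :
    ∃ m, IsAdmissible ω m := by
  obtain ⟨c, hc, C, -, hd⟩ := h.distortion_comparable
  exact (h.toIsRadialWeight.isContinuousWeight h.continuousOn).isAdmissible_of_distortion hc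
    fun r hr => (hd r hr).1

/-- Near 1 the quotient `ψ_ω(r)/(1 - r)` exceeds 1; on the remaining compact interval it is
continuous and positive, hence bounded below. -/
theorem IsRapidlyIncreasingWeight.exists_isAdmissible {ω : ℝ → ℝ}
    (h : IsRapidlyIncreasingWeight ω) : ∃ m, IsAdmissible ω m := by
  have hw := h.toIsRadialWeight.isContinuousWeight h.continuousOn
  have h1 := h.tendsto_distortion.eventually (eventually_ge_atTop 1)
  obtain ⟨r₀, hr₀, hr₁⟩ := (mem_nhdsLT_iff_exists_Ioo_subset' (zero_lt_one' ℝ)).1 h1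
  set r₂ := max r₀ 0
  have hr₂ : r₂ < 1 := max_lt hr₀ zero_lt_one
  have hcont : ContinuousOn (fun r => distortion ω r / (1 - r)) (Icc 0 r₂) :=
    ((hw.continuousOn_distortion.mono fun x hx => ⟨hx.1, hx.2.trans_lt hr₂⟩)).div
      (by fun_prop) fun x hx => by linarith [hx.2]
  obtain ⟨x, hx, hmin⟩ := isCompact_Icc.exists_isMinOn
    (nonempty_Icc.2 (le_max_right r₀ 0)) hcont
  have hx1 : x < 1 := hx.2.trans_lt hr₂
  have hpos : 0 < distortion ω x / (1 - x) := by
    apply div_pos _ (by linarith)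
    have := hw.mul_distortion ⟨hx.1, hx1⟩
    have h2 := hw.tail_pos hx.1 hx1
    have h3 := hw.pos x ⟨hx.1, hx1⟩
    rw [← this] at h2
    exact (pos_iff_pos_of_mul_pos h2).1 h3
  refine hw.isAdmissible_of_distortion (c := min 1 (distortion ω x / (1 - x)))
    (lt_min one_pos hpos) fun r hr => ?_
  rw [← le_div_iff₀ (by linarith [hr.2])]
  rcases le_or_gt r r₂ with h5 | h5
  · exact (min_le_right _ _).trans (hmin ⟨hr.1, h5⟩)
  · exact (min_le_left _ _).trans (hr₁ ⟨(le_max_left _ _).trans_lt h5, hr.2⟩)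

namespace IsAdmissible

variable {ω : ℝ → ℝ} {m : ℕ} (h : IsAdmissible ω m)
include h

/-- The numerator of the derivative is `(1 - r)^(m-1) (m tail ω r - (1 - r) ω(r))`, nonnegative by
admissibility. This is the source of all doubling estimates. -/
theorem tail_div_pow_mono : MonotoneOn (fun r => tail ω r / (1 - r) ^ m) (Ico 0 1) := by
  refine monotoneOn_of_hasDerivWithinAt_nonneg (convex_Ico 0 1)
    (f' := fun r => (-ω r * (1 - r) ^ m - tail ω r * (m * (1 - r) ^ (m - 1) * (-1))) /
      ((1 - r) ^ m) ^ 2) ?_ ?_ ?_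
  · exact (h.continuousOn_tail.mono Ico_subset_Icc_self).div (by fun_prop)
      fun x hx => pow_ne_zero _ (by linarith [hx.2])
  · intro r hr
    rw [interior_Ico] at hr ⊢
    have h1 := h.hasDerivAt_tail hr
    have h2 : HasDerivAt (fun r : ℝ => (1 - r) ^ m) (m * (1 - r) ^ (m - 1) * (-1)) r := by
      simpa using ((hasDerivAt_id r).const_sub 1).fun_pow m
    exact (h1.div h2 (pow_ne_zero _ (by linarith [hr.2]))).hasDerivWithinAt
  · intro r hr
    rw [interior_Ico] at hr
    have h1 := h.lower r ⟨hr.1.le, hr.2⟩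
    have h2 : 0 < 1 - r := by linarith [hr.2]
    apply div_nonneg _ (by positivity)
    -- For `m = 0` the exponent `m - 1` truncates, but then admissibility reads `(1 - r) ω(r) ≤ 0`,
    -- which is absurd.
    rcases m with _ | k
    · have h3 := h.pos r ⟨hr.1.le, hr.2⟩
      simp at h1
      nlinarith
    · have : 0 ≤ (1 - r) ^ k * ((k + 1 : ℕ) * tail ω r - (1 - r) * ω r) :=
        mul_nonneg (by positivity) (by linarith)
      simp only [Nat.add_sub_cancel, pow_succ]
      nlinarith

theorem tail_le {r s : ℝ} (hr : 0 ≤ r) (hrs : r ≤ s) (hs : s < 1) :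
    tail ω r ≤ ((1 - r) / (1 - s)) ^ m * tail ω s := by
  have h1 := h.tail_div_pow_mono ⟨hr, hrs.trans_lt hs⟩ ⟨hr.trans hrs, hs⟩ hrs
  simp only at h1
  have h2 : 0 < 1 - s := by linarith
  have h3 : 0 < 1 - r := by linarith
  rw [div_le_iff₀ (by positivity)] at h1
  calc _ ≤ _ := h1
    _ = _ := by rw [div_pow]; ring

theorem tail_le_const {r s : ℝ} (D : ℝ) (hr : 0 ≤ r) (hrs : r ≤ s) (hs : s < 1)
    (hD : 1 - r ≤ D * (1 - s)) : tail ω r ≤ D ^ m * tail ω s := by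
  refine (h.tail_le hr hrs hs).trans ?_
  have := h.tail_nonneg (hr.trans hrs) hs.le
  have h2 : 0 < 1 - s := by linarith
  gcongr
  · exact div_nonneg (by linarith) h2.le
  · rwa [div_le_iff₀ h2]

theorem tail_mid {r : ℝ} (hr : 0 ≤ r) (hr1 : r < 1) :
    tail ω r ≤ 2 ^ m * tail ω ((1 + r) / 2) :=
  h.tail_le_const 2 hr (by linarith) (by linarith) (by linarith)

end IsAdmissible
-- The iterated tail and its comparison with ω⋆.
namespace IsContinuousWeight

variable {ω : ℝ → ℝ} (h : IsContinuousWeight ω)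
include h

theorem intervalIntegrable_mul_sub {r : ℝ} (hr : r ∈ Icc (0 : ℝ) 1) :
    IntervalIntegrable (fun s => ω s * (s - r)) volume r 1 :=
  (h.intervalIntegrable_sub hr ⟨zero_le_one, le_rfl⟩).mul_continuousOn (by fun_prop)

theorem intervalIntegrable_log {r : ℝ} (hr : r ∈ Ioc (0 : ℝ) 1) :
    IntervalIntegrable (fun s => ω s * Real.log (s / r) * s) volume r 1 := by
  refine ((h.intervalIntegrable_sub ⟨hr.1.le, hr.2⟩ ⟨zero_le_one, le_rfl⟩).mul_continuousOn
    ?_).mul_continuousOn (by fun_prop)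
  rw [uIcc_of_le hr.2]
  refine ContinuousOn.log (by fun_prop) fun x hx => ?_
  have := hr.1.trans_le hx.1
  have := hr.1
  positivity

theorem tailMoment_le {r : ℝ} (hr : r ∈ Ico (0 : ℝ) 1) :
    tailMoment ω r ≤ (1 - r) * tail ω r := by
  unfold tailMoment tail
  rw [← intervalIntegral.integral_const_mul]
  refine intervalIntegral.integral_mono_on_of_le_Ioo hr.2.le
    (h.intervalIntegrable_mul_sub ⟨hr.1, hr.2.le⟩)
    ((h.intervalIntegrable_sub ⟨hr.1, hr.2.le⟩ ⟨zero_le_one, le_rfl⟩).const_mul _) fun s hs => ?_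
  have := h.pos s ⟨hr.1.trans hs.1.le, hs.2⟩
  nlinarith [hs.2]

theorem tailMoment_nonneg {r : ℝ} (hr : r ∈ Ico (0 : ℝ) 1) : 0 ≤ tailMoment ω r := by
  unfold tailMoment
  rw [intervalIntegral.integral_of_le hr.2.le, integral_Ioc_eq_integral_Ioo]
  exact setIntegral_nonneg measurableSet_Ioo fun x hx =>
    mul_nonneg (h.pos x ⟨hr.1.trans hx.1.le, hx.2⟩).le (by linarith [hx.1])

/-- From `log x ≥ 1 - 1/x` at `x = s/|z|`. The iterated tail replaces ω⋆ where a function bounded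
and continuous up to the origin is wanted. -/
theorem tailMoment_le_associatedWeight {z : ℂ} (hz : z ≠ 0) (hz1 : ‖z‖ < 1) :
    tailMoment ω ‖z‖ ≤ associatedWeight ω z := by
  have hr : 0 < ‖z‖ := norm_pos_iff.2 hz
  refine intervalIntegral.integral_mono_on_of_le_Ioo hz1.le
    (h.intervalIntegrable_mul_sub ⟨hr.le, hz1.le⟩) (h.intervalIntegrable_log ⟨hr, hz1.le⟩)
    fun s hs => ?_
  have hs0 : 0 < s := hr.trans hs.1
  have h1 := h.pos s ⟨hs0.le, hs.2⟩
  have h2 := Real.one_sub_inv_le_log_of_pos (div_pos hs0 hr)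
  rw [inv_div] at h2
  have h3 : s - ‖z‖ ≤ Real.log (s / ‖z‖) * s := by
    calc s - ‖z‖ = (1 - ‖z‖ / s) * s := by field_simp
      _ ≤ _ := by gcongr
  rw [mul_assoc]
  gcongr

/-- From `log x ≤ x - 1`; the factor `1/|z|` dominates the logarithmic singularity of ω⋆ at the
origin. -/
theorem associatedWeight_le_tailMoment {z : ℂ} (hz : z ≠ 0) (hz1 : ‖z‖ < 1) :
    associatedWeight ω z ≤ tailMoment ω ‖z‖ / ‖z‖ := by
  have hr : 0 < ‖z‖ := norm_pos_iff.2 hz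
  unfold tailMoment associatedWeight
  rw [← intervalIntegral.integral_div]
  refine intervalIntegral.integral_mono_on_of_le_Ioo hz1.le
    (h.intervalIntegrable_log ⟨hr, hz1.le⟩)
    ((h.intervalIntegrable_mul_sub ⟨hr.le, hz1.le⟩).div_const _) fun s hs => ?_
  have hs0 : 0 < s := hr.trans hs.1
  have h1 := h.pos s ⟨hs0.le, hs.2⟩
  have h2 := Real.log_le_sub_one_of_pos (div_pos hs0 hr)
  have h4 : 0 ≤ s / ‖z‖ - 1 := by
    rw [sub_nonneg, le_div_iff₀ hr]; linarith [hs.1]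
  calc ω s * Real.log (s / ‖z‖) * s ≤ ω s * (s / ‖z‖ - 1) * 1 := by
        gcongr
        · exact hs.2.le
    _ = ω s * (s - ‖z‖) / ‖z‖ := by field_simp

theorem associatedWeight_le {z : ℂ} (hz : z ≠ 0) (hz1 : ‖z‖ < 1) :
    associatedWeight ω z ≤ (1 - ‖z‖) * tail ω ‖z‖ / ‖z‖ :=
  (h.associatedWeight_le_tailMoment hz hz1).trans <| by
    gcongr
    exact h.tailMoment_le ⟨norm_nonneg z, hz1⟩

theorem associatedWeight_nonneg {z : ℂ} (hz1 : ‖z‖ < 1) :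
    0 ≤ associatedWeight ω z := by
  by_cases hz : z = 0
  · simp [associatedWeight, hz]
  · exact (h.tailMoment_nonneg ⟨norm_nonneg z, hz1⟩).trans (h.tailMoment_le_associatedWeight hz hz1)

theorem associatedWeight_le_two {z : ℂ} (hz : 1 / 2 ≤ ‖z‖) (hz1 : ‖z‖ < 1) :
    associatedWeight ω z ≤ 2 * ((1 - ‖z‖) * tail ω ‖z‖) := by
  refine (h.associatedWeight_le (norm_pos_iff.1 (by linarith)) hz1).trans ?_
  rw [div_le_iff₀ (by linarith)]
  nlinarith [mul_nonneg (sub_nonneg.2 hz1.le) (h.tail_nonneg (norm_nonneg z) hz1.le)]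

/-- Discard the part of the integral below the midpoint `(1 + r)/2`; beyond it `s - r ≥ (1 - r)/2`.
-/
theorem half_mul_tail_le_tailMoment {r : ℝ} (hr : r ∈ Ico (0 : ℝ) 1) :
    (1 - r) / 2 * tail ω ((1 + r) / 2) ≤ tailMoment ω r := by
  have hr1 := hr.1
  have hr2 := hr.2
  have hi := h.intervalIntegrable_mul_sub ⟨hr.1, hr.2.le⟩
  have hsub1 : IntervalIntegrable (fun s => ω s * (s - r)) volume r ((1 + r) / 2) :=
    hi.mono_set (uIcc_subset_uIcc left_mem_uIcc (by
      rw [uIcc_of_le hr2.le]; constructor <;> linarith))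
  have hsub2 : IntervalIntegrable (fun s => ω s * (s - r)) volume ((1 + r) / 2) 1 :=
    hi.mono_set (uIcc_subset_uIcc (by
      rw [uIcc_of_le hr2.le]; constructor <;> linarith) right_mem_uIcc)
  unfold tailMoment tail
  rw [← intervalIntegral.integral_add_adjacent_intervals hsub1 hsub2,
    ← intervalIntegral.integral_const_mul]
  have h1 : 0 ≤ ∫ s in r..((1 + r) / 2), ω s * (s - r) :=
    intervalIntegral.integral_nonneg (by linarith) fun x hx =>
      mul_nonneg (h.pos x ⟨hr1.trans hx.1, by linarith [hx.2]⟩).le (by linarith [hx.1])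
  refine le_add_of_nonneg_of_le h1 ?_
  refine intervalIntegral.integral_mono_on_of_le_Ioo (by linarith)
    ((h.intervalIntegrable_sub ⟨by linarith, by linarith⟩ ⟨zero_le_one, le_rfl⟩).const_mul _)
    hsub2 fun s hs => ?_
  have := h.pos s ⟨by linarith [hs.1], hs.2⟩
  nlinarith [hs.1]

theorem ofReal_tailMoment {r : ℝ} (hr : r ∈ Ico (0 : ℝ) 1) :
    ENNReal.ofReal (tailMoment ω r) = ∫⁻ s in Ioo r 1, ENNReal.ofReal (ω s * (s - r)) := by
  have hi := h.intervalIntegrable_mul_sub ⟨hr.1, hr.2.le⟩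
  unfold tailMoment
  rw [intervalIntegral.integral_of_le hr.2.le, integral_Ioc_eq_integral_Ioo,
    ofReal_integral_eq_lintegral_ofReal]
  · rwa [intervalIntegrable_iff_integrableOn_Ioo_of_le hr.2.le] at hi
  · exact (ae_restrict_iff' measurableSet_Ioo).2 (ae_of_all _ fun x hx =>
      mul_nonneg (h.pos x ⟨hr.1.trans hx.1.le, hx.2⟩).le (by linarith [hx.1]))

theorem ofReal_tail {r : ℝ} (hr : r ∈ Icc (0 : ℝ) 1) :
    ENNReal.ofReal (tail ω r) = ∫⁻ s in Ioo r 1, ENNReal.ofReal (ω s) := by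
  have hi := h.intervalIntegrable_sub hr ⟨zero_le_one, le_rfl⟩
  unfold tail
  rw [intervalIntegral.integral_of_le hr.2, integral_Ioc_eq_integral_Ioo,
    ofReal_integral_eq_lintegral_ofReal]
  · rwa [intervalIntegrable_iff_integrableOn_Ioo_of_le hr.2] at hi
  · exact (ae_restrict_iff' measurableSet_Ioo).2 (ae_of_all _ fun x hx =>
      (h.pos x ⟨hr.1.trans hx.1.le, hx.2⟩).le)

theorem continuousOn_tailMoment : ContinuousOn (tailMoment ω) (Ico 0 1) := by
  have hi : IntervalIntegrable (fun s => ω s * s) volume 0 1 :=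
    h.intervalIntegrable.mul_continuousOn (by fun_prop)
  have h1 := intervalIntegral.continuousOn_primitive_interval' hi left_mem_uIcc
  rw [uIcc_of_le zero_le_one] at h1
  have h2 : ContinuousOn (fun r => (∫ s in (0 : ℝ)..1, ω s * s) - (∫ s in (0 : ℝ)..r, ω s * s)
      - r * tail ω r) (Icc 0 1) :=
    (continuousOn_const.sub h1).sub (continuousOn_id.mul h.continuousOn_tail)
  refine (h2.mono Ico_subset_Icc_self).congr fun r hr => ?_
  have hm : r ∈ uIcc (0 : ℝ) 1 := by rw [uIcc_of_le zero_le_one]; exact ⟨hr.1, hr.2.le⟩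
  have ha := hi.mono_set (uIcc_subset_uIcc left_mem_uIcc hm)
  have hb := hi.mono_set (uIcc_subset_uIcc hm right_mem_uIcc)
  have h3 := intervalIntegral.integral_add_adjacent_intervals ha hb
  -- Expanding `s - r` removes the parameter from the integrand, leaving primitives that are
  -- continuous in `r`.
  have h4 : tailMoment ω r = (∫ s in r..1, ω s * s) - r * tail ω r := by
    unfold tailMoment tail
    rw [← intervalIntegral.integral_const_mul, ← intervalIntegral.integral_sub hb
      ((h.intervalIntegrable_sub ⟨hr.1, hr.2.le⟩ ⟨zero_le_one, le_rfl⟩).const_mul _)]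
    congr 1
    ext s
    ring
  rw [h4]
  linarith

end IsContinuousWeight

namespace IsAdmissible

variable {ω : ℝ → ℝ} {m : ℕ} (h : IsAdmissible ω m)
include h

theorem le_tailMoment {r : ℝ} (hr : r ∈ Ico (0 : ℝ) 1) :
    (1 - r) * tail ω r ≤ 2 ^ (m + 1) * tailMoment ω r := by
  have h1 := h.half_mul_tail_le_tailMoment hr
  have h2 := h.tail_mid hr.1 hr.2
  have h3 : 0 ≤ 1 - r := by linarith [hr.2]
  calc _ ≤ (1 - r) * (2 ^ m * tail ω ((1 + r) / 2)) := by gcongr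
    _ = 2 ^ (m + 1) * ((1 - r) / 2 * tail ω ((1 + r) / 2)) := by ring
    _ ≤ _ := by gcongr

theorem le_associatedWeight {z : ℂ} (hz : z ≠ 0) (hz1 : ‖z‖ < 1) :
    (1 - ‖z‖) * tail ω ‖z‖ ≤ 2 ^ (m + 1) * associatedWeight ω z :=
  (h.le_tailMoment ⟨norm_nonneg z, hz1⟩).trans <| by
    gcongr
    exact h.tailMoment_le_associatedWeight hz hz1

end IsAdmissible
-- Polar coordinates and Carleson squares.
theorem norm_ofReal_mul_exp {r : ℝ} (hr : 0 ≤ r) (t : ℝ) :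
    ‖(r : ℂ) * Complex.exp (t * Complex.I)‖ = r := by
  rw [norm_mul, Complex.norm_exp_ofReal_mul_I, mul_one, Complex.norm_real, Real.norm_of_nonneg hr]

theorem setLIntegral_areaDisc {A : Set ℂ} (hA : MeasurableSet A) (hAd : A ⊆ disc) (F : ℂ → ℝ≥0∞) :
    ∫⁻ z in A, F z ∂areaDisc = ENNReal.ofReal Real.pi⁻¹ * ∫⁻ z in A, F z := by
  unfold areaDisc
  rw [Measure.restrict_smul, lintegral_smul_measure, Measure.restrict_restrict hA,
    inter_eq_left.2 hAd, smul_eq_mul]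

/-- Continuity is asked only on the annular region that carries the integral; it supplies the joint
measurability for Tonelli. -/
theorem lintegral_polar {F : ℂ → ℝ≥0∞} {R Θ : Set ℝ} (hF : ContinuousOn F {z | ‖z‖ ∈ R})
    (hR : MeasurableSet R) (hΘ : MeasurableSet Θ) (hR1 : R ⊆ Ioo 0 1)
    (hΘ1 : Θ ⊆ Ioc (-Real.pi) Real.pi) :
    ∫⁻ z in {z : ℂ | ‖z‖ ∈ R ∧ z.arg ∈ Θ}, F z ∂areaDisc =
      ENNReal.ofReal Real.pi⁻¹ * ∫⁻ r in R, ∫⁻ t in Θ,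
        ENNReal.ofReal r * F (r * Complex.exp (t * Complex.I)) := by
  set A : Set ℂ := {z : ℂ | ‖z‖ ∈ R ∧ z.arg ∈ Θ} with hAdef
  have hA : MeasurableSet A := (measurable_norm hR).inter (Complex.measurable_arg hΘ)
  have hAd : A ⊆ disc := fun z hz => by
    simpa [disc] using (hR1 hz.1).2
  rw [setLIntegral_areaDisc hA hAd, ← lintegral_indicator hA, ← Complex.lintegral_comp_polarCoord_symm]
  congr 1
  have h1 : ∀ p ∈ polarCoord.target, ENNReal.ofReal p.1 • A.indicator F (Complex.polarCoord.symm p)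
      = (R ×ˢ Θ).indicator (fun p : ℝ × ℝ =>
        ENNReal.ofReal p.1 * F (p.1 * Complex.exp (p.2 * Complex.I))) p := by
    intro p hp
    rw [polarCoord_target] at hp
    have e : Complex.polarCoord.symm p = p.1 * Complex.exp (p.2 * Complex.I) := by
      rw [Complex.polarCoord_symm_apply, Complex.exp_mul_I]
      push_cast; ring
    have hn : ‖(p.1 * Complex.exp (p.2 * Complex.I) : ℂ)‖ = p.1 := norm_ofReal_mul_exp hp.1.le p.2
    have ha : (p.1 * Complex.exp (p.2 * Complex.I) : ℂ).arg = p.2 := by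
      rw [Complex.exp_mul_I]
      exact Complex.arg_mul_cos_add_sin_mul_I hp.1 ⟨hp.2.1, hp.2.2.le⟩
    rw [e]
    by_cases hpm : p ∈ R ×ˢ Θ
    · have : (p.1 * Complex.exp (p.2 * Complex.I) : ℂ) ∈ A := by
        rw [hAdef, mem_ofPred_eq, hn, ha]; exact hpm
      rw [indicator_of_mem hpm, indicator_of_mem this, smul_eq_mul]
    · have : (p.1 * Complex.exp (p.2 * Complex.I) : ℂ) ∉ A := by
        rw [hAdef, mem_ofPred_eq, hn, ha]; exact hpm
      rw [indicator_of_notMem hpm, indicator_of_notMem this, smul_zero]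
  rw [setLIntegral_congr_fun polarCoord.open_target.measurableSet h1, polarCoord_target,
    Measure.volume_eq_prod, ← Measure.prod_restrict, restrict_Ioo_eq_restrict_Ioc,
    Measure.prod_restrict, setLIntegral_indicator (hR.prod hΘ)]
  have hsub : R ×ˢ Θ ∩ Ioi 0 ×ˢ Ioc (-Real.pi) Real.pi = R ×ˢ Θ :=
    inter_eq_left.2 (prod_mono (fun x hx => (hR1 hx).1) hΘ1)
  rw [hsub, setLIntegral_prod]
  refine AEMeasurable.mul (by fun_prop) (ContinuousOn.aemeasurable ?_ (hR.prod hΘ))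
  refine hF.comp (by fun_prop) fun p hp => ?_
  rw [mem_ofPred_eq, norm_ofReal_mul_exp (hR1 hp.1).1.le]
  exact hp.1

/-- Rotation moves every arc to one centred at angle 0, where the square can be described by the
principal argument without meeting the branch cut in its interior. -/
theorem carlesonSquare_eq_preimage (θ ℓ : ℝ) :
    carlesonSquare θ ℓ =
      (rotation (Circle.exp (-θ))).toHomeomorph ⁻¹' carlesonSquare 0 ℓ := by
  ext z
  constructor
  · rintro ⟨r, t, h0, h1, h2, h3, rfl⟩
    refine ⟨r, t - θ, h0, h1, h2, by simpa using h3, ?_⟩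
    simp only [LinearIsometryEquiv.coe_toHomeomorph, rotation_apply, Circle.coe_exp]
    rw [mul_left_comm, ← Complex.exp_add]
    push_cast
    ring_nf
  · rintro ⟨r, t, h0, h1, h2, h3, h4⟩
    refine ⟨r, t + θ, h0, h1, h2, by simpa using h3, ?_⟩
    simp only [LinearIsometryEquiv.coe_toHomeomorph, rotation_apply, Circle.coe_exp] at h4
    have : z = Complex.exp (θ * Complex.I) * (Complex.exp (((-θ : ℝ) : ℂ) * Complex.I) * z) := by
      rw [← mul_assoc, ← Complex.exp_add]
      simp
    rw [this, h4, mul_left_comm, ← Complex.exp_add]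
    push_cast
    ring_nf

theorem measurePreserving_rotation (a : Circle) :
    MeasurePreserving (rotation a) areaDisc areaDisc := by
  unfold areaDisc
  refine MeasurePreserving.smul_measure ?_ _
  have h := (rotation a).measurePreserving.restrict_preimage (s := disc)
    (Metric.isOpen_ball.measurableSet)
  have : rotation a ⁻¹' disc = disc := by
    ext z
    rw [mem_preimage]
    simp only [disc, mem_ball_zero_iff, LinearIsometryEquiv.norm_map]
  rwa [this] at h

theorem carlesonSquare_zero_eq {ℓ : ℝ} (h0 : 0 < ℓ) (h1 : ℓ ≤ 2 * Real.pi) :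
    carlesonSquare 0 ℓ = {z : ℂ | ‖z‖ ∈ Ico (1 - ℓ) 1 ∧ |z.arg| ≤ ℓ / 2} := by
  ext z
  constructor
  · rintro ⟨r, t, hr0, hr1, hr2, ht, rfl⟩
    rw [sub_zero] at ht
    rw [mem_ofPred_eq, norm_ofReal_mul_exp hr0]
    refine ⟨⟨hr1, hr2⟩, ?_⟩
    rcases hr0.eq_or_lt with rfl | hr0
    · simp; linarith
    · rw [Complex.exp_mul_I]
      rw [abs_le] at ht
      -- The principal argument lies in `(-π, π]`, so `t = -π`, possible only for the full circle,
      -- is the one angle it does not return.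
      rcases eq_or_lt_of_le (show -Real.pi ≤ t by linarith [ht.1]) with h | h
      · have : ((r : ℂ) * (Complex.cos t + Complex.sin t * Complex.I)) = -r := by
          rw [← h]; simp
        rw [this, ← Complex.ofReal_neg, Complex.arg_ofReal_of_neg (by linarith),
          abs_of_pos Real.pi_pos]
        linarith
      · rw [Complex.arg_mul_cos_add_sin_mul_I hr0 ⟨h, by linarith [ht.2]⟩]
        exact abs_le.2 ht
  · rintro ⟨h2, h3⟩
    exact ⟨‖z‖, z.arg, norm_nonneg z, h2.1, h2.2, by simpa using h3,
      (Complex.norm_mul_exp_arg_mul_I z).symm⟩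

theorem carlesonSquare_subset_disc (θ ℓ : ℝ) : carlesonSquare θ ℓ ⊆ disc := by
  rintro _ ⟨r, t, hr0, hr1, hr2, ht, rfl⟩
  simpa [disc, abs_of_nonneg hr0] using hr2

theorem measurableSet_carlesonSquare {θ ℓ : ℝ} (h0 : 0 < ℓ) (h1 : ℓ ≤ 2 * Real.pi) :
    MeasurableSet (carlesonSquare θ ℓ) := by
  rw [carlesonSquare_eq_preimage, carlesonSquare_zero_eq h0 h1]
  refine (rotation _).toHomeomorph.continuous.measurable ?_
  exact (measurable_norm measurableSet_Ico).inter
    ((measurable_norm.comp Complex.measurable_arg) measurableSet_Iic)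

instance : NullSingletonClass areaDisc :=
  ⟨fun x => by simp [areaDisc]⟩

theorem lintegral_carlesonSquare {F : ℂ → ℝ≥0∞} (hF : ContinuousOn F disc) (θ : ℝ) {ℓ : ℝ}
    (h0 : 0 < ℓ) (h1 : ℓ ≤ 2 * Real.pi) :
    ∫⁻ z in carlesonSquare θ ℓ, F z ∂areaDisc =
      ENNReal.ofReal Real.pi⁻¹ * ∫⁻ r in Ioo (max (1 - ℓ) 0) 1,
        ∫⁻ t in Ioc (θ - ℓ / 2) (θ + ℓ / 2),
          ENNReal.ofReal r * F (r * Complex.exp (t * Complex.I)) := by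
  set G : ℂ → ℝ≥0∞ := fun z => F (Complex.exp (θ * Complex.I) * z)
  have hG : ContinuousOn G disc := by
    refine hF.comp (by fun_prop) fun z hz => ?_
    simpa [disc, Complex.norm_exp_ofReal_mul_I] using hz
  have e1 : ∫⁻ z in carlesonSquare θ ℓ, F z ∂areaDisc =
      ∫⁻ z in carlesonSquare 0 ℓ, G z ∂areaDisc := by
    rw [carlesonSquare_eq_preimage θ ℓ, ← (measurePreserving_rotation
      (Circle.exp (-θ))).setLIntegral_comp_preimage_emb
      (rotation (Circle.exp (-θ))).toHomeomorph.measurableEmbedding G]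
    congr 1
    ext z
    simp only [G, rotation_apply, Circle.coe_exp]
    rw [← mul_assoc, ← Complex.exp_add]
    simp
  -- The origin, which belongs to the square once `ℓ ≥ 1`, is a null set and is removed so that
  -- polar coordinates apply.
  have e2 : ∫⁻ z in carlesonSquare 0 ℓ, G z ∂areaDisc = ∫⁻ z in {z : ℂ | ‖z‖ ∈
      Ico (1 - ℓ) 1 ∩ Ioi 0 ∧ z.arg ∈ Icc (-(ℓ / 2)) (ℓ / 2) ∩ Ioc (-Real.pi) Real.pi},
      G z ∂areaDisc := by
    refine setLIntegral_congr ?_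
    have : {z : ℂ | ‖z‖ ∈ Ico (1 - ℓ) 1 ∩ Ioi 0 ∧
        z.arg ∈ Icc (-(ℓ / 2)) (ℓ / 2) ∩ Ioc (-Real.pi) Real.pi} = carlesonSquare 0 ℓ \ {0} := by
      rw [carlesonSquare_zero_eq h0 h1]
      ext z
      simp [abs_le, Complex.neg_pi_lt_arg, Complex.arg_le_pi]
      tauto
    rw [this]
    exact (sdiff_null_ae_eq_self (measure_singleton 0)).symm
  rw [e1, e2, lintegral_polar (hG.mono fun z hz => by simpa [disc] using hz.1.2)
    (measurableSet_Ico.inter measurableSet_Ioi)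
    (measurableSet_Icc.inter measurableSet_Ioc) (fun x hx => ⟨hx.2, hx.1.2⟩) inter_subset_right]
  congr 1
  have e3 : (Ico (1 - ℓ) 1 ∩ Ioi 0 : Set ℝ) =ᵐ[volume] Ioo (max (1 - ℓ) 0) 1 := by
    have : (Ico (1 - ℓ) 1 ∩ Ioi 0 : Set ℝ) =ᵐ[volume] (Ioo (1 - ℓ) 1 ∩ Ioi 0 : Set ℝ) :=
      Ioo_ae_eq_Ico.symm.inter (ae_eq_refl _)
    have h2 : (Ioo (1 - ℓ) 1 ∩ Ioi 0 : Set ℝ) = Ioo (max (1 - ℓ) 0) 1 := by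
      ext x
      simp; tauto
    rwa [h2] at this
  have e4 : (Icc (-(ℓ / 2)) (ℓ / 2) ∩ Ioc (-Real.pi) Real.pi : Set ℝ) =ᵐ[volume]
      Ioc (-(ℓ / 2)) (ℓ / 2) := by
    have : (Icc (-(ℓ / 2)) (ℓ / 2) ∩ Ioc (-Real.pi) Real.pi : Set ℝ) =ᵐ[volume]
      (Ioc (-(ℓ / 2)) (ℓ / 2) ∩ Ioc (-Real.pi) Real.pi : Set ℝ) :=
      Ioc_ae_eq_Icc.symm.inter (ae_eq_refl _)
    refine this.trans (Eq.eventuallyEq (inter_eq_left.2 fun x hx => ⟨?_, ?_⟩)) <;>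
      linarith [hx.1, hx.2]
  rw [setLIntegral_congr e3]
  refine setLIntegral_congr_fun measurableSet_Ioo fun r hr => ?_
  rw [setLIntegral_congr e4]
  have e5 : Ioc (-(ℓ / 2)) (ℓ / 2) = (fun t => θ + t) ⁻¹' Ioc (θ - ℓ / 2) (θ + ℓ / 2) := by
    ext t; simp [sub_eq_add_neg]
  rw [e5, ← (measurePreserving_add_left volume θ).setLIntegral_comp_preimage_emb
    (measurableEmbedding_addLeft θ)
    (fun t => ENNReal.ofReal r * F (r * Complex.exp (t * Complex.I)))]
  refine lintegral_congr fun t => ?_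
  simp only [G]
  rw [mul_left_comm, ← Complex.exp_add]
  push_cast
  ring_nf

theorem norm_mem_Ico {z : ℂ} (hz : z ∈ disc) : ‖z‖ ∈ Ico (0 : ℝ) 1 :=
  ⟨norm_nonneg z, by simpa [disc] using hz⟩

theorem carlesonSquare_two_pi : carlesonSquare 0 (2 * Real.pi) = disc := by
  rw [carlesonSquare_zero_eq (by positivity) le_rfl]
  ext z
  have h1 := Complex.abs_arg_le_pi z
  have h2 := Real.pi_gt_three
  have h3 := norm_nonneg z
  simp only [mem_Ico, mem_ofPred_eq, disc, mem_ball_zero_iff]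
  constructor
  · exact fun h => h.1.2
  · exact fun h => ⟨⟨by linarith, h⟩, by linarith⟩

theorem carlesonSquare_congr {θ φ : ℝ} (h : Circle.exp θ = Circle.exp φ) (ℓ : ℝ) :
    carlesonSquare θ ℓ = carlesonSquare φ ℓ := by
  rw [carlesonSquare_eq_preimage θ, carlesonSquare_eq_preimage φ, Circle.exp_neg, Circle.exp_neg, h]

theorem carlesonSquareAt_eq (θ : ℝ) {ℓ : ℝ} (h1 : ℓ < 1) :
    carlesonSquareAt (((1 - ℓ : ℝ) : ℂ) * Complex.exp (θ * Complex.I)) = carlesonSquare θ ℓ := by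
  set a : ℂ := ((1 - ℓ : ℝ) : ℂ) * Complex.exp (θ * Complex.I) with ha
  have hn : ‖a‖ = 1 - ℓ := norm_ofReal_mul_exp (by linarith) θ
  unfold carlesonSquareAt
  rw [hn, sub_sub_cancel]
  apply carlesonSquare_congr
  ext
  rw [Circle.coe_exp, Circle.coe_exp]
  have h2 := Complex.norm_mul_exp_arg_mul_I a
  rw [hn] at h2
  nth_rewrite 2 [ha] at h2
  exact mul_left_cancel₀ (by exact_mod_cast (by linarith : (1 - ℓ) ≠ 0)) h2

/-- Arcs of length 1/2 centred at `j/2 + 1/4`, `j < 13`, cover `[0, 13/2]`, and `13/2 > 2π`. -/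
theorem disc_subset_iUnion_carlesonSquare :
    disc ⊆ Metric.closedBall 0 (1 / 2) ∪
      ⋃ j : Fin 13, carlesonSquare ((j : ℕ) / 2 + 1 / 4) (1 / 2) := by
  intro z hz
  rcases le_or_gt ‖z‖ (1 / 2) with h | h
  · left; simpa using h
  right
  have hz1 := (norm_mem_Ico hz).2
  obtain ⟨t, ht0, ht1, ht⟩ : ∃ t : ℝ, 0 ≤ t ∧ t < 2 * Real.pi ∧
      z = (‖z‖ : ℂ) * Complex.exp (t * Complex.I) := by
    have h1 := Complex.neg_pi_lt_arg z
    have h2 := Complex.arg_le_pi z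
    have h3 := Real.pi_pos
    rcases le_or_gt 0 z.arg with h0 | h0
    · exact ⟨z.arg, h0, by linarith, (Complex.norm_mul_exp_arg_mul_I z).symm⟩
    · refine ⟨z.arg + 2 * Real.pi, by linarith, by linarith, ?_⟩
      push_cast
      rw [add_mul, Complex.exp_add, Complex.exp_two_pi_mul_I, mul_one,
        Complex.norm_mul_exp_arg_mul_I]
  have hj := Nat.floor_le (by linarith : 0 ≤ 2 * t)
  have hj' := Nat.lt_floor_add_one (2 * t)
  have hlt : ⌊2 * t⌋₊ < 13 := by
    rw [Nat.floor_lt (by linarith)]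
    have := Real.pi_lt_d2
    norm_num at this ⊢
    linarith
  refine mem_iUnion.2 ⟨⟨_, hlt⟩, ‖z‖, t, norm_nonneg z, by linarith, hz1, ?_, ht⟩
  rw [abs_le]
  constructor <;> linarith

theorem continuousOn_weight {ω : ℝ → ℝ} (hc : ContinuousOn ω (Ico 0 1)) :
    ContinuousOn (fun z : ℂ => ω ‖z‖) disc :=
  hc.comp (by fun_prop) fun _ hz => norm_mem_Ico hz

theorem ofReal_mem_disc {r : ℝ} (h : r ∈ Ico (0 : ℝ) 1) (t : ℝ) :
    (r : ℂ) * Complex.exp (t * Complex.I) ∈ disc := by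
  simpa [disc, abs_of_nonneg h.1] using h.2

/-- The Jacobian `r` cancels the singularity. This handles the `1/|z|` majorant of ω⋆ at the origin.
-/
theorem lintegral_inv_norm_lt_top : ∫⁻ z in disc, (ENNReal.ofReal ‖z‖)⁻¹ ∂areaDisc < ∞ := by
  rw [← carlesonSquare_two_pi, lintegral_carlesonSquare ?_ 0 (by positivity) le_rfl]
  · refine ENNReal.mul_lt_top (by simp) ?_
    have h1 : ∀ r ∈ Ioo (max (1 - 2 * Real.pi) 0) 1, ∫⁻ t in Ioc (0 - 2 * Real.pi / 2)
        (0 + 2 * Real.pi / 2), ENNReal.ofReal r *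
          (ENNReal.ofReal ‖(r : ℂ) * Complex.exp (t * Complex.I)‖)⁻¹ =
        ENNReal.ofReal (2 * Real.pi) := by
      intro r hr
      have hr0 : 0 < r := (le_max_right _ _).trans_lt hr.1
      simp only [norm_ofReal_mul_exp hr0.le]
      rw [ENNReal.mul_inv_cancel (by simpa using hr0) (by simp)]
      rw [lintegral_const, Measure.restrict_apply_univ, Real.volume_Ioc, one_mul]
      congr 1
      ring
    rw [setLIntegral_congr_fun measurableSet_Ioo h1]
    simp [ENNReal.mul_lt_top_iff]
  · exact (continuous_inv.comp (ENNReal.continuous_ofReal.comp continuous_norm)).continuousOn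

theorem exists_bound_deriv {g : ℂ → ℂ} (hg : g ∈ AnalyticDisc) {ρ : ℝ} (hρ : ρ < 1) :
    ∃ C : ℝ, 0 ≤ C ∧ ∀ z, ‖z‖ ≤ ρ → ‖deriv g z‖ ≤ C := by
  have hd : ContinuousOn (deriv g) disc :=
    (DifferentiableOn.deriv hg Metric.isOpen_ball).continuousOn
  obtain ⟨C, hC⟩ := (isCompact_closedBall (0 : ℂ) ρ).exists_bound_of_continuousOn
    (hd.mono (Metric.closedBall_subset_ball hρ))
  exact ⟨max C 0, le_max_right _ _, fun z hz => (hC z (by simpa using hz)).trans (le_max_left _ _)⟩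

theorem continuousOn_deriv {g : ℂ → ℂ} (hg : g ∈ AnalyticDisc) : ContinuousOn (deriv g) disc :=
  (DifferentiableOn.deriv hg Metric.isOpen_ball).continuousOn

/-! ### Mass and energy of Carleson squares; criteria for membership in 𝓒¹. -/

/-- The energy `∫_E |g'|² ω⋆ dA`. -/
noncomputable def energy (ω : ℝ → ℝ) (g : ℂ → ℂ) (E : Set ℂ) : ℝ≥0∞ :=
  ∫⁻ z in E, ENNReal.ofReal (‖deriv g z‖ ^ 2 * associatedWeight ω z) ∂areaDisc

theorem weightMass_carlesonSquare {ω : ℝ → ℝ} (h : IsContinuousWeight ω) (θ : ℝ) {ℓ : ℝ}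
    (h0 : 0 < ℓ) (h1 : ℓ ≤ 2 * Real.pi) :
    weightMass ω (carlesonSquare θ ℓ) = ENNReal.ofReal (Real.pi⁻¹ * ℓ) *
      ∫⁻ r in Ioo (max (1 - ℓ) 0) 1, ENNReal.ofReal r * ENNReal.ofReal (ω r) := by
  unfold weightMass
  rw [lintegral_carlesonSquare (F := fun z => ENNReal.ofReal (ω ‖z‖))
    (ENNReal.continuous_ofReal.comp_continuousOn (continuousOn_weight h.continuousOn)) θ h0 h1, ENNReal.ofReal_mul (by positivity), mul_assoc]
  congr 1
  rw [← lintegral_const_mul' _ _ (by simp)]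
  refine setLIntegral_congr_fun measurableSet_Ioo fun r hr => ?_
  have hr0 : 0 < r := (le_max_right _ _).trans_lt hr.1
  simp only [norm_ofReal_mul_exp hr0.le]
  rw [lintegral_const, Measure.restrict_apply_univ, Real.volume_Ioc, mul_comm]
  congr 2
  ring

theorem weightMass_le {ω : ℝ → ℝ} (h : IsContinuousWeight ω) (θ : ℝ) {ℓ : ℝ}
    (h0 : 0 < ℓ) (h1 : ℓ ≤ 2 * Real.pi) :
    weightMass ω (carlesonSquare θ ℓ) ≤
      ENNReal.ofReal (Real.pi⁻¹ * ℓ * tail ω (max (1 - ℓ) 0)) := by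
  rw [weightMass_carlesonSquare h θ h0 h1, ENNReal.ofReal_mul (p := Real.pi⁻¹ * ℓ) (by positivity)]
  gcongr
  rw [h.ofReal_tail ⟨le_max_right _ _, max_le (by linarith) zero_le_one⟩]
  refine setLIntegral_mono' measurableSet_Ioo fun r hr => ?_
  exact mul_le_of_le_one_left (by simp) (ENNReal.ofReal_le_one.2 hr.2.le)

/-- Since `x` may be 0, the Jacobian `r` is bounded below by 1/2 only past the midpoint `(1 + x)/2`;
doubling recovers the full tail. -/
theorem half_tail_le_lintegral {ω : ℝ → ℝ} {m : ℕ} (h : IsAdmissible ω m) {x : ℝ}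
    (hx : x ∈ Ico (0 : ℝ) 1) : ENNReal.ofReal ((2 ^ (m + 1))⁻¹ * tail ω x) ≤
      ∫⁻ r in Ioo x 1, ENNReal.ofReal r * ENNReal.ofReal (ω r) := by
  have hx0 := hx.1
  have hx1 := hx.2
  have h2 := h.tail_mid hx.1 hx.2
  calc ENNReal.ofReal ((2 ^ (m + 1))⁻¹ * tail ω x)
      ≤ ENNReal.ofReal (1 / 2 * tail ω ((1 + x) / 2)) := by
        apply ENNReal.ofReal_le_ofReal
        rw [inv_mul_le_iff₀ (by positivity), pow_succ]
        linarith
    _ = ENNReal.ofReal (1 / 2) * ∫⁻ r in Ioo ((1 + x) / 2) 1, ENNReal.ofReal (ω r) := by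
        rw [ENNReal.ofReal_mul (by positivity), h.ofReal_tail ⟨by linarith, by linarith⟩]
    _ = ∫⁻ r in Ioo ((1 + x) / 2) 1, ENNReal.ofReal (1 / 2) * ENNReal.ofReal (ω r) := by
        rw [lintegral_const_mul' _ _ (by simp)]
    _ ≤ ∫⁻ r in Ioo ((1 + x) / 2) 1, ENNReal.ofReal r * ENNReal.ofReal (ω r) := by
        refine setLIntegral_mono' measurableSet_Ioo fun r hr => ?_
        gcongr
        linarith [hr.1]
    _ ≤ _ := lintegral_mono_set (Ioo_subset_Ioo_left (by linarith))

theorem le_weightMass {ω : ℝ → ℝ} {m : ℕ} (h : IsAdmissible ω m) (θ : ℝ) {ℓ : ℝ}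
    (h0 : 0 < ℓ) (h1 : ℓ ≤ 2 * Real.pi) :
    ENNReal.ofReal (Real.pi⁻¹ * ℓ * ((2 ^ (m + 1))⁻¹ * tail ω (max (1 - ℓ) 0))) ≤
      weightMass ω (carlesonSquare θ ℓ) := by
  rw [weightMass_carlesonSquare h.toIsContinuousWeight θ h0 h1, ENNReal.ofReal_mul (by positivity)]
  gcongr
  exact half_tail_le_lintegral h ⟨le_max_right _ _, max_lt (by linarith) zero_lt_one⟩

theorem weightMass_pos {ω : ℝ → ℝ} {m : ℕ} (h : IsAdmissible ω m) (θ : ℝ) {ℓ : ℝ}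
    (h0 : 0 < ℓ) (h1 : ℓ ≤ 2 * Real.pi) : 0 < weightMass ω (carlesonSquare θ ℓ) := by
  refine lt_of_lt_of_le (ENNReal.ofReal_pos.2 ?_) (le_weightMass h θ h0 h1)
  have := h.tail_pos (le_max_right (1 - ℓ) 0) (max_lt (by linarith) zero_lt_one)
  positivity

theorem mem_cOneSpace_iff {ω : ℝ → ℝ} {m : ℕ} (h : IsAdmissible ω m) {g : ℂ → ℂ} :
    g ∈ cOneSpace ω ↔ g ∈ AnalyticDisc ∧ ∃ K : ℝ≥0, ∀ θ : ℝ, ∀ ℓ ∈ Ioc (0 : ℝ) (2 * Real.pi),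
      energy ω g (carlesonSquare θ ℓ) ≤ K * weightMass ω (carlesonSquare θ ℓ) := by
  refine and_congr_right fun hg => ?_
  unfold cOneNormSq
  constructor
  · intro hlt
    have h2 := (ENNReal.add_lt_top.1 hlt).2
    refine ⟨(⨆ (θ : ℝ) (ℓ ∈ Ioc (0 : ℝ) (2 * Real.pi)),
      (energy ω g (carlesonSquare θ ℓ)) / weightMass ω (carlesonSquare θ ℓ)).toNNReal,
      fun θ ℓ hℓ => ?_⟩
    rw [ENNReal.coe_toNNReal (show (⨆ (θ : ℝ) (ℓ ∈ Ioc (0 : ℝ) (2 * Real.pi)),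
      (energy ω g (carlesonSquare θ ℓ)) / weightMass ω (carlesonSquare θ ℓ)) ≠ ∞ from h2.ne), ← ENNReal.div_le_iff (weightMass_pos h θ hℓ.1 hℓ.2).ne'
      ((weightMass_le h.toIsContinuousWeight θ hℓ.1 hℓ.2).trans_lt ENNReal.ofReal_lt_top).ne]
    exact le_iSup₂_of_le θ ℓ (le_iSup_of_le hℓ le_rfl)
  · rintro ⟨K, hK⟩
    refine ENNReal.add_lt_top.2 ⟨ENNReal.ofReal_lt_top, lt_of_le_of_lt ?_ (ENNReal.coe_lt_top (r := K))⟩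
    exact iSup₂_le fun θ ℓ => iSup_le fun hℓ => ENNReal.div_le_of_le_mul (hK θ ℓ hℓ)

/-- Cover the disc by thirteen squares of side 1/2 and the ball of radius 1/2. On that ball `g'` is
bounded and ω⋆ is at most a constant over `|z|`. -/
theorem energy_disc_lt_top {ω : ℝ → ℝ} (h : IsContinuousWeight ω) {g : ℂ → ℂ}
    (hg : g ∈ AnalyticDisc) (hs : ∀ θ : ℝ, energy ω g (carlesonSquare θ (1 / 2)) < ∞) :
    energy ω g disc < ∞ := by
  obtain ⟨C, hC0, hC⟩ := exists_bound_deriv hg (by norm_num : (1 / 2 : ℝ) < 1)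
  have h1 : energy ω g (Metric.closedBall 0 (1 / 2)) < ∞ := by
    refine lt_of_le_of_lt ?_ (ENNReal.mul_lt_top (a := ENNReal.ofReal (C ^ 2 * tail ω 0))
      ENNReal.ofReal_lt_top lintegral_inv_norm_lt_top)
    rw [← lintegral_const_mul' _ _ (by simp)]
    refine le_trans ?_ (lintegral_mono_set (Metric.closedBall_subset_ball
      (by norm_num : (1 / 2 : ℝ) < 1)))
    refine setLIntegral_mono' Metric.isClosed_closedBall.measurableSet fun z hz => ?_
    have hz' : ‖z‖ ≤ 1 / 2 := by simpa using hz
    by_cases hz0 : z = 0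
    · simp [hz0, associatedWeight]
    have hz1 : 0 < ‖z‖ := norm_pos_iff.2 hz0
    rw [← ENNReal.ofReal_inv_of_pos hz1, ← ENNReal.ofReal_mul
      (mul_nonneg (by positivity) (h.tail_nonneg le_rfl zero_le_one))]
    apply ENNReal.ofReal_le_ofReal
    have h2 := h.associatedWeight_le hz0 (by linarith)
    have h3 := h.tail_anti le_rfl hz1.le (by linarith)
    have h4 := h.tail_nonneg hz1.le (by linarith)
    have h5 : associatedWeight ω z ≤ tail ω 0 * ‖z‖⁻¹ := by
      refine h2.trans ?_
      rw [div_eq_mul_inv]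
      gcongr
      nlinarith
    rw [mul_assoc]
    gcongr
    · exact h.associatedWeight_nonneg (by linarith)
    · exact hC z hz'
  refine lt_of_le_of_lt (lintegral_mono_set disc_subset_iUnion_carlesonSquare) ?_
  refine lt_of_le_of_lt (lintegral_union_le _ _ _) (ENNReal.add_lt_top.2 ⟨h1, ?_⟩)
  refine lt_of_le_of_lt (lintegral_iUnion_le _ _) ?_
  rw [tsum_fintype]
  exact ENNReal.sum_lt_top.2 fun j _ => hs _

/-- For longer arcs the energy is at most the finite total, while `ω(S(I))` is bounded below by the
positive constant `c`. Later estimates may thus assume `|z| ≥ 1/2` on the square. -/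
theorem mem_cOneSpace_of_small {ω : ℝ → ℝ} {m : ℕ} (h : IsAdmissible ω m) {g : ℂ → ℂ}
    (hg : g ∈ AnalyticDisc) {K : ℝ≥0} (hK : ∀ θ : ℝ, ∀ ℓ ∈ Ioc (0 : ℝ) (1 / 2),
      energy ω g (carlesonSquare θ ℓ) ≤ K * weightMass ω (carlesonSquare θ ℓ)) :
    g ∈ cOneSpace ω := by
  have hpi := Real.pi_gt_three
  have hT := energy_disc_lt_top h.toIsContinuousWeight hg fun θ =>
    (hK θ (1 / 2) ⟨by norm_num, le_rfl⟩).trans_lt (ENNReal.mul_lt_top ENNReal.coe_lt_top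
      ((weightMass_le h.toIsContinuousWeight θ (by norm_num) (by linarith)).trans_lt
        ENNReal.ofReal_lt_top))
  set c := Real.pi⁻¹ * (1 / 2) * ((2 ^ (m + 1))⁻¹ * tail ω (1 / 2))
  have hc : 0 < c := by
    have := h.tail_pos (by norm_num : (0 : ℝ) ≤ 1 / 2) (by norm_num)
    positivity
  have hc' : ENNReal.ofReal c ≠ 0 := by simpa using hc
  refine (mem_cOneSpace_iff h).2 ⟨hg, max K (energy ω g disc / ENNReal.ofReal c).toNNReal,
    fun θ ℓ hℓ => ?_⟩
  have hd : energy ω g disc / ENNReal.ofReal c ≠ ∞ := (ENNReal.div_lt_top hT.ne hc').ne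
  rw [ENNReal.coe_max, ENNReal.coe_toNNReal hd]
  rcases le_or_gt ℓ (1 / 2) with h1 | h1
  · exact (hK θ ℓ ⟨hℓ.1, h1⟩).trans (mul_le_mul_left (le_max_left _ _) _)
  · calc energy ω g (carlesonSquare θ ℓ) ≤ energy ω g disc :=
          lintegral_mono_set (carlesonSquare_subset_disc θ ℓ)
      _ = energy ω g disc / ENNReal.ofReal c * ENNReal.ofReal c :=
          (ENNReal.div_mul_cancel hc' (by simp)).symm
      _ ≤ _ := by
        refine mul_le_mul' (le_max_right _ _) ?_
        · refine le_trans (ENNReal.ofReal_le_ofReal ?_) (le_weightMass h θ hℓ.1 hℓ.2)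
          have := h.tail_anti (le_max_right (1 - ℓ) 0)
            (max_le (by linarith) (by norm_num) : max (1 - ℓ) 0 ≤ 1 / 2) (by norm_num)
          have h2 := h.tail_nonneg (by norm_num : (0 : ℝ) ≤ 1 / 2) (by norm_num)
          simp only [c]
          gcongr

/-! ### BMOA inside 𝓒¹. -/

theorem BMOA.exists_bound {g : ℂ → ℂ} (hg : g ∈ BMOA) : ∃ K : ℝ≥0, ∀ θ : ℝ, ∀ ℓ ∈ Ioo (0 : ℝ) 1,
    ∫⁻ z in carlesonSquare θ ℓ, ENNReal.ofReal (‖deriv g z‖ ^ 2 * (1 - ‖z‖ ^ 2)) ∂areaDisc ≤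
      K * ENNReal.ofReal ℓ := by
  have h1 := (ENNReal.add_lt_top.1 hg.2).1
  obtain ⟨K, hK, -⟩ := ENNReal.lt_iff_exists_nnreal_btwn.1 h1
  refine ⟨K, fun θ ℓ hℓ => ?_⟩
  · rw [← ENNReal.div_le_iff (by simpa using hℓ.1) (by simp), ← carlesonSquareAt_eq θ hℓ.2]
    refine le_trans ?_ hK.le
    have hn : ‖((1 - ℓ : ℝ) : ℂ) * Complex.exp (θ * Complex.I)‖ = 1 - ℓ :=
      norm_ofReal_mul_exp (by linarith [hℓ.2]) θ
    refine le_iSup₂_of_le (((1 - ℓ : ℝ) : ℂ) * Complex.exp (θ * Complex.I)) ⟨?_, ?_⟩ ?_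
    · rw [disc, mem_ball_zero_iff, hn]; linarith [hℓ.1]
    · rw [mem_singleton_iff, ← norm_eq_zero, hn]; linarith [hℓ.2]
    · rw [hn, sub_sub_cancel]

theorem one_sub_le_norm_of_mem {θ ℓ : ℝ} {z : ℂ} (hz : z ∈ carlesonSquare θ ℓ) :
    1 - ℓ ≤ ‖z‖ ∧ ‖z‖ < 1 := by
  obtain ⟨r, t, h0, h1, h2, -, rfl⟩ := hz
  rw [norm_ofReal_mul_exp h0]
  exact ⟨h1, h2⟩

/-- On a short square, ω⋆ is at most `2 (1 - |z|²) tail ω (1 - ℓ)`. The constant tail comes out of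
the integral, and `ℓ tail ω (1 - ℓ)` is comparable to the mass of the square. -/
theorem BMOA_subset_cOneSpace {ω : ℝ → ℝ} {m : ℕ} (h : IsAdmissible ω m) :
    BMOA ⊆ cOneSpace ω := by
  intro g hg
  obtain ⟨K, hK⟩ := BMOA.exists_bound hg
  have hpi := Real.pi_gt_three
  refine mem_cOneSpace_of_small h hg.1
    (K := (2 * (Real.pi * 2 ^ (m + 1))).toNNReal * K) fun θ ℓ hℓ => ?_
  have hm : max (1 - ℓ) 0 = 1 - ℓ := max_eq_left (by linarith [hℓ.2])
  have ht : 0 ≤ tail ω (1 - ℓ) := h.tail_nonneg (by linarith [hℓ.2]) (by linarith [hℓ.1])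
  calc energy ω g (carlesonSquare θ ℓ)
      ≤ ∫⁻ z in carlesonSquare θ ℓ, ENNReal.ofReal (2 * tail ω (1 - ℓ)) *
          ENNReal.ofReal (‖deriv g z‖ ^ 2 * (1 - ‖z‖ ^ 2)) ∂areaDisc := by
        refine setLIntegral_mono' (measurableSet_carlesonSquare hℓ.1 (by linarith [hℓ.2]))
          fun z hz => ?_
        obtain ⟨h1, h2⟩ := one_sub_le_norm_of_mem hz
        rw [← ENNReal.ofReal_mul (by positivity)]
        apply ENNReal.ofReal_le_ofReal
        have h3 := h.associatedWeight_le_two (by linarith [hℓ.2]) h2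
        have h4 := h.tail_anti (by linarith [hℓ.2]) h1 h2.le
        have h5 : (1 - ‖z‖) * tail ω ‖z‖ ≤ (1 - ‖z‖ ^ 2) * tail ω (1 - ℓ) := by
          gcongr
          · exact h.tail_nonneg (norm_nonneg z) h2.le
          · nlinarith [norm_nonneg z]
          · nlinarith [norm_nonneg z]
        calc _ ≤ ‖deriv g z‖ ^ 2 * (2 * ((1 - ‖z‖ ^ 2) * tail ω (1 - ℓ))) := by
              gcongr; linarith
          _ = _ := by ring
    _ = ENNReal.ofReal (2 * tail ω (1 - ℓ)) * ∫⁻ z in carlesonSquare θ ℓ,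
          ENNReal.ofReal (‖deriv g z‖ ^ 2 * (1 - ‖z‖ ^ 2)) ∂areaDisc :=
        lintegral_const_mul' _ _ ENNReal.ofReal_ne_top
    _ ≤ ENNReal.ofReal (2 * tail ω (1 - ℓ)) * (K * ENNReal.ofReal ℓ) := by
        gcongr
        exact hK θ ℓ ⟨hℓ.1, by linarith [hℓ.2]⟩
    _ = ENNReal.ofReal (2 * (Real.pi * 2 ^ (m + 1))) * K *
        ENNReal.ofReal (Real.pi⁻¹ * ℓ * ((2 ^ (m + 1))⁻¹ * tail ω (max (1 - ℓ) 0))) := by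
        rw [hm, mul_left_comm, mul_comm (ENNReal.ofReal (2 * (Real.pi * 2 ^ (m + 1)))), mul_assoc,
          ← ENNReal.ofReal_mul (by positivity), ← ENNReal.ofReal_mul (by positivity)]
        congr 2
        have := hℓ.1
        field_simp
    _ ≤ _ := by
        rw [ENNReal.coe_mul]
        exact mul_le_mul_right (le_weightMass h θ hℓ.1 (by linarith [hℓ.2])) _

/-! ### The Bloch space: equality for regular weights, inclusion in general. -/

theorem blochSpace.exists_bound {g : ℂ → ℂ} (hg : g ∈ blochSpace) :
    ∃ C : ℝ, 0 ≤ C ∧ ∀ z ∈ disc, ‖deriv g z‖ * (1 - ‖z‖) ≤ C := by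
  have h1 := (ENNReal.add_lt_top.1 hg.2).1
  obtain ⟨K, hK, -⟩ := ENNReal.lt_iff_exists_nnreal_btwn.1 h1
  refine ⟨K, K.2, fun z hz => ?_⟩
  · have h2 := (norm_mem_Ico hz).2
    calc ‖deriv g z‖ * (1 - ‖z‖) ≤ ‖deriv g z‖ * (1 - ‖z‖ ^ 2) := by
          gcongr
          nlinarith [norm_nonneg z]
      _ ≤ _ := by
          have h3 : ENNReal.ofReal (‖deriv g z‖ * (1 - ‖z‖ ^ 2)) ≤ K :=
            (le_iSup₂_of_le z hz le_rfl).trans hK.le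
          simpa using ENNReal.ofReal_le_iff_le_toReal ENNReal.coe_ne_top |>.1 h3

theorem mem_blochSpace_of_bound {g : ℂ → ℂ} (hg : g ∈ AnalyticDisc) {C : ℝ}
    (hC : ∀ z ∈ disc, ‖deriv g z‖ * (1 - ‖z‖) ≤ C) : g ∈ blochSpace := by
  refine ⟨hg, ENNReal.add_lt_top.2 ⟨lt_of_le_of_lt ?_ (ENNReal.ofReal_lt_top (r := 2 * C)),
    ENNReal.ofReal_lt_top⟩⟩
  refine iSup₂_le fun z hz => ENNReal.ofReal_le_ofReal ?_
  have h2 := (norm_mem_Ico hz).2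
  calc ‖deriv g z‖ * (1 - ‖z‖ ^ 2) ≤ ‖deriv g z‖ * (2 * (1 - ‖z‖)) := by
        gcongr
        nlinarith [norm_nonneg z]
    _ ≤ _ := by linarith [hC z hz]

/-- The upper bound on `ψ_ω` gives `ω⋆ ≤ 2C (1 - |z|)² ω` for `|z| ≥ 1/2`, so the two integrands
compare pointwise. -/
theorem blochSpace_subset_cOneSpace {ω : ℝ → ℝ} (hω : IsRegularWeight ω) :
    blochSpace ⊆ cOneSpace ω := by
  intro g hg
  obtain ⟨m, h⟩ := hω.exists_isAdmissible
  obtain ⟨B, hB0, hB⟩ := blochSpace.exists_bound hg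
  obtain ⟨c, hc, C, hC, hd⟩ := hω.distortion_comparable
  have hpi := Real.pi_gt_three
  refine mem_cOneSpace_of_small h hg.1 (K := (2 * B ^ 2 * C).toNNReal) fun θ ℓ hℓ => ?_
  unfold energy weightMass
  rw [← lintegral_const_mul' _ _ ENNReal.coe_ne_top]
  refine setLIntegral_mono' (measurableSet_carlesonSquare hℓ.1 (by linarith [hℓ.2]))
    fun z hz => ?_
  obtain ⟨h1, h2⟩ := one_sub_le_norm_of_mem hz
  have h0 := norm_nonneg z
  have hmem : ‖z‖ ∈ Ico (0 : ℝ) 1 := ⟨h0, h2⟩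
  have hωp := h.pos _ hmem
  change _ ≤ ENNReal.ofReal _ * _
  rw [← ENNReal.ofReal_mul (by positivity)]
  apply ENNReal.ofReal_le_ofReal
  have h3 := h.associatedWeight_le_two (by linarith [hℓ.2]) h2
  have h4 : tail ω ‖z‖ ≤ C * (1 - ‖z‖) * ω ‖z‖ := by
    rw [← h.mul_distortion hmem, mul_comm]
    gcongr
    exact (hd _ hmem).2
  have h5 := hB z (carlesonSquare_subset_disc _ _ hz)
  have h6 : 0 ≤ 1 - ‖z‖ := by linarith
  calc ‖deriv g z‖ ^ 2 * associatedWeight ω z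
      ≤ ‖deriv g z‖ ^ 2 * (2 * ((1 - ‖z‖) * (C * (1 - ‖z‖) * ω ‖z‖))) := by
        gcongr
        exact h3.trans (by gcongr)
    _ = (‖deriv g z‖ * (1 - ‖z‖)) ^ 2 * (2 * C * ω ‖z‖) := by ring
    _ ≤ B ^ 2 * (2 * C * ω ‖z‖) := by gcongr
    _ = _ := by ring

theorem ofReal_norm_center_le {f : ℂ → ℂ} {z : ℂ} {R r : ℝ}
    (hf : DifferentiableOn ℂ f (Metric.ball z R)) (hr0 : 0 < r) (hr : r < R) :
    ENNReal.ofReal (2 * Real.pi * ‖f z‖) ≤ ∫⁻ t in Ioc (-Real.pi) Real.pi,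
      ENNReal.ofReal ‖f (z + r * Complex.exp (t * Complex.I))‖ := by
  have hsub : Metric.closedBall z r ⊆ Metric.ball z R := Metric.closedBall_subset_ball hr
  have h1 : Real.circleAverage f z r = f z := by
    refine DiffContOnCl.circleAverage ?_
    rw [abs_of_pos hr0]
    refine DifferentiableOn.diffContOnCl (hf.mono ?_)
    rwa [closure_ball z hr0.ne']
  rw [Real.circleAverage_def, inv_smul_eq_iff₀ (by positivity)] at h1
  have h2 : ∫ t in (-Real.pi)..Real.pi, f (circleMap z r t) = (2 * Real.pi) • f z := by
    rw [← h1]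
    have hp : Function.Periodic (fun t => f (circleMap z r t)) (2 * Real.pi) :=
      fun t => by simp only [periodic_circleMap z r t]
    have := hp.intervalIntegral_add_eq (-Real.pi) 0
    rw [zero_add] at this
    rw [← this]
    congr 1
    ring
  have h3 : ENNReal.ofReal (2 * Real.pi * ‖f z‖) = ‖(2 * Real.pi) • f z‖ₑ := by
    rw [← ofReal_norm, norm_smul, Real.norm_of_nonneg (by positivity)]
  rw [h3, ← h2, intervalIntegral.integral_of_le (by linarith [Real.pi_pos])]
  refine (enorm_integral_le_lintegral_enorm _).trans (le_of_eq ?_)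
  simp only [circleMap, ofReal_norm]

/-- Integrate the mean value inequality on circles against `r dr`; in the normalized measure the
ball has area `R²`. -/
theorem ofReal_norm_center_mul_sq_le {f : ℂ → ℂ} {z : ℂ} {R : ℝ} (hR0 : 0 < R) (hR1 : R ≤ 1)
    (hf : DifferentiableOn ℂ f (Metric.ball z R)) (hd : Metric.ball z R ⊆ disc) :
    ENNReal.ofReal (‖f z‖ * R ^ 2) ≤
      ∫⁻ w in Metric.ball z R, ENNReal.ofReal ‖f w‖ ∂areaDisc := by
  set A : Set ℂ := {w : ℂ | ‖w‖ ∈ Ioo 0 R ∧ w.arg ∈ Ioc (-Real.pi) Real.pi} with hA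
  have hAeq : A = Metric.ball 0 R \ {0} := by
    ext w
    simp [hA, Complex.neg_pi_lt_arg, Complex.arg_le_pi]
    tauto
  have hAm : MeasurableSet A := by
    rw [hAeq]; exact Metric.isOpen_ball.measurableSet.diff (measurableSet_singleton 0)
  have hAd : A ⊆ disc := fun w hw => by
    simpa [disc] using hw.1.2.trans_le hR1
  have e1 : ∫⁻ w in Metric.ball z R, ENNReal.ofReal ‖f w‖ ∂areaDisc =
      ∫⁻ w in A, ENNReal.ofReal ‖f (z + w)‖ ∂areaDisc := by
    rw [setLIntegral_areaDisc Metric.isOpen_ball.measurableSet hd, setLIntegral_areaDisc hAm hAd]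
    congr 1
    have e2 : (fun w => z + w) ⁻¹' Metric.ball z R = Metric.ball 0 R := by
      ext w; simp
    rw [← (measurePreserving_add_left volume z).setLIntegral_comp_preimage_emb
      (measurableEmbedding_addLeft z) (fun w => ENNReal.ofReal ‖f w‖), e2, hAeq]
    exact (setLIntegral_congr (sdiff_null_ae_eq_self (measure_singleton 0))).symm
  have hcont : ContinuousOn (fun w => ENNReal.ofReal ‖f (z + w)‖) {w | ‖w‖ ∈ Ioo 0 R} := by
    refine ENNReal.continuous_ofReal.comp_continuousOn (hf.continuousOn.comp (by fun_prop)
      fun w hw => ?_).norm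
    simpa using hw.2
  rw [e1, lintegral_polar hcont measurableSet_Ioo measurableSet_Ioc
    (Ioo_subset_Ioo_right hR1) le_rfl]
  have e3 : ∀ r ∈ Ioo 0 R, ENNReal.ofReal (2 * Real.pi * ‖f z‖ * r) ≤ ∫⁻ t in Ioc (-Real.pi) Real.pi,
      ENNReal.ofReal r * ENNReal.ofReal ‖f (z + r * Complex.exp (t * Complex.I))‖ := by
    intro r hr
    rw [lintegral_const_mul' _ _ (by simp), mul_comm _ r, ENNReal.ofReal_mul hr.1.le]
    gcongr
    exact ofReal_norm_center_le hf hr.1 hr.2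
  refine le_trans ?_ (mul_le_mul_right (setLIntegral_mono' measurableSet_Ioo e3) _)
  rw [← ofReal_integral_eq_lintegral_ofReal, ← ENNReal.ofReal_mul (by positivity)]
  · apply ENNReal.ofReal_le_ofReal
    rw [← integral_Ioc_eq_integral_Ioo, ← intervalIntegral.integral_of_le hR0.le,
      intervalIntegral.integral_const_mul, integral_id]
    have := Real.pi_pos
    apply le_of_eq
    field_simp
    ring
  · exact ((continuous_const.mul continuous_id).integrableOn_Icc (a := 0) (b := R)).mono_set
      Ioo_subset_Icc_self
  · refine (ae_restrict_iff' measurableSet_Ioo).2 (ae_of_all _ fun r hr => ?_)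
    have := hr.1
    simp only [Pi.zero_apply]
    positivity

/-- Write `w = z (1 + u)` with `|u| ≤ (1 - r)/2`, using `r ≥ 1/2`. The angle between `w` and `z` is
the imaginary part of `log (1 + u)`, at most `(3/2)|u|`. -/
theorem ball_subset_carlesonSquare {r : ℝ} (h0 : 1 / 2 ≤ r) (h1 : r < 1) (θ : ℝ) :
    Metric.ball ((r : ℂ) * Complex.exp (θ * Complex.I)) ((1 - r) / 4) ⊆
      carlesonSquare θ (2 * (1 - r)) := by
  intro w hw
  set z : ℂ := (r : ℂ) * Complex.exp (θ * Complex.I) with hz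
  have hzn : ‖z‖ = r := norm_ofReal_mul_exp (by linarith) θ
  have hz0 : z ≠ 0 := norm_pos_iff.1 (by rw [hzn]; linarith)
  rw [Metric.mem_ball, dist_eq_norm] at hw
  have hwn := abs_norm_sub_norm_le w z
  rw [hzn] at hwn
  have hwn' := abs_le.1 (hwn.trans hw.le)
  set u : ℂ := (w - z) / z with hu
  have hun : ‖u‖ ≤ (1 - r) / 2 := by
    rw [hu, norm_div, hzn, div_le_iff₀ (by linarith)]
    nlinarith
  have hwu : w = z * (1 + u) := by rw [hu]; field_simp; ring
  have harg : |(1 + u).arg| ≤ 1 - r := by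
    have h2 := Complex.norm_log_one_add_half_le_self (z := u) (by linarith)
    have h3 := Complex.abs_im_le_norm (Complex.log (1 + u))
    rw [Complex.log_im] at h3
    linarith
  refine ⟨‖w‖, θ + (1 + u).arg, norm_nonneg w, by linarith, by linarith, by
    rw [add_sub_cancel_left]; linarith, ?_⟩
  have h4 := Complex.norm_mul_exp_arg_mul_I (1 + u)
  have h5 : ‖w‖ = r * ‖1 + u‖ := by rw [hwu, norm_mul, hzn]
  rw [h5]
  push_cast
  rw [add_mul, Complex.exp_add]
  calc w = z * (1 + u) := hwu
    _ = ((r : ℂ) * Complex.exp (θ * Complex.I)) *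
        (‖1 + u‖ * Complex.exp ((1 + u).arg * Complex.I)) := by rw [h4]
    _ = _ := by ring

/-- On a ball of radius `(1 - |z|)/4` doubling keeps ω⋆ above a multiple of `(1 - |z|) tail ω |z|`.
The mean value inequality for `(g')²` and the energy bound on a surrounding square then cancel the
tail. -/
theorem bloch_bound_of_energy {ω : ℝ → ℝ} {m : ℕ} (h : IsAdmissible ω m) {g : ℂ → ℂ}
    (hg : g ∈ AnalyticDisc) {K : ℝ≥0} (hK : ∀ θ : ℝ, ∀ ℓ ∈ Ioc (0 : ℝ) (2 * Real.pi),
      energy ω g (carlesonSquare θ ℓ) ≤ K * weightMass ω (carlesonSquare θ ℓ))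
    {z : ℂ} (hz0 : 1 / 2 ≤ ‖z‖) (hz1 : ‖z‖ < 1) :
    (‖deriv g z‖ * (1 - ‖z‖)) ^ 2 ≤ K * 2 ^ (4 * m + 8) := by
  have hpi := Real.pi_gt_three
  set r := ‖z‖ with hr
  have hzr : z = (r : ℂ) * Complex.exp (z.arg * Complex.I) := (Complex.norm_mul_exp_arg_mul_I z).symm
  set ρ := (1 - r) / 4 with hρ
  have hρ0 : 0 < ρ := by rw [hρ]; linarith
  have hsub : Metric.ball z ρ ⊆ carlesonSquare z.arg (2 * (1 - r)) := by
    have := ball_subset_carlesonSquare hz0 hz1 z.arg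
    rwa [← hzr] at this
  have hd : Metric.ball z ρ ⊆ disc := hsub.trans (carlesonSquare_subset_disc _ _)
  have hder : DifferentiableOn ℂ (fun w => deriv g w ^ 2) (Metric.ball z ρ) :=
    ((DifferentiableOn.deriv hg Metric.isOpen_ball).mono hd).pow 2
  have h1 := ofReal_norm_center_mul_sq_le hρ0 (by rw [hρ]; linarith) hder hd
  set c := (1 - r) * tail ω r / 2 ^ (2 * m + 2) with hc
  have ht := h.tail_pos (by linarith : 0 ≤ r) hz1
  have h1r : 0 < 1 - r := by linarith
  have hc0 : 0 < c := by positivity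
  have hlow : ∀ w ∈ Metric.ball z ρ, c ≤ associatedWeight ω w := by
    intro w hw
    rw [Metric.mem_ball, dist_eq_norm] at hw
    have hwn := abs_le.1 ((abs_norm_sub_norm_le w z).trans hw.le)
    rw [← hr, hρ] at hwn
    have hw0 : w ≠ 0 := norm_pos_iff.1 (by linarith)
    have h2 := h.le_associatedWeight hw0 (by linarith)
    have h3 : tail ω (r + (1 - r) / 4) ≤ tail ω ‖w‖ :=
      h.tail_anti (norm_nonneg w) (by linarith) (by linarith)
    have h4 : tail ω r ≤ 2 ^ m * tail ω (r + (1 - r) / 4) :=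
      h.tail_le_const 2 (by linarith) (by linarith) (by linarith) (by linarith)
    rw [hc, div_le_iff₀ (by positivity)]
    have h5 : (1 - r) / 2 * tail ω r ≤ (1 - ‖w‖) * (2 ^ m * tail ω ‖w‖) := by
      gcongr
      · linarith
      · linarith
      · exact h4.trans (by gcongr)
    calc (1 - r) * tail ω r = 2 * ((1 - r) / 2 * tail ω r) := by ring
      _ ≤ 2 * ((1 - ‖w‖) * (2 ^ m * tail ω ‖w‖)) := by gcongr
      _ = 2 * 2 ^ m * ((1 - ‖w‖) * tail ω ‖w‖) := by ring
      _ ≤ 2 * 2 ^ m * (2 ^ (m + 1) * associatedWeight ω w) := by gcongr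
      _ = _ := by ring
  have hℓ : 2 * (1 - r) ∈ Ioc (0 : ℝ) (2 * Real.pi) := ⟨by linarith, by linarith⟩
  have h6 : ENNReal.ofReal (c * (‖deriv g z ^ 2‖ * ρ ^ 2)) ≤
      ENNReal.ofReal (K * (Real.pi⁻¹ * (2 * (1 - r)) * (2 ^ m * tail ω r))) := by
    calc ENNReal.ofReal (c * (‖deriv g z ^ 2‖ * ρ ^ 2))
        = ENNReal.ofReal c * ENNReal.ofReal (‖deriv g z ^ 2‖ * ρ ^ 2) := ENNReal.ofReal_mul hc0.le
      _ ≤ ENNReal.ofReal c * ∫⁻ w in Metric.ball z ρ, ENNReal.ofReal ‖deriv g w ^ 2‖ ∂areaDisc := by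
          gcongr
      _ = ∫⁻ w in Metric.ball z ρ, ENNReal.ofReal c * ENNReal.ofReal ‖deriv g w ^ 2‖ ∂areaDisc :=
          (lintegral_const_mul' _ _ (by simp)).symm
      _ ≤ energy ω g (Metric.ball z ρ) := by
          refine setLIntegral_mono' Metric.isOpen_ball.measurableSet fun w hw => ?_
          rw [← ENNReal.ofReal_mul hc0.le, norm_pow, mul_comm]
          gcongr
          exact hlow w hw
      _ ≤ energy ω g (carlesonSquare z.arg (2 * (1 - r))) := lintegral_mono_set hsub
      _ ≤ K * weightMass ω (carlesonSquare z.arg (2 * (1 - r))) := hK _ _ hℓ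
      _ ≤ K * ENNReal.ofReal (Real.pi⁻¹ * (2 * (1 - r)) * tail ω (max (1 - 2 * (1 - r)) 0)) := by
          gcongr
          exact weightMass_le h.toIsContinuousWeight _ hℓ.1 hℓ.2
      _ ≤ K * ENNReal.ofReal (Real.pi⁻¹ * (2 * (1 - r)) * (2 ^ m * tail ω r)) := by
          gcongr
          rw [max_eq_left (by linarith)]
          exact h.tail_le_const 2 (by linarith) (by linarith) hz1 (by linarith)
      _ = _ := by
          rw [ENNReal.ofReal_mul (p := (K : ℝ)) K.2, ENNReal.ofReal_coe_nnreal]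
  rw [ENNReal.ofReal_le_ofReal_iff (by positivity), norm_pow] at h6
  have hpi' : Real.pi⁻¹ ≤ 1 := inv_le_one_of_one_le₀ (by linarith)
  have h7 : c * (‖deriv g z‖ ^ 2 * ρ ^ 2) ≤ K * (1 * (2 * (1 - r)) * (2 ^ m * tail ω r)) :=
    h6.trans (by gcongr)
  have h8 : c * (‖deriv g z‖ ^ 2 * ρ ^ 2) =
      ((1 - r) * tail ω r / 2 ^ (2 * m + 6)) * (‖deriv g z‖ * (1 - r)) ^ 2 := by
    rw [hc, hρ]; field_simp; ring
  rw [h8, ← le_div_iff₀' (by positivity)] at h7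
  calc (‖deriv g z‖ * (1 - r)) ^ 2 ≤ _ := h7
    _ = (K : ℝ) * 2 ^ (3 * m + 7) := by field_simp; ring
    _ ≤ K * 2 ^ (4 * m + 8) := by gcongr <;> linarith

theorem cOneSpace_subset_blochSpace {ω : ℝ → ℝ} {m : ℕ} (h : IsAdmissible ω m) :
    cOneSpace ω ⊆ blochSpace := by
  intro g hg
  obtain ⟨hgd, K, hK⟩ := (mem_cOneSpace_iff h).1 hg
  obtain ⟨C, hC0, hC⟩ := exists_bound_deriv hgd (by norm_num : (1 / 2 : ℝ) < 1)
  refine mem_blochSpace_of_bound hgd (C := max C (Real.sqrt (K * 2 ^ (4 * m + 8)))) fun z hz => ?_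
  have hz1 := (norm_mem_Ico hz).2
  rcases le_or_gt ‖z‖ (1 / 2) with h1 | h1
  · refine le_max_of_le_left ?_
    nlinarith [hC z h1, norm_nonneg z, norm_nonneg (deriv g z)]
  · exact le_max_of_le_right (Real.le_sqrt_of_sq_le (bloch_bound_of_energy h hgd hK h1.le hz1))

/-! ### Parseval's identity and a Littlewood–Paley inequality. -/

theorem integral_exp_eq_zero {N L : ℝ} (hN : N ≠ 0) (α : ℝ) (p : ℤ) (h : N * L = 2 * Real.pi * p) :
    ∫ t in α..(α + L), Complex.exp ((N * t : ℝ) * Complex.I) = 0 := by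
  have hc : (N : ℂ) * Complex.I ≠ 0 := by simp [hN]
  have e : ∀ t : ℝ, Complex.exp ((N * t : ℝ) * Complex.I) = Complex.exp ((N * Complex.I) * t) := by
    intro t; push_cast; ring_nf
  simp_rw [e]
  rw [integral_exp_mul_complex hc]
  have : (N : ℂ) * Complex.I * ((α + L : ℝ) : ℂ) =
      N * Complex.I * α + p * (2 * Real.pi * Complex.I) := by
    have h' : (N : ℂ) * L = 2 * Real.pi * p := by exact_mod_cast h
    push_cast
    linear_combination Complex.I * h'
  rw [this, Complex.exp_add, Complex.exp_int_mul_two_pi_mul_I]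
  simp

/-- Parseval's identity over an interval of length `L` for an absolutely convergent series of
exponentials with frequencies whose differences are multiples of `2π / L`. -/
theorem parseval {c : ℕ → ℂ} (hc : Summable fun k => ‖c k‖) {N : ℕ → ℝ}
    (hN : Function.Injective N) {L : ℝ} (hL : 0 ≤ L)
    (hp : ∀ j k, ∃ p : ℤ, (N j - N k) * L = 2 * Real.pi * p) (α : ℝ) :
    ∫⁻ t in Ioc α (α + L),
      ENNReal.ofReal (‖∑' k, c k * Complex.exp ((N k * t : ℝ) * Complex.I)‖ ^ 2) =
    ENNReal.ofReal L * ∑' k, ENNReal.ofReal (‖c k‖ ^ 2) := by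
  set S : ℝ → ℂ := fun t => ∑' k, c k * Complex.exp ((N k * t : ℝ) * Complex.I) with hS
  have hnorm : ∀ k t, ‖c k * Complex.exp ((N k * t : ℝ) * Complex.I)‖ = ‖c k‖ := fun k t => by
    rw [norm_mul, Complex.norm_exp_ofReal_mul_I, mul_one]
  have hScont : Continuous S :=
    continuous_tsum (fun k => by fun_prop) hc fun k t => (hnorm k t).le
  -- Expand `|S|²` as an absolutely convergent double series and integrate termwise; off the
  -- diagonal each term runs over whole periods and vanishes.
  set F : ℕ × ℕ → ℝ → ℂ := fun q t => c q.1 * Complex.exp ((N q.1 * t : ℝ) * Complex.I) *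
    (starRingEnd ℂ) (c q.2 * Complex.exp ((N q.2 * t : ℝ) * Complex.I)) with hF
  have hsum2 : Summable fun q : ℕ × ℕ => ‖c q.1‖ * ‖c q.2‖ :=
    hc.mul_of_nonneg hc (fun _ => norm_nonneg _) fun _ => norm_nonneg _
  have hFn : ∀ q t, ‖F q t‖ = ‖c q.1‖ * ‖c q.2‖ := fun q t => by
    simp only [hF]
    rw [norm_mul, RCLike.norm_conj, hnorm, hnorm]
  have hFsum : ∀ t, ∑' q, F q t = ((‖S t‖ ^ 2 : ℝ) : ℂ) := by
    intro t
    have h1 : Summable fun k => ‖c k * Complex.exp ((N k * t : ℝ) * Complex.I)‖ := by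
      simpa only [hnorm] using hc
    have h2 : Summable fun k =>
        ‖(starRingEnd ℂ) (c k * Complex.exp ((N k * t : ℝ) * Complex.I))‖ := by
      simpa only [RCLike.norm_conj] using h1
    rw [hF, ← tsum_mul_tsum_of_summable_norm h1 h2, ← Complex.conj_tsum, Complex.mul_conj,
      Complex.normSq_eq_norm_sq]
  have hFi : ∀ q, ∫ t in Ioc α (α + L), F q t = if q.1 = q.2 then ((‖c q.1‖ ^ 2 * L : ℝ) : ℂ) else 0 := by
    intro q
    have e : ∀ t : ℝ, F q t = c q.1 * (starRingEnd ℂ) (c q.2) *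
        Complex.exp (((N q.1 - N q.2) * t : ℝ) * Complex.I) := by
      intro t
      simp only [hF, map_mul, ← Complex.exp_conj, Complex.conj_I, Complex.conj_ofReal]
      rw [mul_mul_mul_comm, ← Complex.exp_add]
      push_cast
      ring_nf
    simp_rw [e]
    rw [integral_const_mul, ← intervalIntegral.integral_of_le (by linarith)]
    split_ifs with hq
    · rw [hq, Complex.mul_conj, Complex.normSq_eq_norm_sq]
      simp
    · obtain ⟨p, hp⟩ := hp q.1 q.2
      rw [integral_exp_eq_zero (sub_ne_zero.2 fun h => hq (hN h)) α p hp, mul_zero]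
  have hI : HasSum (fun q => ∫ t in Ioc α (α + L), F q t) (∫ t in Ioc α (α + L), ∑' q, F q t) := by
    refine hasSum_integral_of_summable_integral_norm (fun q => ?_) ?_
    · exact (Continuous.integrableOn_Icc (by simp only [hF]; fun_prop)).mono_set Ioc_subset_Icc_self
    · simp only [hFn, integral_const]
      exact hsum2.const_smul _
  simp only [hFi, hFsum] at hI
  rw [show (∫ t in Ioc α (α + L), ((‖S t‖ ^ 2 : ℝ) : ℂ)) =
    ((∫ t in Ioc α (α + L), ‖S t‖ ^ 2 : ℝ) : ℂ) from integral_ofReal] at hI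
  have hinj : Function.Injective fun k : ℕ => (k, k) := fun a b h => (Prod.mk.inj h).1
  rw [← hinj.hasSum_iff] at hI
  · have hI' : HasSum (fun k => ‖c k‖ ^ 2 * L) (∫ t in Ioc α (α + L), ‖S t‖ ^ 2) := by
      rw [← Complex.hasSum_ofReal]
      convert! hI using 1
      ext k
      simp
    rw [← ofReal_integral_eq_lintegral_ofReal, ← hI'.tsum_eq,
      ENNReal.ofReal_tsum_of_nonneg (fun k => by positivity) hI'.summable, ← ENNReal.tsum_mul_left]
    · congr 1
      ext k
      rw [mul_comm, ENNReal.ofReal_mul hL]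
    · exact (Continuous.integrableOn_Icc (hScont.norm.pow 2)).mono_set Ioc_subset_Icc_self
    · exact ae_of_all _ fun t => by positivity
  · rintro ⟨j, k⟩ hjk
    rw [if_neg]
    rintro h
    exact hjk ⟨j, by simpa using h⟩

theorem lintegral_disc {F : ℂ → ℝ≥0∞} (hF : ContinuousOn F disc) :
    ∫⁻ z in disc, F z ∂areaDisc =
      ENNReal.ofReal Real.pi⁻¹ * ∫⁻ r in Ioo (0 : ℝ) 1,
        ∫⁻ t in Ioc (-Real.pi) (-Real.pi + 2 * Real.pi),
          ENNReal.ofReal r * F (r * Complex.exp (t * Complex.I)) := by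
  have hpi := Real.pi_gt_three
  rw [← carlesonSquare_two_pi, lintegral_carlesonSquare hF 0 (by positivity) le_rfl,
    max_eq_right (by linarith)]
  congr! 6 <;> ring

theorem lintegral_sq_mul_radial {f : ℂ → ℂ} {a : ℕ → ℂ} (hfc : ContinuousOn f disc)
    (hf : ∀ z ∈ disc, HasSum (fun n => a n * z ^ n) (f z)) {v : ℝ → ℝ}
    (hv : ContinuousOn v (Ico 0 1)) (hv0 : ∀ r ∈ Ico (0 : ℝ) 1, 0 ≤ v r) :
    ∫⁻ z in disc, ENNReal.ofReal (‖f z‖ ^ 2 * v ‖z‖) ∂areaDisc =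
      ∑' n, ENNReal.ofReal (2 * ‖a n‖ ^ 2) *
        ∫⁻ r in Ioo (0 : ℝ) 1, ENNReal.ofReal (r ^ (2 * n + 1) * v r) := by
  rw [lintegral_disc]
  rotate_left
  · exact ENNReal.continuous_ofReal.comp_continuousOn
      ((hfc.norm.pow 2).mul (continuousOn_weight hv))
  have h1 : ∀ r ∈ Ioo (0 : ℝ) 1, ∫⁻ t in Ioc (-Real.pi) (-Real.pi + 2 * Real.pi),
      ENNReal.ofReal r * ENNReal.ofReal (‖f (r * Complex.exp (t * Complex.I))‖ ^ 2 *
        v ‖r * Complex.exp (t * Complex.I)‖) =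
      ENNReal.ofReal (2 * Real.pi) *
        ∑' n, ENNReal.ofReal (‖a n‖ ^ 2) * ENNReal.ofReal (r ^ (2 * n + 1) * v r) := by
    intro r hr
    have hvr := hv0 r ⟨hr.1.le, hr.2⟩
    have hr0 := hr.1
    have hs : Summable fun n => ‖a n * (r : ℂ) ^ n‖ := by
      have := (hf r (by simpa [disc, abs_of_pos hr.1] using hr.2)).summable
      exact this.norm
    have hP := parseval hs (N := fun n => (n : ℝ)) Nat.cast_injective
      (L := 2 * Real.pi) (by positivity) (fun j k => ⟨j - k, by push_cast; ring⟩) (-Real.pi)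
    have h2 : ∀ t : ℝ, ENNReal.ofReal r * ENNReal.ofReal (‖f (r * Complex.exp (t * Complex.I))‖ ^ 2 *
        v ‖r * Complex.exp (t * Complex.I)‖) = ENNReal.ofReal (r * v r) *
        ENNReal.ofReal (‖∑' n : ℕ, a n * (r : ℂ) ^ n *
          Complex.exp (((n : ℝ) * t : ℝ) * Complex.I)‖ ^ 2) := by
      intro t
      rw [norm_ofReal_mul_exp hr0.le, ← ENNReal.ofReal_mul hr0.le,
        ← ENNReal.ofReal_mul (by positivity),
        ← (hf _ (ofReal_mem_disc ⟨hr.1.le, hr.2⟩ t)).tsum_eq]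
      have e : ∀ n : ℕ, a n * ((r : ℂ) * Complex.exp (t * Complex.I)) ^ n =
          a n * (r : ℂ) ^ n * Complex.exp (((n : ℝ) * t : ℝ) * Complex.I) := by
        intro n
        rw [mul_pow, ← Complex.exp_nat_mul]
        push_cast
        ring_nf
      simp_rw [e]
      congr 1
      ring
    simp_rw [h2]
    rw [lintegral_const_mul' _ _ (by simp), hP, mul_left_comm, ← ENNReal.tsum_mul_left]
    congr 2
    ext n
    rw [← ENNReal.ofReal_mul (by positivity), ← ENNReal.ofReal_mul (by positivity), norm_mul,
      norm_pow, Complex.norm_real, Real.norm_of_nonneg hr0.le]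
    congr 1
    ring
  rw [setLIntegral_congr_fun measurableSet_Ioo h1, lintegral_const_mul' _ _ ENNReal.ofReal_ne_top,
    ← mul_assoc, ← ENNReal.ofReal_mul (by positivity), lintegral_tsum, ← ENNReal.tsum_mul_left]
  · congr 1
    ext n
    rw [lintegral_const_mul' _ _ (by simp), ← mul_assoc, ← ENNReal.ofReal_mul (by positivity)]
    congr 2
    field_simp
  · intro n
    refine AEMeasurable.const_mul (ContinuousOn.aemeasurable ?_ measurableSet_Ioo) _
    exact ENNReal.continuous_ofReal.comp_continuousOn
      ((by fun_prop : ContinuousOn (fun r : ℝ => r ^ (2 * n + 1)) _).mul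
        (hv.mono Ioo_subset_Ico_self))

theorem lintegral_pow_mul_sub {n : ℕ} {s : ℝ} (hs : 0 < s) :
    ∫⁻ r in Ioo 0 s, ENNReal.ofReal (r ^ n * (s - r)) =
      ENNReal.ofReal (s ^ (n + 2) / ((n + 1) * (n + 2))) := by
  rw [← ofReal_integral_eq_lintegral_ofReal]
  · congr 1
    rw [← integral_Ioc_eq_integral_Ioo, ← intervalIntegral.integral_of_le hs.le]
    have : ∀ r : ℝ, r ^ n * (s - r) = s * r ^ n - r ^ (n + 1) := fun r => by ring
    simp_rw [this]
    rw [intervalIntegral.integral_sub (Continuous.intervalIntegrable (by fun_prop) _ _)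
      (Continuous.intervalIntegrable (by fun_prop) _ _)]
    simp only [intervalIntegral.integral_const_mul, integral_pow]
    push_cast
    field_simp
    ring
  · exact (Continuous.integrableOn_Icc (by fun_prop)).mono_set Ioo_subset_Icc_self
  · refine (ae_restrict_iff' measurableSet_Ioo).2 (ae_of_all _ fun r hr => ?_)
    exact mul_nonneg (pow_nonneg hr.1.le _) (by linarith [hr.2])

/-- Tonelli on the triangle `r < s`; the inner integral of `r^n (s - r)` is explicit. This makes the
moments of the iterated tail comparable with those of `ω`. -/
theorem lintegral_pow_mul_tailMoment {ω : ℝ → ℝ} (h : IsContinuousWeight ω) (n : ℕ) :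
    ∫⁻ r in Ioo (0 : ℝ) 1, ENNReal.ofReal (r ^ n * tailMoment ω r) =
      ∫⁻ s in Ioo (0 : ℝ) 1, ENNReal.ofReal (ω s * (s ^ (n + 2) / ((n + 1) * (n + 2)))) := by
  set G : ℝ → ℝ → ℝ≥0∞ := fun r s =>
    {q : ℝ × ℝ | q.1 < q.2}.indicator (fun q => ENNReal.ofReal (q.1 ^ n * (q.2 - q.1)) *
      ENNReal.ofReal (ω q.2)) (r, s) with hG
  have hωm : AEMeasurable (fun s => ENNReal.ofReal (ω s)) (volume.restrict (Ioo (0 : ℝ) 1)) :=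
    ((h.continuousOn.mono Ioo_subset_Ico_self).aemeasurable measurableSet_Ioo).ennreal_ofReal
  have e1 : ∀ r ∈ Ioo (0 : ℝ) 1, ENNReal.ofReal (r ^ n * tailMoment ω r) =
      ∫⁻ s in Ioo (0 : ℝ) 1, G r s := by
    intro r hr
    rw [ENNReal.ofReal_mul (pow_nonneg hr.1.le _), h.ofReal_tailMoment ⟨hr.1.le, hr.2⟩,
      ← lintegral_const_mul' _ _ (by simp)]
    have : ∀ s, G r s = (Ioi r).indicator (fun s => ENNReal.ofReal (r ^ n * (s - r)) *
      ENNReal.ofReal (ω s)) s := fun s => by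
      simp only [hG, indicator_apply, mem_ofPred_eq, mem_Ioi]
    simp_rw [this]
    rw [setLIntegral_indicator measurableSet_Ioi]
    have hset : Ioi r ∩ Ioo 0 1 = Ioo r 1 := by
      ext s
      simp only [mem_inter_iff, mem_Ioi, mem_Ioo]
      exact ⟨fun h => ⟨h.1, h.2.2⟩, fun h => ⟨h.1, hr.1.trans h.1, h.2⟩⟩
    rw [hset]
    refine setLIntegral_congr_fun measurableSet_Ioo fun s hs => ?_
    have h1 : 0 < s - r := sub_pos.2 hs.1
    have h2 := hr.1
    rw [← ENNReal.ofReal_mul (by positivity), ← ENNReal.ofReal_mul (by positivity)]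
    congr 1
    ring
  have e2 : ∀ s ∈ Ioo (0 : ℝ) 1, ∫⁻ r in Ioo (0 : ℝ) 1, G r s =
      ENNReal.ofReal (ω s * (s ^ (n + 2) / ((n + 1) * (n + 2)))) := by
    intro s hs
    have : ∀ r, G r s = (Iio s).indicator (fun r => ENNReal.ofReal (r ^ n * (s - r)) *
      ENNReal.ofReal (ω s)) r := fun r => by
      simp only [hG, indicator_apply, mem_ofPred_eq, mem_Iio]
    simp_rw [this]
    rw [setLIntegral_indicator measurableSet_Iio]
    have hset : Iio s ∩ Ioo 0 1 = Ioo 0 s := by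
      ext r
      simp only [mem_inter_iff, mem_Iio, mem_Ioo]
      exact ⟨fun h => ⟨h.2.1, h.1⟩, fun h => ⟨h.2, h.1, h.2.trans hs.2⟩⟩
    rw [hset, lintegral_mul_const' _ _ (by simp), lintegral_pow_mul_sub hs.1, mul_comm,
      ENNReal.ofReal_mul (h.pos s ⟨hs.1.le, hs.2⟩).le]
  rw [setLIntegral_congr_fun measurableSet_Ioo e1, lintegral_lintegral_swap,
    setLIntegral_congr_fun measurableSet_Ioo e2]
  refine AEMeasurable.indicator ?_ (measurableSet_lt measurable_fst measurable_snd)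
  exact AEMeasurable.mul (by fun_prop) (hωm.comp_quasiMeasurePreserving
    Measure.quasiMeasurePreserving_snd)

theorem hasSum_taylor {f : ℂ → ℂ} (hf : f ∈ AnalyticDisc) {z : ℂ} (hz : z ∈ disc) :
    HasSum (fun n : ℕ => ((n.factorial : ℂ)⁻¹ * iteratedDeriv n f 0) * z ^ n) (f z) := by
  have := Complex.hasSum_taylorSeries_on_ball hf hz
  simp only [sub_zero, smul_eq_mul] at this
  convert! this using 1
  ext n
  ring

/-- A Littlewood–Paley inequality for radially weighted Bergman norms. -/
theorem lintegral_sq_le {ω : ℝ → ℝ} (h : IsContinuousWeight ω) {f : ℂ → ℂ}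
    (hf : f ∈ AnalyticDisc) :
    ∫⁻ z in disc, ENNReal.ofReal (‖f z‖ ^ 2 * ω ‖z‖) ∂areaDisc ≤
      ENNReal.ofReal (2 * ‖f 0‖ ^ 2) * ENNReal.ofReal (tail ω 0) + 6 *
        ∫⁻ z in disc, ENNReal.ofReal (‖deriv f z‖ ^ 2 * tailMoment ω ‖z‖) ∂areaDisc := by
  have hf' : deriv f ∈ AnalyticDisc := DifferentiableOn.deriv hf Metric.isOpen_ball
  rw [lintegral_sq_mul_radial hf.continuousOn (fun z hz => hasSum_taylor hf hz) h.continuousOn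
    (fun r hr => (h.pos r hr).le),
    lintegral_sq_mul_radial hf'.continuousOn (fun z hz => hasSum_taylor hf' hz)
      h.continuousOn_tailMoment (fun r hr => h.tailMoment_nonneg hr),
    tsum_eq_zero_add' ENNReal.summable, ← ENNReal.tsum_mul_left]
  refine add_le_add (mul_le_mul' (by simp) ?_) (ENNReal.tsum_le_tsum fun n => ?_)
  · rw [h.ofReal_tail ⟨le_rfl, zero_le_one⟩]
    refine setLIntegral_mono' measurableSet_Ioo fun r hr => ENNReal.ofReal_le_ofReal ?_
    have := h.pos r ⟨hr.1.le, hr.2⟩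
    have h1 : r ^ (2 * 0 + 1) ≤ 1 := pow_le_one₀ hr.1.le hr.2.le
    nlinarith
  · rw [lintegral_pow_mul_tailMoment h, ← lintegral_const_mul' _ _ ENNReal.ofReal_ne_top,
      ← lintegral_const_mul' _ _ ENNReal.ofReal_ne_top, ← lintegral_const_mul' _ _ (by simp)]
    refine setLIntegral_mono' measurableSet_Ioo fun r hr => ?_
    have hω := h.pos r ⟨hr.1.le, hr.2⟩
    have hr0 := hr.1
    have h6 : (6 : ℝ≥0∞) = ENNReal.ofReal 6 := by simp
    rw [h6, ← ENNReal.ofReal_mul (by positivity), ← ENNReal.ofReal_mul (by positivity),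
      ← ENNReal.ofReal_mul (by positivity), ← iteratedDeriv_succ']
    apply ENNReal.ofReal_le_ofReal
    rw [norm_mul, norm_mul, norm_inv, norm_inv, Complex.norm_natCast, Complex.norm_natCast,
      Nat.factorial_succ]
    push_cast
    set A := ‖iteratedDeriv (n + 1) f 0‖
    set q : ℝ := (n.factorial : ℝ) with hq
    have hq0 : 0 < q := by positivity
    have hn : (0 : ℝ) ≤ n := by positivity
    -- The constant 6 is what the case `n = 0` requires, where equality holds.
    have key : (1 : ℝ) ≤ 6 * (n + 1) ^ 2 / ((2 * n + 1 + 1) * (2 * n + 1 + 2)) := by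
      rw [le_div_iff₀ (by positivity)]
      nlinarith
    calc 2 * (((n + 1) * q)⁻¹ * A) ^ 2 * (r ^ (2 * (n + 1) + 1) * ω r)
        = 2 * (((n + 1) * q)⁻¹ * A) ^ 2 * (r ^ (2 * (n + 1) + 1) * ω r) * 1 := by ring
      _ ≤ 2 * (((n + 1) * q)⁻¹ * A) ^ 2 * (r ^ (2 * (n + 1) + 1) * ω r) *
          (6 * (n + 1) ^ 2 / ((2 * n + 1 + 1) * (2 * n + 1 + 2))) := by gcongr
      _ = _ := by
        field_simp
        ring

/-! ### Averages of Bloch functions, in logarithmic coordinates. -/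

section HalfPlane

variable {G : ℂ → ℂ} {B : ℝ} (hG : DifferentiableOn ℂ G {ζ | ζ.re < 0})
  (hB : ∀ ζ : ℂ, ζ.re < 0 → ‖deriv G ζ‖ ≤ B / (-ζ.re))
include hG hB

theorem halfPlane_norm_sub_le (hB0 : 0 ≤ B) {x : ℝ} (hx : x < 0) {p q : ℂ} (hp : p.re ≤ x)
    (hq : q.re ≤ x) : ‖G p - G q‖ ≤ B / (-x) * ‖p - q‖ := by
  have hconv : Convex ℝ {ζ : ℂ | ζ.re ≤ x} := convex_halfSpace_re_le x
  have hopen : IsOpen {ζ : ℂ | ζ.re < 0} := isOpen_lt Complex.continuous_re continuous_const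
  refine hconv.norm_image_sub_le_of_norm_deriv_le (fun ζ hζ => ?_) (fun ζ hζ => ?_) hq hp
  · exact hG.differentiableAt (hopen.mem_nhds (lt_of_le_of_lt hζ hx))
  · have hζ' : ζ.re ≤ x := hζ
    refine (hB ζ (by linarith)).trans ?_
    gcongr
    linarith

theorem halfPlane_horizontal_le {x₁ x τ : ℝ} (h1 : x₁ ≤ x) (hx : x < 0) :
    ‖G (x + τ * Complex.I) - G (x₁ + τ * Complex.I)‖ ≤ B * (Real.log (-x₁) - Real.log (-x)) := by
  have hopen : IsOpen {ζ : ℂ | ζ.re < 0} := isOpen_lt Complex.continuous_re continuous_const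
  have hre : ∀ s : ℝ, ((s : ℂ) + τ * Complex.I).re = s := fun s => by simp
  have hd : ∀ s ∈ Icc x₁ x, HasDerivAt (fun s : ℝ => G (s + τ * Complex.I))
      (deriv G (s + τ * Complex.I)) s := by
    intro s hs
    have h2 : HasDerivAt G (deriv G (s + τ * Complex.I)) (s + τ * Complex.I) :=
      (hG.differentiableAt (hopen.mem_nhds (by
        rw [mem_ofPred_eq, hre]; linarith [hs.2]))).hasDerivAt
    have h3 : HasDerivAt (fun s : ℂ => s + τ * Complex.I) 1 (s : ℂ) :=
      (hasDerivAt_id _).add_const _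
    have := (HasDerivAt.comp (s : ℂ) h2 h3).comp_ofReal
    simpa using this
  refine image_norm_le_of_norm_deriv_right_le_deriv_boundary' (a := x₁) (b := x)
    (f := fun s : ℝ => G (s + τ * Complex.I) - G (x₁ + τ * Complex.I))
    (f' := fun s => deriv G (s + τ * Complex.I))
    (B := fun s => B * (Real.log (-x₁) - Real.log (-s))) (B' := fun s => B / (-s))
    ?_ ?_ ?_ ?_ ?_ ?_ ⟨h1, le_rfl⟩
  · exact fun s hs => ((hd s hs).sub_const _).continuousAt.continuousWithinAt
  · exact fun s hs => ((hd s ⟨hs.1, hs.2.le⟩).sub_const _).hasDerivWithinAt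
  · simp
  · refine ContinuousOn.mul continuousOn_const (continuousOn_const.sub
      (ContinuousOn.log (by fun_prop) fun s hs => ?_))
    linarith [hs.2]
  · intro s hs
    have hs0 : s < 0 := hs.2.trans hx
    have h2 : HasDerivAt (fun s : ℝ => Real.log (-s)) (-1 / -s) s :=
      (hasDerivAt_neg s).log (by linarith)
    have h3 := ((h2.const_sub (Real.log (-x₁))).const_mul B).hasDerivWithinAt (s := Ici s)
    convert! h3 using 1
    field_simp
  · intro s hs
    have := hB (s + τ * Complex.I) (by rw [hre]; exact hs.2.trans hx)
    rwa [hre] at this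

/-- By Cauchy's theorem on a rectangle, the difference of the vertical integrals equals that of the
horizontal sides. There `G` grows at most logarithmically, which is integrable, so the bound does
not degenerate as `x` tends to 0. -/
theorem halfPlane_average_sub_le (hB0 : 0 ≤ B) {x₁ x α β : ℝ} (h1 : x₁ ≤ x) (hx : x < 0)
    (hαβ : α ≤ β) :
    ‖(∫ t in α..β, G (x + t * Complex.I)) - ∫ t in α..β, G (x₁ + t * Complex.I)‖ ≤
      B * (2 * (-x₁) + (β - α)) := by
  have hopen : IsOpen {ζ : ℂ | ζ.re < 0} := isOpen_lt Complex.continuous_re continuous_const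
  have hx1 : x₁ < 0 := h1.trans_lt hx
  have hline : ∀ τ : ℝ, ContinuousOn (fun s : ℝ => G (s + τ * Complex.I)) (uIcc x₁ x) := by
    intro τ
    refine hG.continuousOn.comp (by fun_prop) fun s hs => ?_
    rw [uIcc_of_le h1] at hs
    simpa using hs.2.trans_lt hx
  have hrect := Complex.integral_boundary_rect_eq_zero_of_differentiableOn G
    (x₁ + α * Complex.I) (x + β * Complex.I) (hG.mono fun ζ hζ => by
      have := hζ.1
      simp only [Complex.add_re, Complex.ofReal_re, Complex.mul_re, Complex.I_re, mul_zero,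
        Complex.ofReal_im, Complex.I_im, mul_one, sub_self, add_zero, mem_preimage,
        uIcc_of_le h1] at this
      exact this.2.trans_lt hx)
  simp only [Complex.add_re, Complex.ofReal_re, Complex.mul_re, Complex.I_re, mul_zero,
    Complex.ofReal_im, Complex.I_im, mul_one, sub_self, add_zero, Complex.add_im, Complex.mul_im,
    zero_add, smul_eq_mul] at hrect
  rw [← intervalIntegral.integral_sub (hline α).intervalIntegrable (hline β).intervalIntegrable]
    at hrect
  have h2 : ‖(∫ t in α..β, G (x + t * Complex.I)) - ∫ t in α..β, G (x₁ + t * Complex.I)‖ =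
      ‖∫ s in x₁..x, (G (s + α * Complex.I) - G (s + β * Complex.I))‖ := by
    have : (∫ s in x₁..x, (G (s + α * Complex.I) - G (s + β * Complex.I))) =
        -(Complex.I * ((∫ t in α..β, G (x + t * Complex.I)) -
          ∫ t in α..β, G (x₁ + t * Complex.I))) := by
      linear_combination hrect
    rw [this, norm_neg, norm_mul, Complex.norm_I, one_mul]
  rw [h2]
  have hlog : ContinuousOn (fun s : ℝ => Real.log (-s)) (uIcc x₁ x) := by
    refine ContinuousOn.log (by fun_prop) fun s hs => ?_
    rw [uIcc_of_le h1] at hs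
    linarith [hs.2]
  have hlogi : IntervalIntegrable (fun s : ℝ => Real.log (-s)) volume x₁ x := hlog.intervalIntegrable
  have h3 : ∀ s ∈ Ioc x₁ x, ‖G (s + α * Complex.I) - G (s + β * Complex.I)‖ ≤
      2 * B * (Real.log (-x₁) - Real.log (-s)) + B / (-x₁) * (β - α) := by
    intro s hs
    have ha := halfPlane_horizontal_le hG hB (τ := α) hs.1.le (hs.2.trans_lt hx)
    have hb := halfPlane_horizontal_le hG hB (τ := β) hs.1.le (hs.2.trans_lt hx)
    have hc := halfPlane_norm_sub_le hG hB hB0 hx1 (p := x₁ + α * Complex.I)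
      (q := x₁ + β * Complex.I) (by simp) (by simp)
    have hd : ‖((x₁ : ℂ) + α * Complex.I) - (x₁ + β * Complex.I)‖ = β - α := by
      rw [add_sub_add_left_eq_sub, ← sub_mul, norm_mul, Complex.norm_I, mul_one,
        ← Complex.ofReal_sub, Complex.norm_real, norm_sub_rev, Real.norm_of_nonneg (by linarith)]
    rw [hd] at hc
    have he : G (s + α * Complex.I) - G (s + β * Complex.I) =
        (G (s + α * Complex.I) - G (x₁ + α * Complex.I)) +
        (G (x₁ + α * Complex.I) - G (x₁ + β * Complex.I)) -
        (G (s + β * Complex.I) - G (x₁ + β * Complex.I)) := by ring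
    rw [he]
    refine (norm_sub_le _ _).trans ?_
    have := norm_add_le (G (s + α * Complex.I) - G (x₁ + α * Complex.I))
      (G (x₁ + α * Complex.I) - G (x₁ + β * Complex.I))
    linarith
  have hi : IntervalIntegrable (fun s : ℝ => 2 * B * (Real.log (-x₁) - Real.log (-s)) +
      B / (-x₁) * (β - α)) volume x₁ x :=
    ((intervalIntegrable_const.sub hlogi).const_mul _).add intervalIntegrable_const
  refine (intervalIntegral.norm_integral_le_of_norm_le h1 (ae_of_all _ h3) hi).trans ?_
  rw [intervalIntegral.integral_add ((intervalIntegrable_const.sub hlogi).const_mul _)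
    intervalIntegrable_const, intervalIntegral.integral_const_mul,
    intervalIntegral.integral_sub intervalIntegrable_const hlogi,
    intervalIntegral.integral_comp_neg (fun s => Real.log s), integral_log]
  simp only [intervalIntegral.integral_const, smul_eq_mul]
  have h5 : Real.log (-x) ≤ Real.log (-x₁) := Real.log_le_log (by linarith) (by linarith)
  have h6 : B / (-x₁) * (x - x₁) ≤ B := by
    rw [div_mul_eq_mul_div, div_le_iff₀ (by linarith)]
    nlinarith
  -- The left side is the integral of `log(-x₁) - log(-s)` over `[x₁, x]`.
  have h7 : (x - x₁) * Real.log (-x₁) - (-x₁ * Real.log (-x₁) - -x * Real.log (-x) - -x₁ + -x) ≤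
      -x₁ := by nlinarith
  calc _ = 2 * B * ((x - x₁) * Real.log (-x₁) -
          (-x₁ * Real.log (-x₁) - -x * Real.log (-x) - -x₁ + -x)) +
          B / (-x₁) * (x - x₁) * (β - α) := by ring
    _ ≤ 2 * B * (-x₁) + B * (β - α) := by
        gcongr
    _ = _ := by ring

end HalfPlane

theorem exp_mem_disc {ζ : ℂ} (h : ζ.re < 0) : Complex.exp ζ ∈ disc := by
  simpa [disc, Complex.norm_exp] using h

theorem exp_log_add {r : ℝ} (hr : 0 < r) (t : ℝ) :
    Complex.exp ((Real.log r : ℝ) + t * Complex.I) = r * Complex.exp (t * Complex.I) := by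
  rw [Complex.exp_add, ← Complex.ofReal_exp, Real.exp_log hr]

section Disc

variable {g : ℂ → ℂ} (hg : g ∈ AnalyticDisc) {B : ℝ} (hB0 : 0 ≤ B)
  (hB : ∀ z ∈ disc, ‖deriv g z‖ * (1 - ‖z‖) ≤ B)
include hg hB0 hB

/-- The averages of a Bloch function over circular arcs stay close to its values on the top half
of the corresponding Carleson square. -/
theorem bloch_average_sub_le {α β ρ r₀ t₀ : ℝ} (hℓ0 : α < β) (hℓ : β - α ≤ 1 / 2)
    (hρ : ρ ∈ Ico (1 - (β - α)) 1) (hr₀ : 1 - (β - α) ≤ r₀) (hr₀' : r₀ < 1 - (β - α) / 2)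
    (ht₀ : t₀ ∈ Icc α β) :
    ‖(∫ t in α..β, g (ρ * Complex.exp (t * Complex.I))) -
      (β - α) * g (r₀ * Complex.exp (t₀ * Complex.I))‖ ≤ 11 * B * (β - α) := by
  set ℓ := β - α with hℓdef
  have hℓpos : 0 < ℓ := sub_pos.2 hℓ0
  set G : ℂ → ℂ := fun ζ => g (Complex.exp ζ) with hGdef
  have hopen : IsOpen {ζ : ℂ | ζ.re < 0} := isOpen_lt Complex.continuous_re continuous_const
  have hGd : ∀ ζ : ℂ, ζ.re < 0 → HasDerivAt G (deriv g (Complex.exp ζ) * Complex.exp ζ) ζ :=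
    fun ζ hζ => HasDerivAt.comp ζ ((DifferentiableOn.differentiableAt hg
      (Metric.isOpen_ball.mem_nhds (exp_mem_disc hζ))).hasDerivAt) (Complex.hasDerivAt_exp ζ)
  have hG : DifferentiableOn ℂ G {ζ | ζ.re < 0} := fun ζ hζ =>
    (hGd ζ hζ).differentiableAt.differentiableWithinAt
  have hGB : ∀ ζ : ℂ, ζ.re < 0 → ‖deriv G ζ‖ ≤ B / (-ζ.re) := by
    intro ζ hζ
    rw [(hGd ζ hζ).deriv, norm_mul, Complex.norm_exp, le_div_iff₀ (by linarith)]
    have h1 := hB _ (exp_mem_disc hζ)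
    rw [Complex.norm_exp] at h1
    -- The inequality `u e^(-u) ≤ 1 - e^(-u)` converts the Bloch bound on the disc into the
    -- half-plane bound with the same constant.
    have h2 : Real.exp ζ.re * (-ζ.re) ≤ 1 - Real.exp ζ.re := by
      have h3 := Real.add_one_le_exp (-ζ.re)
      have h4 : Real.exp ζ.re * Real.exp (-ζ.re) = 1 := by rw [← Real.exp_add]; simp
      nlinarith [Real.exp_pos ζ.re]
    calc _ = ‖deriv g (Complex.exp ζ)‖ * (Real.exp ζ.re * (-ζ.re)) := by ring
      _ ≤ ‖deriv g (Complex.exp ζ)‖ * (1 - Real.exp ζ.re) := by gcongr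
      _ ≤ B := h1
  have hρ0 : 0 < ρ := by linarith [hρ.1]
  have hr0 : 0 < r₀ := by linarith
  have hr1 : 0 < 1 - ℓ := by linarith
  set x₁ := Real.log (1 - ℓ)
  set x := Real.log ρ
  set x₀ := Real.log r₀
  have hx : x < 0 := Real.log_neg hρ0 hρ.2
  have hx0 : x₀ < 0 := Real.log_neg hr0 (by linarith)
  have h1x : x₁ ≤ x := Real.log_le_log hr1 hρ.1
  have h1x0 : x₁ ≤ x₀ := Real.log_le_log hr1 hr₀
  have hx1 : -x₁ ≤ 2 * ℓ := by
    have := Real.one_sub_inv_le_log_of_pos hr1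
    have h2 : (1 - ℓ)⁻¹ ≤ 1 + 2 * ℓ := by
      rw [inv_le_iff_one_le_mul₀ hr1]; nlinarith
    linarith
  have hx0' : ℓ / 2 ≤ -x₀ := by
    have := Real.log_le_sub_one_of_pos hr0
    linarith
  have hav := halfPlane_average_sub_le hG hGB hB0 h1x hx hℓ0.le
  have e1 : ∀ t : ℝ, g (ρ * Complex.exp (t * Complex.I)) = G (x + t * Complex.I) := fun t => by
    simp only [hGdef]; rw [exp_log_add hρ0]
  have e2 : g (r₀ * Complex.exp (t₀ * Complex.I)) = G (x₀ + t₀ * Complex.I) := by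
    simp only [hGdef]; rw [exp_log_add hr0]
  simp_rw [e1, e2]
  have hcont : Continuous fun t : ℝ => G (x₁ + t * Complex.I) := by
    rw [← continuousOn_univ]
    exact hG.continuousOn.comp (by fun_prop) fun t _ => by simpa using h1x0.trans_lt hx0
  have e3 : (∫ t in α..β, G (x₁ + t * Complex.I)) - ℓ * G (x₀ + t₀ * Complex.I) =
      ∫ t in α..β, (G (x₁ + t * Complex.I) - G (x₀ + t₀ * Complex.I)) := by
    rw [intervalIntegral.integral_sub (hcont.intervalIntegrable _ _) intervalIntegrable_const,
      intervalIntegral.integral_const, Complex.real_smul]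
  have h4 : ‖(∫ t in α..β, G (x₁ + t * Complex.I)) - ℓ * G (x₀ + t₀ * Complex.I)‖ ≤ 6 * B * ℓ := by
    rw [e3]
    have := intervalIntegral.norm_integral_le_of_norm_le_const (a := α) (b := β) (C := 6 * B)
      (f := fun t : ℝ => G (x₁ + t * Complex.I) - G (x₀ + t₀ * Complex.I)) fun t ht => ?_
    · rwa [abs_of_pos hℓpos] at this
    rw [uIoc_of_le hℓ0.le] at ht
    refine (halfPlane_norm_sub_le hG hGB hB0 hx0 (by simpa using h1x0) (by simp)).trans ?_
    have h5 : ‖((x₁ : ℂ) + t * Complex.I) - (x₀ + t₀ * Complex.I)‖ ≤ 3 * ℓ := by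
      have : ((x₁ : ℂ) + t * Complex.I) - (x₀ + t₀ * Complex.I) =
          ((x₁ - x₀ : ℝ) : ℂ) + ((t - t₀ : ℝ) : ℂ) * Complex.I := by push_cast; ring
      rw [this]
      refine (norm_add_le _ _).trans ?_
      rw [norm_mul, Complex.norm_I, mul_one, Complex.norm_real, Complex.norm_real,
        Real.norm_eq_abs, Real.norm_eq_abs]
      have h6 : |x₁ - x₀| ≤ 2 * ℓ := abs_le.2 ⟨by linarith, by linarith⟩
      have h7 : |t - t₀| ≤ ℓ := abs_le.2 ⟨by linarith [ht.1, ht₀.2], by linarith [ht.2, ht₀.1]⟩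
      linarith
    calc B / (-x₀) * _ ≤ B / (ℓ / 2) * (3 * ℓ) := by gcongr
      _ = 6 * B := by field_simp; ring
  have e4 : (∫ t in α..β, G (x + t * Complex.I)) - ((β : ℂ) - α) * G (x₀ + t₀ * Complex.I) =
      ((∫ t in α..β, G (x + t * Complex.I)) - ∫ t in α..β, G (x₁ + t * Complex.I)) +
      ((∫ t in α..β, G (x₁ + t * Complex.I)) - ℓ * G (x₀ + t₀ * Complex.I)) := by
    rw [hℓdef]; push_cast; ring
  rw [e4]
  refine (norm_add_le _ _).trans ?_
  -- With `-x₁ ≤ 2ℓ` the constant is `4 + 1 + 6 = 11`: the first two terms move the arc to radius `1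
  -- - ℓ`, and the last one passes to the base point.
  calc _ ≤ B * (2 * (-x₁) + ℓ) + 6 * B * ℓ := add_le_add hav h4
    _ ≤ B * (2 * (2 * ℓ) + ℓ) + 6 * B * ℓ := by gcongr
    _ = _ := by ring

theorem bloch_lintegral_arc_ge {α β ρ r₀ t₀ : ℝ} (hℓ0 : α < β) (hℓ : β - α ≤ 1 / 2)
    (hρ : ρ ∈ Ico (1 - (β - α)) 1) (hr₀ : 1 - (β - α) ≤ r₀) (hr₀' : r₀ < 1 - (β - α) / 2)
    (ht₀ : t₀ ∈ Icc α β) :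
    ∫⁻ _ in Ioc α β, ENNReal.ofReal (‖g (r₀ * Complex.exp (t₀ * Complex.I))‖ - 11 * B) ≤
      ∫⁻ t in Ioc α β, ENNReal.ofReal ‖g (ρ * Complex.exp (t * Complex.I))‖ := by
  have hcont : Continuous fun t : ℝ => g (ρ * Complex.exp (t * Complex.I)) := by
    rw [← continuousOn_univ]
    refine (DifferentiableOn.continuousOn hg).comp (by fun_prop) fun t _ => ?_
    exact ofReal_mem_disc ⟨by linarith [hρ.1], hρ.2⟩ t
  have h1 := bloch_average_sub_le hg hB0 hB hℓ0 hℓ hρ hr₀ hr₀' ht₀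
  rw [lintegral_const, Measure.restrict_apply_univ, Real.volume_Ioc,
    ← ENNReal.ofReal_mul' (by linarith), ← ofReal_integral_eq_lintegral_ofReal]
  · apply ENNReal.ofReal_le_ofReal
    rw [← intervalIntegral.integral_of_le hℓ0.le]
    have h2 := intervalIntegral.norm_integral_le_integral_norm
      (f := fun t : ℝ => g (ρ * Complex.exp (t * Complex.I))) (μ := volume) hℓ0.le
    have h3 := norm_sub_norm_le (((β : ℂ) - α) * g (r₀ * Complex.exp (t₀ * Complex.I)))
      (∫ t in α..β, g (ρ * Complex.exp (t * Complex.I)))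
    rw [norm_sub_rev, norm_mul, ← Complex.ofReal_sub, Complex.norm_real,
      Real.norm_of_nonneg (by linarith)] at h3
    rw [← Complex.ofReal_sub] at h1
    linarith
  · exact hcont.norm.integrableOn_Icc.mono_set Ioc_subset_Icc_self
  · exact ae_of_all _ fun t => norm_nonneg _

/-- The arc estimate is uniform in the radius `ρ`, so it can be integrated against `ρ ω(ρ) dρ` for
any weight. -/
theorem bloch_lintegral_carlesonSquare_ge {ω : ℝ → ℝ} (h : IsContinuousWeight ω)
    {α β r₀ t₀ : ℝ} (hℓ0 : α < β) (hℓ : β - α ≤ 1 / 2) (hr₀ : 1 - (β - α) ≤ r₀)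
    (hr₀' : r₀ < 1 - (β - α) / 2) (ht₀ : t₀ ∈ Icc α β) :
    ENNReal.ofReal (‖g (r₀ * Complex.exp (t₀ * Complex.I))‖ - 11 * B) *
        weightMass ω (carlesonSquare ((α + β) / 2) (β - α)) ≤
      ∫⁻ z in carlesonSquare ((α + β) / 2) (β - α), ENNReal.ofReal (‖g z‖ * ω ‖z‖) ∂areaDisc := by
  have hpi := Real.pi_gt_three
  have hω := continuousOn_weight h.continuousOn
  unfold weightMass
  rw [lintegral_carlesonSquare (F := fun z => ENNReal.ofReal (ω ‖z‖))
      (ENNReal.continuous_ofReal.comp_continuousOn hω) _ (by linarith) (by linarith),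
    lintegral_carlesonSquare (F := fun z => ENNReal.ofReal (‖g z‖ * ω ‖z‖))
      (ENNReal.continuous_ofReal.comp_continuousOn
        ((DifferentiableOn.continuousOn hg).norm.mul hω)) _ (by linarith) (by linarith),
    mul_left_comm, ← lintegral_const_mul' _ _ ENNReal.ofReal_ne_top,
    show (α + β) / 2 - (β - α) / 2 = α by ring, show (α + β) / 2 + (β - α) / 2 = β by ring,
    max_eq_left (by linarith)]
  gcongr ENNReal.ofReal Real.pi⁻¹ * ?_
  refine setLIntegral_mono' measurableSet_Ioo fun ρ hρ => ?_
  have hρ0 : 0 < ρ := by linarith [hρ.1]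
  have hωρ := h.pos ρ ⟨hρ0.le, hρ.2⟩
  have e2 : ∀ t : ℝ, ENNReal.ofReal ρ * ENNReal.ofReal (‖g (ρ * Complex.exp (t * Complex.I))‖ *
      ω ‖ρ * Complex.exp (t * Complex.I)‖) = ENNReal.ofReal (ρ * ω ρ) *
      ENNReal.ofReal ‖g (ρ * Complex.exp (t * Complex.I))‖ := fun t => by
    rw [norm_ofReal_mul_exp hρ0.le, ← ENNReal.ofReal_mul hρ0.le, ← ENNReal.ofReal_mul (by positivity)]
    congr 1
    ring
  have e1 : ∀ t : ℝ, ENNReal.ofReal ρ * ENNReal.ofReal (ω ‖ρ * Complex.exp (t * Complex.I)‖) =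
      ENNReal.ofReal (ρ * ω ρ) := fun t => by
    rw [norm_ofReal_mul_exp hρ0.le, ← ENNReal.ofReal_mul hρ0.le]
  simp_rw [e1, e2]
  rw [lintegral_const_mul' _ _ ENNReal.ofReal_ne_top,
    ← lintegral_const_mul' _ _ ENNReal.ofReal_ne_top]
  calc _ = ∫⁻ _ in Ioc α β, ENNReal.ofReal (ρ * ω ρ) *
        ENNReal.ofReal (‖g (r₀ * Complex.exp (t₀ * Complex.I))‖ - 11 * B) := by
        simp_rw [mul_comm]
    _ ≤ _ := by
        rw [lintegral_const_mul' _ _ ENNReal.ofReal_ne_top]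
        gcongr ENNReal.ofReal (ρ * ω ρ) * ?_
        exact bloch_lintegral_arc_ge hg hB0 hB hℓ0 hℓ ⟨hρ.1.le, hρ.2⟩ hr₀ hr₀' ht₀

end Disc

/-! ### The stopping-time argument and integrability of all powers. -/

theorem lintegral_rpow_lt_top_of_meas_lt {X : Type*} [MeasurableSpace X] {μ ν : Measure X}
    {f : X → ℝ} (hf0 : ∀ x, 0 ≤ f x) (hfμ : AEMeasurable f μ) (hfν : AEMeasurable f ν)
    (hμ : μ univ < ∞) {t₀ : ℝ} (ht₀ : 0 ≤ t₀) {K : ℝ≥0∞} (hK : K < ∞)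
    (h : ∀ t, t₀ < t → ENNReal.ofReal t * μ {x | t < f x} ≤ K * ν {x | t < 4 * f x})
    {q : ℝ} (hq : 1 < q) (hν : ∫⁻ x, ENNReal.ofReal (f x ^ (q - 1)) ∂ν < ∞) :
    ∫⁻ x, ENNReal.ofReal (f x ^ q) ∂μ < ∞ := by
  rw [lintegral_rpow_eq_lintegral_meas_lt_mul μ (ae_of_all _ hf0) hfμ (by linarith)]
  refine ENNReal.mul_lt_top ENNReal.ofReal_lt_top ?_
  -- In the layer-cake formula, levels below `t₀` cost only the finite mass of `μ`. Above, `t^(q-1)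
  -- = t · t^(q-2)` and the hypothesis absorbs the factor `t`, leaving the layer-cake integral of
  -- `(4f)^(q-1)` against `ν`.
  rw [← Ioc_union_Ioi_eq_Ioi ht₀]
  refine (lintegral_union_le _ _ _).trans_lt (ENNReal.add_lt_top.2 ⟨?_, ?_⟩)
  · calc ∫⁻ t in Ioc 0 t₀, μ {x | t < f x} * ENNReal.ofReal (t ^ (q - 1))
        ≤ ∫⁻ _ in Ioc 0 t₀, μ univ * ENNReal.ofReal (t₀ ^ (q - 1)) := by
          refine setLIntegral_mono' measurableSet_Ioc fun t ht => ?_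
          refine mul_le_mul' (measure_mono (subset_univ _)) (ENNReal.ofReal_le_ofReal ?_)
          exact Real.rpow_le_rpow ht.1.le ht.2 (by linarith)
      _ < ∞ := by
          rw [lintegral_const, Measure.restrict_apply_univ, Real.volume_Ioc]
          exact ENNReal.mul_lt_top (ENNReal.mul_lt_top hμ ENNReal.ofReal_lt_top)
            ENNReal.ofReal_lt_top
  · have h4 : ∫⁻ x, ENNReal.ofReal ((4 * f x) ^ (q - 1)) ∂ν < ∞ := by
      have : ∀ x, ENNReal.ofReal ((4 * f x) ^ (q - 1)) =
          ENNReal.ofReal (4 ^ (q - 1)) * ENNReal.ofReal (f x ^ (q - 1)) := fun x => by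
        rw [Real.mul_rpow (by norm_num) (hf0 x), ENNReal.ofReal_mul (by positivity)]
      simp_rw [this]
      rw [lintegral_const_mul' _ _ ENNReal.ofReal_ne_top]
      exact ENNReal.mul_lt_top ENNReal.ofReal_lt_top hν
    rw [lintegral_rpow_eq_lintegral_meas_lt_mul ν
      (ae_of_all _ fun x => mul_nonneg (by norm_num : (0 : ℝ) ≤ 4) (hf0 x)) (hfν.const_mul 4)
      (by linarith)] at h4
    have h5 : ∫⁻ t in Ioi 0, ν {x | t < 4 * f x} * ENNReal.ofReal (t ^ (q - 1 - 1)) < ∞ :=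
      ENNReal.lt_top_of_mul_ne_top_right h4.ne (by simpa using hq)
    calc ∫⁻ t in Ioi t₀, μ {x | t < f x} * ENNReal.ofReal (t ^ (q - 1))
        ≤ ∫⁻ t in Ioi t₀, K * (ν {x | t < 4 * f x} * ENNReal.ofReal (t ^ (q - 1 - 1))) := by
          refine setLIntegral_mono' measurableSet_Ioi fun t ht => ?_
          have ht0 : 0 < t := ht₀.trans_lt ht
          have e : t ^ (q - 1) = t * t ^ (q - 1 - 1) := by
            rw [Real.rpow_sub_one ht0.ne' (q - 1)]; field_simp
          rw [e, ENNReal.ofReal_mul ht0.le, ← mul_assoc, ← mul_assoc, mul_comm (μ _)]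
          exact mul_le_mul_left (h t ht) _
      _ ≤ ∫⁻ t in Ioi 0, K * (ν {x | t < 4 * f x} * ENNReal.ofReal (t ^ (q - 1 - 1))) :=
          lintegral_mono_set (Ioi_subset_Ioi ht₀)
      _ < ∞ := by
          rw [lintegral_const_mul' _ _ hK.ne]
          exact ENNReal.mul_lt_top hK h5

/-- The half-open polar rectangle over the arguments in `(α, β]`. -/
def sector (α β : ℝ) : Set ℂ := {z | ‖z‖ ∈ Ico (1 - (β - α)) 1 ∧ z.arg ∈ Ioc α β}

theorem measurableSet_sector (α β : ℝ) : MeasurableSet (sector α β) :=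
  (measurable_norm measurableSet_Ico).inter (Complex.measurable_arg measurableSet_Ioc)

theorem sector_neg_pi_pi : sector (-Real.pi) Real.pi = disc := by
  ext z
  have h1 := Complex.neg_pi_lt_arg z
  have h2 := Complex.arg_le_pi z
  have h3 := Real.pi_gt_three
  have h4 := norm_nonneg z
  simp only [sector, mem_Ico, mem_Ioc, mem_ofPred_eq, disc, mem_ball_zero_iff]
  constructor
  · exact fun h => h.1.2
  · exact fun h => ⟨⟨by linarith, h⟩, h1, h2⟩

theorem sector_subset_carlesonSquare (α β : ℝ) :
    sector α β ⊆ carlesonSquare ((α + β) / 2) (β - α) := fun z hz => by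
  refine ⟨‖z‖, z.arg, norm_nonneg z, hz.1.1, hz.1.2, abs_le.2 ⟨?_, ?_⟩,
    (Complex.norm_mul_exp_arg_mul_I z).symm⟩ <;> linarith [hz.2.1, hz.2.2]

/-- Containment together with equal finite area. Half-open sectors are needed for disjoint dyadic
splitting, closed squares for the hypothesis on the energy. -/
theorem sector_ae_eq {α β : ℝ} (hα : -Real.pi ≤ α) (hαβ : α < β) (hβ : β ≤ Real.pi)
    (hℓ : β - α ≤ 1 / 2) :
    sector α β =ᵐ[areaDisc] carlesonSquare ((α + β) / 2) (β - α) := by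
  have hpi := Real.pi_gt_three
  have h1 : ∫⁻ z in sector α β, (1 : ℝ≥0∞) ∂areaDisc =
      ∫⁻ z in carlesonSquare ((α + β) / 2) (β - α), 1 ∂areaDisc := by
    rw [lintegral_carlesonSquare continuousOn_const _ (by linarith) (by linarith)]
    unfold sector
    rw [lintegral_polar continuousOn_const measurableSet_Ico measurableSet_Ioc
      (fun x hx => ⟨by linarith [hx.1], hx.2⟩) (Ioc_subset_Ioc hα hβ),
      show (α + β) / 2 - (β - α) / 2 = α by ring, show (α + β) / 2 + (β - α) / 2 = β by ring,
      max_eq_left (by linarith), setLIntegral_congr Ioo_ae_eq_Ico]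
  rw [setLIntegral_one, setLIntegral_one] at h1
  refine ae_eq_of_subset_of_measure_ge (sector_subset_carlesonSquare α β) h1.ge
    (measurableSet_sector α β).nullMeasurableSet ?_
  rw [← setLIntegral_one, setLIntegral_areaDisc (measurableSet_carlesonSquare (by linarith)
    (by linarith)) (carlesonSquare_subset_disc _ _), setLIntegral_one]
  refine ENNReal.mul_ne_top ENNReal.ofReal_ne_top (ne_top_of_le_ne_top ?_
    (measure_mono (carlesonSquare_subset_disc _ _)))
  exact measure_ball_lt_top.ne

/-- A stopping-time comparison: if every polar rectangle whose top half meets `S` has smaller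
`μ`-measure than `ν`-measure, then `μ S ≤ ν disc`. -/
theorem measure_inter_le_of_sector {μ ν : Measure ℂ} {S : Set ℂ}
    (h : ∀ α β : ℝ, -Real.pi ≤ α → α < β → β ≤ Real.pi →
      (∃ z ∈ sector α β, ‖z‖ < 1 - (β - α) / 2 ∧ z ∈ S) → μ (sector α β) ≤ ν (sector α β)) :
    μ (disc ∩ S) ≤ ν disc := by
  -- Truncating at distance `(β - α)/2^N` from the circle makes the selection of maximal rectangles
  -- a finite induction on the number of halvings.
  have key : ∀ N : ℕ, ∀ α β : ℝ, -Real.pi ≤ α → α < β → β ≤ Real.pi →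
      μ (sector α β ∩ (S ∩ {z | ‖z‖ < 1 - (β - α) / 2 ^ N})) ≤ ν (sector α β) := by
    intro N
    induction N with
    | zero =>
      intro α β _ _ _
      have : sector α β ∩ (S ∩ {z | ‖z‖ < 1 - (β - α) / 2 ^ 0}) = ∅ := by
        rw [eq_empty_iff_forall_notMem]
        rintro z ⟨hz, -, hz2⟩
        simp only [pow_zero, div_one, mem_ofPred_eq] at hz2
        linarith [hz.1.1]
      rw [this, measure_empty]
      exact bot_le
    | succ N ih =>
      intro α β hα hαβ hβ
      by_cases hex : ∃ z ∈ sector α β, ‖z‖ < 1 - (β - α) / 2 ∧ z ∈ S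
      · exact (measure_mono inter_subset_left).trans (h α β hα hαβ hβ hex)
      -- If `S` misses the top half, its points lie in the two half-width children, which are
      -- disjoint and contained in the parent.
      · push Not at hex
        set γ := (α + β) / 2 with hγ
        have h1 := ih α γ hα (by linarith) (by linarith)
        have h2 := ih γ β (by linarith) (by linarith) hβ
        have e1 : γ - α = (β - α) / 2 := by rw [hγ]; ring
        have e2 : β - γ = (β - α) / 2 := by rw [hγ]; ring
        have e3 : (β - α) / 2 / 2 ^ N = (β - α) / 2 ^ (N + 1) := by rw [pow_succ]; field_simp
        rw [e1, e3] at h1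
        rw [e2, e3] at h2
        have hsub : sector α β ∩ (S ∩ {z | ‖z‖ < 1 - (β - α) / 2 ^ (N + 1)}) ⊆
            sector α γ ∩ (S ∩ {z | ‖z‖ < 1 - (β - α) / 2 ^ (N + 1)}) ∪
            sector γ β ∩ (S ∩ {z | ‖z‖ < 1 - (β - α) / 2 ^ (N + 1)}) := by
          rintro z ⟨hz, hzS, hz2⟩
          have hge : 1 - (β - α) / 2 ≤ ‖z‖ := by
            by_contra hlt
            exact hex z hz (not_le.1 hlt) hzS
          rcases le_or_gt z.arg γ with hle | hlt
          · exact Or.inl ⟨⟨⟨by rw [e1]; exact hge, hz.1.2⟩, hz.2.1, hle⟩, hzS, hz2⟩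
          · exact Or.inr ⟨⟨⟨by rw [e2]; exact hge, hz.1.2⟩, hlt, hz.2.2⟩, hzS, hz2⟩
        have hdisj : Disjoint (sector α γ) (sector γ β) := by
          rw [Set.disjoint_left]
          intro z hz hz'
          exact absurd hz.2.2 (not_le.2 hz'.2.1)
        calc _ ≤ _ := measure_mono hsub
          _ ≤ _ := measure_union_le _ _
          _ ≤ ν (sector α γ) + ν (sector γ β) := add_le_add h1 h2
          _ = ν (sector α γ ∪ sector γ β) :=
            (measure_union hdisj (measurableSet_sector γ β)).symm
          _ ≤ ν (sector α β) := by
            refine measure_mono (union_subset (fun z hz => ?_) fun z hz => ?_)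
            · exact ⟨⟨by linarith [hz.1.1], hz.1.2⟩, hz.2.1, by linarith [hz.2.2]⟩
            · exact ⟨⟨by linarith [hz.1.1], hz.1.2⟩, by linarith [hz.2.1], hz.2.2⟩
  have hpi := Real.pi_pos
  rw [← sector_neg_pi_pi]
  have hU : sector (-Real.pi) Real.pi ∩ S = ⋃ N : ℕ, sector (-Real.pi) Real.pi ∩
      (S ∩ {z | ‖z‖ < 1 - (Real.pi - -Real.pi) / 2 ^ N}) := by
    refine subset_antisymm (fun z hz => ?_) (iUnion_subset fun N => ?_)
    · have h1 : 0 < (1 - ‖z‖) / (Real.pi - -Real.pi) := div_pos (by linarith [hz.1.1.2]) (by linarith)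
      obtain ⟨N, hN⟩ := exists_pow_lt_of_lt_one h1 (by norm_num : (1 / 2 : ℝ) < 1)
      refine mem_iUnion.2 ⟨N, hz.1, hz.2, ?_⟩
      rw [lt_div_iff₀ (by linarith)] at hN
      rw [mem_ofPred_eq, div_eq_mul_inv, ← inv_pow, ← one_div]
      linarith
    · exact inter_subset_inter_right _ inter_subset_left
  have hmono : Monotone fun N : ℕ => sector (-Real.pi) Real.pi ∩
      (S ∩ {z : ℂ | ‖z‖ < 1 - (Real.pi - -Real.pi) / 2 ^ N}) := by
    intro N M hNM
    refine inter_subset_inter_right _ (inter_subset_inter_right _ fun z hz => ?_)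
    rw [mem_ofPred_eq] at hz ⊢
    refine hz.trans_le ?_
    gcongr
    · linarith
    · norm_num
  rw [hU, hmono.measure_iUnion]
  exact iSup_le fun N => key N _ _ le_rfl (by linarith) le_rfl

instance : SFinite areaDisc := by unfold areaDisc; infer_instance

theorem measurableSet_disc : MeasurableSet disc := Metric.isOpen_ball.measurableSet

theorem areaDisc_restrict_disc : areaDisc.restrict disc = areaDisc := by
  unfold areaDisc
  rw [Measure.restrict_smul, Measure.restrict_restrict measurableSet_disc, inter_self]

theorem areaDisc_compl_disc : areaDisc discᶜ = 0 := by
  rw [← areaDisc_restrict_disc, Measure.restrict_apply measurableSet_disc.compl]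
  simp

theorem aemeasurable_areaDisc {E : Type*} [TopologicalSpace E] [MeasurableSpace E] [BorelSpace E]
    {F : ℂ → E} (hF : ContinuousOn F disc) : AEMeasurable F areaDisc := by
  rw [← areaDisc_restrict_disc]
  exact hF.aemeasurable measurableSet_disc

/-- The measure `|g'|² Φ dA`, where `Φ` is the iterated tail of `ω`. -/
noncomputable def energyMeasure (ω : ℝ → ℝ) (g : ℂ → ℂ) : Measure ℂ :=
  areaDisc.withDensity fun z => ENNReal.ofReal (‖deriv g z‖ ^ 2 * tailMoment ω ‖z‖)

/-- The measure `|g| ω dA`. -/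
noncomputable def modulusMeasure (ω : ℝ → ℝ) (g : ℂ → ℂ) : Measure ℂ :=
  areaDisc.withDensity fun z => ENNReal.ofReal (‖g z‖ * ω ‖z‖)

theorem energyMeasure_le_energy {ω : ℝ → ℝ} (h : IsContinuousWeight ω) (g : ℂ → ℂ) {E : Set ℂ}
    (hE : MeasurableSet E) (hEd : E ⊆ disc) : energyMeasure ω g E ≤ energy ω g E := by
  unfold energyMeasure energy
  rw [withDensity_apply']
  refine lintegral_mono_ae ((ae_restrict_iff' hE).2 ?_)
  have h0 : ∀ᵐ z ∂areaDisc, z ≠ 0 := by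
    simp [ae_iff, measure_singleton]
  filter_upwards [h0] with z hz hzE
  apply ENNReal.ofReal_le_ofReal
  gcongr
  exact h.tailMoment_le_associatedWeight hz (norm_mem_Ico (hEd hzE)).2

/-- A weak-type Carleson embedding. If `|g| > t` at a point of the top half of a square `Q`, then
`|g|` has `ω`-average at least `3t/4` on `Q`. Points with `|g| ≤ t/4` contribute at most `t/4`, so
the rest of `Q` carries `ν`-mass at least `(t/2) ω(Q)`, while `μ(Q) ≤ K ω(Q)`. -/
theorem energyMeasure_meas_lt_le {ω : ℝ → ℝ} (h : IsContinuousWeight ω) {g : ℂ → ℂ}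
    (hg : g ∈ AnalyticDisc) {K : ℝ≥0} (hK : ∀ θ : ℝ, ∀ ℓ ∈ Ioc (0 : ℝ) (2 * Real.pi),
      energy ω g (carlesonSquare θ ℓ) ≤ K * weightMass ω (carlesonSquare θ ℓ))
    {B : ℝ} (hB0 : 0 ≤ B) (hB : ∀ z ∈ disc, ‖deriv g z‖ * (1 - ‖z‖) ≤ B)
    {t : ℝ} (ht : 44 * B ≤ t) (ht' : ∀ z : ℂ, ‖z‖ ≤ 3 / 4 → ‖g z‖ ≤ t) :
    ENNReal.ofReal t * energyMeasure ω g {z | t < ‖g z‖} ≤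
      (2 * K) * modulusMeasure ω g {z | t < 4 * ‖g z‖} := by
  have hpi := Real.pi_gt_three
  have ht0 : 0 ≤ t := le_trans (by positivity) ht
  set μ := energyMeasure ω g
  set ν := modulusMeasure ω g
  set T : Set ℂ := disc ∩ (fun z => ‖g z‖) ⁻¹' Ioi (t / 4) with hT
  have hTm : MeasurableSet T :=
    ((DifferentiableOn.continuousOn hg).norm.isOpen_inter_preimage Metric.isOpen_ball
      isOpen_Ioi).measurableSet
  have hνac : ν ≪ areaDisc := withDensity_absolutelyContinuous _ _
  have key : (ENNReal.ofReal (t / 2) • μ) (disc ∩ {z | t < ‖g z‖}) ≤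
      ((K : ℝ≥0∞) • ν.restrict T) disc := by
    refine measure_inter_le_of_sector fun α β hα hαβ hβ => ?_
    rintro ⟨z, hz, hz1, hz2⟩
    have hzn : 3 / 4 < ‖z‖ := by
      by_contra hle
      exact absurd (ht' z (not_lt.1 hle)) (not_le.2 hz2)
    -- The point lies in the top half, so `β - α < 2 (1 - |z|) < 1/2`; this is what the threshold
    -- 3/4 is for.
    have hℓ : β - α ≤ 1 / 2 := by linarith
    set Q := carlesonSquare ((α + β) / 2) (β - α) with hQ
    set W := weightMass ω Q
    have hQm : MeasurableSet Q := measurableSet_carlesonSquare (by linarith) (by linarith)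
    have hQd : Q ⊆ disc := carlesonSquare_subset_disc _ _
    have hW : W ≠ ∞ := ((weightMass_le h ((α + β) / 2) (by linarith : 0 < β - α)
      (by linarith)).trans_lt ENNReal.ofReal_lt_top).ne
    have h1 := bloch_lintegral_carlesonSquare_ge hg hB0 hB h hαβ hℓ hz.1.1 hz1
      (Ioc_subset_Icc_self hz.2)
    rw [Complex.norm_mul_exp_arg_mul_I] at h1
    have h2 : ∫⁻ w in Q \ T, ENNReal.ofReal (‖g w‖ * ω ‖w‖) ∂areaDisc ≤ ENNReal.ofReal (t / 4) * W := by
      calc _ ≤ ∫⁻ w in Q \ T, ENNReal.ofReal (t / 4) * ENNReal.ofReal (ω ‖w‖) ∂areaDisc := by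
            refine setLIntegral_mono' (hQm.diff hTm) fun w hw => ?_
            have hwd := hQd hw.1
            rw [← ENNReal.ofReal_mul (by positivity)]
            apply ENNReal.ofReal_le_ofReal
            have hωw := (h.pos _ (norm_mem_Ico hwd)).le
            gcongr
            by_contra hlt
            exact hw.2 ⟨hwd, not_le.1 hlt⟩
        _ ≤ ∫⁻ w in Q, ENNReal.ofReal (t / 4) * ENNReal.ofReal (ω ‖w‖) ∂areaDisc :=
            lintegral_mono_set sdiff_subset
        _ = _ := lintegral_const_mul' _ _ ENNReal.ofReal_ne_top
    have h3 : ENNReal.ofReal (t / 2) * W ≤ ν (Q ∩ T) := by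
      have h4 := lintegral_inter_add_sdiff (μ := areaDisc)
        (fun w => ENNReal.ofReal (‖g w‖ * ω ‖w‖)) Q hTm
      rw [← h4] at h1
      -- Here `11B ≤ t/4` because `t ≥ 44B`.
      have h5 : ENNReal.ofReal (t / 2) + ENNReal.ofReal (t / 4) ≤
          ENNReal.ofReal (‖g z‖ - 11 * B) := by
        rw [← ENNReal.ofReal_add (by positivity) (by positivity)]
        apply ENNReal.ofReal_le_ofReal
        have : t < ‖g z‖ := hz2
        linarith
      have h6 := (mul_le_mul_left h5 W).trans (h1.trans (add_le_add_right h2 _))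
      rw [add_mul] at h6
      have h7 := (ENNReal.add_le_add_iff_right (ENNReal.mul_ne_top ENNReal.ofReal_ne_top hW)).1 h6
      simp only [ν, modulusMeasure]
      rwa [withDensity_apply']
    calc (ENNReal.ofReal (t / 2) • μ) (sector α β)
        = ENNReal.ofReal (t / 2) * μ (sector α β) := by simp
      _ ≤ ENNReal.ofReal (t / 2) * μ Q := by
          gcongr
          exact sector_subset_carlesonSquare α β
      _ ≤ ENNReal.ofReal (t / 2) * (K * W) := by
          gcongr
          exact (energyMeasure_le_energy h g hQm hQd).trans
            (hK _ _ ⟨by linarith, by linarith⟩)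
      _ = K * (ENNReal.ofReal (t / 2) * W) := by ring
      _ ≤ K * ν (Q ∩ T) := by gcongr
      _ = K * ν (sector α β ∩ T) := by
          congr 1
          exact measure_congr (((hνac.ae_eq (sector_ae_eq hα hαβ hβ hℓ)).symm).inter (ae_eq_refl T))
      _ = _ := by simp [Measure.restrict_apply (measurableSet_sector α β)]
  simp only [Measure.smul_apply, smul_eq_mul, Measure.restrict_apply measurableSet_disc] at key
  have h8 : μ {z | t < ‖g z‖} ≤ μ (disc ∩ {z | t < ‖g z‖}) := by
    have hc : μ discᶜ = 0 := withDensity_absolutelyContinuous _ _ areaDisc_compl_disc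
    calc μ {z | t < ‖g z‖} ≤ μ ((disc ∩ {z | t < ‖g z‖}) ∪ discᶜ) := by
          refine measure_mono fun z hz => ?_
          by_cases hzd : z ∈ disc
          · exact Or.inl ⟨hzd, hz⟩
          · exact Or.inr hzd
      _ ≤ _ := measure_union_le _ _
      _ = _ := by rw [hc, add_zero]
  have h9 : ENNReal.ofReal t = 2 * ENNReal.ofReal (t / 2) := by
    rw [show (2 : ℝ≥0∞) = ENNReal.ofReal 2 by simp, ← ENNReal.ofReal_mul (by norm_num)]
    congr 1
    ring
  calc ENNReal.ofReal t * μ {z | t < ‖g z‖}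
      ≤ 2 * ENNReal.ofReal (t / 2) * μ (disc ∩ {z | t < ‖g z‖}) := by rw [h9]; gcongr
    _ = 2 * (ENNReal.ofReal (t / 2) * μ (disc ∩ {z | t < ‖g z‖})) := mul_assoc _ _ _
    _ ≤ 2 * (K * ν (disc ∩ T)) := by gcongr
    _ = 2 * K * ν (disc ∩ T) := (mul_assoc _ _ _).symm
    _ ≤ 2 * K * ν {z | t < 4 * ‖g z‖} := by
        gcongr
        intro z hz
        have : t / 4 < ‖g z‖ := hz.2.2
        rw [mem_ofPred_eq]
        linarith

/-- Integrating the weak-type bound over levels produces `|g|^(q-1)` against `|g| ω dA`, that is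
`|g|^q ω`, so no power is lost. -/
theorem lintegral_energyMeasure_lt_top {ω : ℝ → ℝ} {m : ℕ} (h : IsAdmissible ω m) {g : ℂ → ℂ}
    (hg : g ∈ cOneSpace ω) {q : ℝ} (hq : 1 < q)
    (hfin : ∫⁻ z, ENNReal.ofReal (‖g z‖ ^ q * ω ‖z‖) ∂areaDisc < ∞) :
    ∫⁻ z, ENNReal.ofReal (‖g z‖ ^ q) ∂energyMeasure ω g < ∞ := by
  obtain ⟨B, hB0, hB⟩ := blochSpace.exists_bound (cOneSpace_subset_blochSpace h hg)
  obtain ⟨hgd, K, hK⟩ := (mem_cOneSpace_iff h).1 hg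
  have hgc : ContinuousOn g disc := DifferentiableOn.continuousOn hgd
  have hgm : AEMeasurable (fun z => ‖g z‖) areaDisc := aemeasurable_areaDisc hgc.norm
  have hω := continuousOn_weight h.continuousOn
  obtain ⟨C, hC⟩ := (isCompact_closedBall (0 : ℂ) (3 / 4)).exists_bound_of_continuousOn
    (hgc.mono (Metric.closedBall_subset_ball (by norm_num)))
  refine lintegral_rpow_lt_top_of_meas_lt (ν := modulusMeasure ω g) (t₀ := max (44 * B) C)
    (K := 2 * K) (fun z => norm_nonneg _)
    (hgm.mono_ac (withDensity_absolutelyContinuous _ _))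
    (hgm.mono_ac (withDensity_absolutelyContinuous _ _)) ?_ (le_max_of_le_left (by positivity))
    (ENNReal.mul_lt_top (by simp) ENNReal.coe_lt_top) (fun t ht => ?_) hq ?_
  · have h1 : energyMeasure ω g univ = energyMeasure ω g disc := by
      have hc : energyMeasure ω g discᶜ = 0 :=
        withDensity_absolutelyContinuous _ _ areaDisc_compl_disc
      rw [← measure_add_measure_compl measurableSet_disc, hc, add_zero]
    change energyMeasure ω g univ < ∞
    rw [h1]
    refine (energyMeasure_le_energy h.toIsContinuousWeight g measurableSet_disc le_rfl).trans_lt ?_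
    have h2 := hK 0 (2 * Real.pi) ⟨by positivity, le_rfl⟩
    have h3 := weightMass_le h.toIsContinuousWeight 0 (by positivity) (le_refl (2 * Real.pi))
    rw [carlesonSquare_two_pi] at h2 h3
    exact h2.trans_lt (ENNReal.mul_lt_top ENNReal.coe_lt_top (h3.trans_lt ENNReal.ofReal_lt_top))
  · exact energyMeasure_meas_lt_le h.toIsContinuousWeight hgd hK hB0 hB
      ((le_max_left _ _).trans ht.le) fun z hz =>
        (hC z (by simpa using hz)).trans ((le_max_right _ _).trans ht.le)
  · unfold modulusMeasure
    rw [lintegral_withDensity_eq_lintegral_mul₀ (aemeasurable_areaDisc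
      (F := fun z => ‖g z‖ * ω ‖z‖) (hgc.norm.mul hω)).ennreal_ofReal
      (hgm.pow_const _).ennreal_ofReal]
    refine lt_of_eq_of_lt (lintegral_congr fun z => ?_) hfin
    rw [Pi.mul_apply, ← ENNReal.ofReal_mul' (by positivity)]
    congr 1
    rcases (norm_nonneg (g z)).eq_or_lt with h0 | h0
    · rw [← h0, Real.zero_rpow (by linarith), Real.zero_rpow (by linarith)]
      ring
    · rw [Real.rpow_sub_one h0.ne']
      field_simp

/-- Induction on `k` through Littlewood–Paley for `g^(k+1)`, whose squared derivative is `(k+1)²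
|g|^(2k) |g'|²`. -/
theorem lintegral_even_pow_lt_top {ω : ℝ → ℝ} {m : ℕ} (h : IsAdmissible ω m) {g : ℂ → ℂ}
    (hg : g ∈ cOneSpace ω) (k : ℕ) :
    ∫⁻ z, ENNReal.ofReal (‖g z‖ ^ (2 * k) * ω ‖z‖) ∂areaDisc < ∞ := by
  obtain ⟨hgd, K, hK⟩ := (mem_cOneSpace_iff h).1 hg
  have h2 := hK 0 (2 * Real.pi) ⟨by positivity, le_rfl⟩
  have h3 := (weightMass_le h.toIsContinuousWeight 0 (by positivity)
    (le_refl (2 * Real.pi))).trans_lt ENNReal.ofReal_lt_top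
  rw [carlesonSquare_two_pi] at h2 h3
  have h4 := energyMeasure_le_energy h.toIsContinuousWeight g measurableSet_disc le_rfl
  induction k with
  | zero =>
    unfold weightMass at h3
    rw [areaDisc_restrict_disc] at h3
    simpa using h3
  | succ k ih =>
    have hμ : ∫⁻ z, ENNReal.ofReal (‖g z‖ ^ (2 * k)) ∂energyMeasure ω g < ∞ := by
      -- The embedding needs an exponent above 1; for `k = 0` only the total mass of `μ` is
      -- required, and it is at most the energy of the disc.
      rcases Nat.eq_zero_or_pos k with rfl | hk
      · simp only [mul_zero, pow_zero, ENNReal.ofReal_one, lintegral_const, one_mul]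
        have hc : energyMeasure ω g discᶜ = 0 :=
          withDensity_absolutelyContinuous _ _ areaDisc_compl_disc
        rw [← measure_add_measure_compl measurableSet_disc, hc, add_zero]
        exact (h4.trans h2).trans_lt (ENNReal.mul_lt_top ENNReal.coe_lt_top h3)
      · have hk' : (1 : ℝ) < ((2 * k : ℕ) : ℝ) := by exact_mod_cast (by omega : 1 < 2 * k)
        have := lintegral_energyMeasure_lt_top h hg hk' (by simpa only [Real.rpow_natCast] using ih)
        simpa only [Real.rpow_natCast] using this
    have hgc : ContinuousOn g disc := DifferentiableOn.continuousOn hgd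
    have hf : (fun z => g z ^ (k + 1)) ∈ AnalyticDisc := DifferentiableOn.pow hgd (k + 1)
    have hLP := lintegral_sq_le h.toIsContinuousWeight hf
    have e1 : ∀ z, ‖g z ^ (k + 1)‖ ^ 2 = ‖g z‖ ^ (2 * (k + 1)) := fun z => by
      rw [norm_pow, ← pow_mul, mul_comm]
    simp only [e1] at hLP
    rw [areaDisc_restrict_disc] at hLP
    refine hLP.trans_lt (ENNReal.add_lt_top.2 ⟨ENNReal.mul_lt_top ENNReal.ofReal_lt_top
      ENNReal.ofReal_lt_top, ENNReal.mul_lt_top (by simp) ?_⟩)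
    unfold energyMeasure at hμ
    have hdc : ContinuousOn (fun z => ‖deriv g z‖ ^ 2 * tailMoment ω ‖z‖) disc :=
      ((continuousOn_deriv hgd).norm.pow 2).mul
        (h.continuousOn_tailMoment.comp (by fun_prop) fun z hz => norm_mem_Ico hz)
    rw [lintegral_withDensity_eq_lintegral_mul₀ (aemeasurable_areaDisc hdc).ennreal_ofReal
      (aemeasurable_areaDisc (F := fun z => ‖g z‖ ^ (2 * k)) (hgc.norm.pow _)).ennreal_ofReal] at hμ
    refine lt_of_eq_of_lt ?_ (ENNReal.mul_lt_top (a := ENNReal.ofReal ((k + 1) ^ 2))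
      ENNReal.ofReal_lt_top hμ)
    rw [← lintegral_const_mul' _ _ ENNReal.ofReal_ne_top]
    rw [← areaDisc_restrict_disc]
    refine setLIntegral_congr_fun measurableSet_disc fun z hz => ?_
    have hd := DifferentiableOn.differentiableAt hgd (Metric.isOpen_ball.mem_nhds hz)
    have e2 : deriv (fun z => g z ^ (k + 1)) z = (k + 1) * g z ^ k * deriv g z := by
      have := (hd.hasDerivAt.fun_pow (k + 1)).deriv
      simpa using this
    simp only [Pi.mul_apply]
    rw [e2, ← ENNReal.ofReal_mul' (by positivity), ← ENNReal.ofReal_mul (by positivity)]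
    congr 1
    rw [norm_mul, norm_mul, norm_pow, show ((k : ℂ) + 1) = ((k + 1 : ℕ) : ℂ) by push_cast; rfl,
      Complex.norm_natCast]
    push_cast
    ring

theorem cOneSpace_subset_bergmanSpace {ω : ℝ → ℝ} {m : ℕ} (h : IsAdmissible ω m) {p : ℝ}
    (hp : 0 < p) : cOneSpace ω ⊆ bergmanSpace p ω := by
  intro g hg
  obtain ⟨k, hk⟩ := exists_nat_ge p
  refine ⟨hg.1, ?_⟩
  have h0 := lintegral_even_pow_lt_top h hg 0
  have h1 := lintegral_even_pow_lt_top h hg k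
  have hgc : ContinuousOn g disc := DifferentiableOn.continuousOn hg.1
  have hω := continuousOn_weight h.continuousOn
  refine lt_of_le_of_lt ?_ (ENNReal.add_lt_top.2 ⟨h0, h1⟩)
  rw [← lintegral_add_left' (aemeasurable_areaDisc
    (F := fun z => ‖g z‖ ^ (2 * 0) * ω ‖z‖) ((hgc.norm.pow (2 * 0)).mul hω)).ennreal_ofReal, ← areaDisc_restrict_disc]
  refine setLIntegral_mono' measurableSet_disc fun z hz => ?_
  have hωz := (h.pos _ (norm_mem_Ico hz)).le
  rw [← ENNReal.ofReal_add (by positivity) (by positivity), ← add_mul]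
  apply ENNReal.ofReal_le_ofReal
  gcongr
  simp only [mul_zero, pow_zero]
  rcases le_or_gt ‖g z‖ 1 with hle | hlt
  · have := Real.rpow_le_one (norm_nonneg (g z)) hle hp.le
    have h5 : 0 ≤ ‖g z‖ ^ (2 * k) := by positivity
    linarith
  · have h5 : ‖g z‖ ^ p ≤ ‖g z‖ ^ ((2 * k : ℕ) : ℝ) := by
      apply Real.rpow_le_rpow_of_exponent_le hlt.le
      push_cast
      linarith
    rw [Real.rpow_natCast] at h5
    linarith

/-! ### Hadamard lacunary series. -/

theorem sum_two_pow_mul_pow_div (r : ℝ) (hr0 : 0 ≤ r) (hr1 : r < 1) (K : ℕ) :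
    ∑ k ∈ Finset.range K, 2 ^ k * r ^ (2 ^ k - 1) / (1 + r ^ 2 ^ k) =
      1 / (1 - r) - 2 ^ K * r ^ (2 ^ K - 1) / (1 - r ^ 2 ^ K) := by
  -- The identity is the logarithmic derivative of `∏_(k<K) (1 + r^(2^k)) = (1 - r^(2^K))/(1 - r)`.
  induction K with
  | zero => simp
  | succ K ih =>
    rw [Finset.sum_range_succ, ih]
    have hn : 2 ^ K - 1 + 1 = 2 ^ K := Nat.sub_add_cancel Nat.one_le_two_pow
    set x := r ^ 2 ^ K with hx
    have e1 : r ^ 2 ^ (K + 1) = x ^ 2 := by rw [hx, ← pow_mul, pow_succ]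
    have e2 : r ^ (2 ^ (K + 1) - 1) = r ^ (2 ^ K - 1) * x := by
      rw [hx, ← pow_add]; congr 1; omega
    have hx1 : x < 1 := pow_lt_one₀ hr0 hr1 (by positivity)
    have hx0 : 0 ≤ x := pow_nonneg hr0 _
    have h1 : 1 - x ≠ 0 := by linarith
    have h2 : 1 + x ≠ 0 := by linarith
    have h3 : 1 - x ^ 2 ≠ 0 := by
      have : (1 - x) * (1 + x) ≠ 0 := mul_ne_zero h1 h2
      intro h; apply this; linarith
    rw [e1, e2, pow_succ]
    have e3 : 1 - x ^ 2 = (1 - x) * (1 + x) := by ring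
    rw [e3]
    field_simp
    ring

/-- Inserting the denominators `1 + r^(2^k) ≤ 2` reduces to the closed form. This yields the Bloch
bound for every series with coefficients bounded by 1. -/
theorem sum_two_pow_mul_pow_le {r : ℝ} (hr0 : 0 ≤ r) (hr1 : r < 1) (K : ℕ) :
    ∑ k ∈ Finset.range K, 2 ^ k * r ^ (2 ^ k - 1) ≤ 2 / (1 - r) := by
  have h1 := sum_two_pow_mul_pow_div r hr0 hr1 K
  have h2 : 0 ≤ 2 ^ K * r ^ (2 ^ K - 1) / (1 - r ^ 2 ^ K) := by
    have : r ^ 2 ^ K < 1 := pow_lt_one₀ hr0 hr1 (by positivity)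
    exact div_nonneg (by positivity) (by linarith)
  calc ∑ k ∈ Finset.range K, 2 ^ k * r ^ (2 ^ k - 1)
      ≤ ∑ k ∈ Finset.range K, 2 * (2 ^ k * r ^ (2 ^ k - 1) / (1 + r ^ 2 ^ k)) := by
        refine Finset.sum_le_sum fun k _ => ?_
        have h3 : r ^ 2 ^ k ≤ 1 := pow_le_one₀ hr0 hr1.le
        have h4 : 0 ≤ r ^ 2 ^ k := pow_nonneg hr0 _
        rw [← mul_div_assoc, le_div_iff₀ (by linarith)]
        have h5 : 0 ≤ 2 ^ k * r ^ (2 ^ k - 1) := by positivity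
        nlinarith
    _ = 2 * (1 / (1 - r) - 2 ^ K * r ^ (2 ^ K - 1) / (1 - r ^ 2 ^ K)) := by
        rw [← Finset.mul_sum, h1]
    _ ≤ 2 / (1 - r) := by
        rw [mul_sub, mul_one_div]
        linarith

theorem summable_two_pow_mul_pow {r : ℝ} (hr0 : 0 ≤ r) (hr1 : r < 1) :
    Summable fun k : ℕ => (2 : ℝ) ^ k * r ^ (2 ^ k - 1) :=
  summable_of_sum_range_le (fun k => by positivity) (sum_two_pow_mul_pow_le hr0 hr1)

theorem summable_two_pow_mul_pow' {r : ℝ} (hr0 : 0 ≤ r) (hr1 : r < 1) :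
    Summable fun k : ℕ => (2 : ℝ) ^ k * r ^ 2 ^ k := by
  refine Summable.of_nonneg_of_le (fun k => by positivity) (fun k => ?_)
    (summable_two_pow_mul_pow hr0 hr1)
  gcongr 2 ^ k * ?_
  exact pow_le_pow_of_le_one hr0 hr1.le (Nat.sub_le _ _)

/-- The Hadamard lacunary series `∑ a_k z^(2^k)`. -/
noncomputable def lacunary (a : ℕ → ℝ) (z : ℂ) : ℂ := ∑' k, (a k : ℂ) * z ^ 2 ^ k

/-- The part of `z ↦ z * deriv (lacunary a) z` with frequencies at least `2 ^ N`. -/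
noncomputable def lacunaryTail (a : ℕ → ℝ) (N : ℕ) (z : ℂ) : ℂ :=
  ∑' k, ((a (k + N) * 2 ^ (k + N) : ℝ) : ℂ) * z ^ 2 ^ (k + N)

section

variable {a : ℕ → ℝ} (ha : ∀ k, |a k| ≤ 1)
include ha

theorem norm_lacunary_term_le {z : ℂ} {ρ : ℝ} (hz : ‖z‖ ≤ ρ) (k : ℕ) :
    ‖(a k : ℂ) * z ^ 2 ^ k‖ ≤ 2 ^ k * ρ ^ 2 ^ k := by
  rw [norm_mul, Complex.norm_real, Real.norm_eq_abs, norm_pow]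
  have h2 : (1 : ℝ) ≤ 2 ^ k := one_le_pow₀ (by norm_num)
  gcongr
  exact (ha k).trans h2

theorem lacunary_mem_analyticDisc : lacunary a ∈ AnalyticDisc := by
  intro z hz
  have hz1 := (norm_mem_Ico hz).2
  obtain ⟨ρ, hρ0, hρ1⟩ := exists_between hz1
  have hρ : 0 ≤ ρ := (norm_nonneg z).trans hρ0.le
  have := Complex.differentiableOn_tsum_of_summable_norm (summable_two_pow_mul_pow' hρ hρ1)
    (F := fun k (z : ℂ) => (a k : ℂ) * z ^ 2 ^ k) (U := Metric.ball 0 ρ)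
    (fun k => by fun_prop) Metric.isOpen_ball
    (fun k w hw => norm_lacunary_term_le ha (by simpa using (mem_ball_zero_iff.1 hw).le) k)
  exact (this.differentiableAt (Metric.isOpen_ball.mem_nhds (by simpa using hρ0))).differentiableWithinAt

theorem hasSum_deriv_lacunary {z : ℂ} (hz : z ∈ disc) :
    HasSum (fun k => (a k : ℂ) * (2 ^ k * z ^ (2 ^ k - 1))) (deriv (lacunary a) z) := by
  have hz1 := (norm_mem_Ico hz).2
  obtain ⟨ρ, hρ0, hρ1⟩ := exists_between hz1
  have hρ : 0 ≤ ρ := (norm_nonneg z).trans hρ0.le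
  have := Complex.hasSum_deriv_of_summable_norm (summable_two_pow_mul_pow' hρ hρ1)
    (F := fun k (z : ℂ) => (a k : ℂ) * z ^ 2 ^ k) (U := Metric.ball 0 ρ)
    (fun k => by fun_prop) Metric.isOpen_ball
    (fun k w hw => norm_lacunary_term_le ha (by simpa using (mem_ball_zero_iff.1 hw).le) k)
    (by simpa using hρ0 : z ∈ Metric.ball 0 ρ)
  convert! this using 1
  ext k
  simp

theorem norm_deriv_lacunary_mul_le {z : ℂ} (hz : z ∈ disc) :
    ‖deriv (lacunary a) z‖ * (1 - ‖z‖) ≤ 2 := by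
  have hz1 := norm_mem_Ico hz
  have hs := summable_two_pow_mul_pow hz1.1 hz1.2
  have h1 : ‖deriv (lacunary a) z‖ ≤ 2 / (1 - ‖z‖) := by
    rw [← (hasSum_deriv_lacunary ha hz).tsum_eq]
    refine (tsum_of_norm_bounded hs.hasSum fun k => ?_).trans
      (Real.tsum_le_of_sum_range_le (fun k => by have := hz1.1; positivity)
        (sum_two_pow_mul_pow_le hz1.1 hz1.2))
    rw [norm_mul, norm_mul, norm_pow, norm_pow, Complex.norm_real, Real.norm_eq_abs]
    simp only [Complex.norm_ofNat]
    exact mul_le_of_le_one_left (by positivity) (ha k)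
  rwa [le_div_iff₀ (by linarith [hz1.2])] at h1

theorem summable_lacunary_coeff {r : ℝ} (hr0 : 0 ≤ r) (hr1 : r < 1) :
    Summable fun k => ‖((a k * 2 ^ k : ℝ) : ℂ) * (r : ℂ) ^ 2 ^ k‖ := by
  refine Summable.of_nonneg_of_le (fun k => norm_nonneg _) (fun k => ?_)
    (summable_two_pow_mul_pow' hr0 hr1)
  rw [norm_mul, Complex.norm_real, norm_pow, Complex.norm_real, Real.norm_of_nonneg hr0, norm_mul,
    Real.norm_eq_abs, norm_pow, Real.norm_ofNat]
  gcongr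
  exact mul_le_of_le_one_left (by positivity) (ha k)

/-- The factor `z` restores the exponents `2^k`, so that the frequencies beyond `N` share the
divisor `2^N`. -/
theorem mul_deriv_lacunary {z : ℂ} (hz : z ∈ disc) (N : ℕ) :
    z * deriv (lacunary a) z =
      ∑ k ∈ Finset.range N, ((a k * 2 ^ k : ℝ) : ℂ) * z ^ 2 ^ k + lacunaryTail a N z := by
  have h1 := (hasSum_deriv_lacunary ha hz).mul_left z
  have h2 : (fun k => z * ((a k : ℂ) * (2 ^ k * z ^ (2 ^ k - 1)))) =
      fun k => ((a k * 2 ^ k : ℝ) : ℂ) * z ^ 2 ^ k := by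
    ext k
    have : z ^ 2 ^ k = z ^ (2 ^ k - 1) * z := by
      rw [← pow_succ, Nat.sub_add_cancel Nat.one_le_two_pow]
    rw [this]
    push_cast
    ring
  rw [h2] at h1
  rw [← h1.tsum_eq, lacunaryTail, h1.summable.sum_add_tsum_nat_add N]

theorem norm_lacunary_head_le {z : ℂ} (hz : z ∈ disc) (N : ℕ) :
    ‖∑ k ∈ Finset.range N, ((a k * 2 ^ k : ℝ) : ℂ) * z ^ 2 ^ k‖ ≤ 2 ^ N := by
  have hz1 := norm_mem_Ico hz
  have h1 : ‖∑ k ∈ Finset.range N, ((a k * 2 ^ k : ℝ) : ℂ) * z ^ 2 ^ k‖ ≤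
      ∑ k ∈ Finset.range N, (2 : ℝ) ^ k := by
    refine norm_sum_le_of_le _ fun k _ => ?_
    rw [norm_mul, Complex.norm_real, norm_mul, Real.norm_eq_abs, norm_pow, norm_pow,
      Real.norm_ofNat]
    calc |a k| * 2 ^ k * ‖z‖ ^ 2 ^ k ≤ 1 * 2 ^ k * 1 := by
          gcongr
          · exact ha k
          · exact pow_le_one₀ hz1.1 hz1.2.le
      _ = _ := by ring
  rw [geom_sum_eq (by norm_num)] at h1
  linarith

/-- All frequencies of the tail are multiples of `2^N`, so Parseval holds exactly on any arc of
length `2π/2^N`, not only on the whole circle. -/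
theorem lintegral_lacunaryTail {r : ℝ} (hr0 : 0 ≤ r) (hr1 : r < 1) (N : ℕ) (α : ℝ) :
    ∫⁻ t in Ioc α (α + 2 * Real.pi / 2 ^ N),
      ENNReal.ofReal (‖lacunaryTail a N (r * Complex.exp (t * Complex.I))‖ ^ 2) =
    ENNReal.ofReal (2 * Real.pi / 2 ^ N) *
      ∑' k, ENNReal.ofReal ((a (k + N) * 2 ^ (k + N) * r ^ 2 ^ (k + N)) ^ 2) := by
  have hs := (summable_nat_add_iff N).2 (summable_lacunary_coeff ha hr0 hr1)
  have hP := parseval hs (N := fun k => (2 : ℝ) ^ (k + N))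
    (fun i j hij => by
      have := (pow_right_injective₀ (by norm_num : (0 : ℝ) < 2) (by norm_num)) hij
      omega)
    (L := 2 * Real.pi / 2 ^ N) (by positivity)
    (fun j k => ⟨2 ^ j - 2 ^ k, by push_cast; rw [pow_add, pow_add]; field_simp⟩) α
  convert! hP using 1
  · refine lintegral_congr fun t => ?_
    unfold lacunaryTail
    congr 4
    ext k
    rw [mul_pow, ← Complex.exp_nat_mul, ← mul_assoc]
    push_cast
    ring_nf
  · congr 2
    ext k
    rw [norm_mul, Complex.norm_real, norm_pow, Complex.norm_real, ← norm_pow, ← norm_mul,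
      Real.norm_eq_abs, sq_abs]

end

theorem one_div_le_pow_four_mul {r : ℝ} (hr0 : 0 ≤ r) {n : ℕ} (h : 2 * n * (1 - r) ≤ 1) :
    1 / 16 ≤ r ^ (4 * n) := by
  have h1 := one_add_mul_le_pow (a := r - 1) (by linarith) n
  rw [add_sub_cancel] at h1
  have h2 : 1 / 2 ≤ r ^ n := by linarith
  calc (1 : ℝ) / 16 = (1 / 2) ^ 4 := by norm_num
    _ ≤ (r ^ n) ^ 4 := by gcongr
    _ = _ := by rw [← pow_mul, mul_comm]

theorem one_div_le_pow_two_pow {r : ℝ} (hr0 : 0 ≤ r) {k : ℕ} (hk : 1 ≤ k)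
    (h : 1 - r ≤ (1 / 2) ^ k) : 1 / 16 ≤ (r ^ 2 ^ k) ^ 2 := by
  obtain ⟨j, rfl⟩ := Nat.exists_eq_add_of_le' hk
  have h1 : 1 / 16 ≤ r ^ (4 * 2 ^ j) := by
    refine one_div_le_pow_four_mul hr0 ?_
    calc 2 * ((2 ^ j : ℕ) : ℝ) * (1 - r) ≤ 2 * ((2 ^ j : ℕ) : ℝ) * (1 / 2) ^ (j + 1) := by gcongr
      _ = 1 := by push_cast; rw [one_div, inv_pow]; field_simp; ring
  refine h1.trans (le_of_eq ?_)
  rw [← pow_mul]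
  congr 1
  ring

/-- One frequency with `2^(-k)` comparable to `1 - r` already gives a tail of mean square at least
`1/(64 (1 - r)²)`. Since `1 - r ≤ 2^(-N)/16`, the head, of size at most `2^N`, cannot cancel it. -/
theorem lintegral_norm_sq_lacunary_ge {r : ℝ} (hr0 : 0 < r) (hr1 : r < 1) {N : ℕ}
    (hr : 1 - r ≤ (1 / 2) ^ N / 16) (α : ℝ) :
    ENNReal.ofReal (2 * Real.pi / 2 ^ N / (256 * (1 - r) ^ 2)) ≤
      ∫⁻ t in Ioc α (α + 2 * Real.pi / 2 ^ N),
        ENNReal.ofReal (‖(r * Complex.exp (t * Complex.I)) *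
          deriv (lacunary fun _ => 1) (r * Complex.exp (t * Complex.I))‖ ^ 2) := by
  have ha : ∀ _ : ℕ, |(1 : ℝ)| ≤ 1 := fun _ => by simp
  set L := 2 * Real.pi / 2 ^ N with hL
  have hL0 : 0 < L := by positivity
  have h1r : 0 < 1 - r := by linarith
  obtain ⟨k, hk1, hk2⟩ := exists_nat_pow_near_of_lt_one h1r (by linarith)
    (by norm_num : (0 : ℝ) < 1 / 2) (by norm_num)
  have hkN : N + 4 < k + 1 := by
    by_contra hle
    have h2 : ((1 : ℝ) / 2) ^ (N + 4) ≤ (1 / 2) ^ (k + 1) :=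
      pow_le_pow_of_le_one (by norm_num) (by norm_num) (not_lt.1 hle)
    rw [pow_add] at h2
    linarith
  set X := ∫⁻ t in Ioc α (α + L), ENNReal.ofReal (‖(r * Complex.exp (t * Complex.I)) *
          deriv (lacunary fun _ => 1) (r * Complex.exp (t * Complex.I))‖ ^ 2) with hX
  have hT := lintegral_lacunaryTail ha hr0.le hr1 N α
  rw [← hL] at hT
  have hlow : ENNReal.ofReal (L / (64 * (1 - r) ^ 2)) ≤ ∫⁻ t in Ioc α (α + L),
      ENNReal.ofReal (‖lacunaryTail (fun _ => 1) N (r * Complex.exp (t * Complex.I))‖ ^ 2) := by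
    rw [hT]
    have h3 := ENNReal.le_tsum (f := fun k : ℕ =>
      ENNReal.ofReal ((1 * 2 ^ (k + N) * r ^ 2 ^ (k + N)) ^ 2)) (k - N)
    refine le_trans ?_ (mul_le_mul_right h3 _)
    rw [← ENNReal.ofReal_mul hL0.le, Nat.sub_add_cancel (by omega)]
    apply ENNReal.ofReal_le_ofReal
    have h4 := one_div_le_pow_two_pow hr0.le (by omega) hk2
    have h5 : 1 ≤ 2 ^ (k + 1) * (1 - r) := by
      rw [one_div, inv_pow, inv_lt_iff_one_lt_mul₀' (by positivity)] at hk1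
      exact hk1.le
    have h6 : 1 / (64 * (1 - r) ^ 2) ≤ (2 ^ k) ^ 2 * (1 / 16) := by
      rw [div_le_iff₀ (by positivity)]
      have h7 : (1 : ℝ) ^ 2 ≤ (2 ^ (k + 1) * (1 - r)) ^ 2 := by gcongr
      calc (1 : ℝ) ≤ (2 ^ (k + 1) * (1 - r)) ^ 2 := by linarith
        _ = _ := by rw [pow_succ]; ring
    calc L / (64 * (1 - r) ^ 2) = L * (1 / (64 * (1 - r) ^ 2)) := by ring
      _ ≤ L * ((2 ^ k) ^ 2 * (1 / 16)) := by gcongr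
      _ ≤ L * ((2 ^ k) ^ 2 * (r ^ 2 ^ k) ^ 2) := by gcongr
      _ = _ := by ring
  have hup : ∫⁻ t in Ioc α (α + L),
      ENNReal.ofReal (‖lacunaryTail (fun _ => 1) N (r * Complex.exp (t * Complex.I))‖ ^ 2) ≤
      2 * X + ENNReal.ofReal (L * (2 * 4 ^ N)) := by
    calc _ ≤ ∫⁻ t in Ioc α (α + L), (2 * ENNReal.ofReal (‖(r * Complex.exp (t * Complex.I)) *
          deriv (lacunary fun _ => 1) (r * Complex.exp (t * Complex.I))‖ ^ 2) +
          ENNReal.ofReal (2 * 4 ^ N)) := by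
          refine lintegral_mono fun t => ?_
          set z : ℂ := r * Complex.exp (t * Complex.I)
          have hz : z ∈ disc := ofReal_mem_disc ⟨hr0.le, hr1⟩ t
          have h8 := mul_deriv_lacunary ha hz N
          have h9 := norm_lacunary_head_le ha hz N
          have h10 : ‖lacunaryTail (fun _ => 1) N z‖ ≤
              ‖z * deriv (lacunary fun _ => 1) z‖ + 2 ^ N := by
            rw [← sub_eq_iff_eq_add'] at h8
            rw [← h8]
            exact (norm_sub_le _ _).trans (by gcongr)
          rw [show (2 : ℝ≥0∞) = ENNReal.ofReal 2 by simp, ← ENNReal.ofReal_mul (by norm_num),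
            ← ENNReal.ofReal_add (by positivity) (by positivity)]
          apply ENNReal.ofReal_le_ofReal
          have h11 : (4 : ℝ) ^ N = (2 ^ N) ^ 2 := by rw [← pow_mul, mul_comm, pow_mul]; norm_num
          rw [h11]
          calc ‖lacunaryTail (fun _ => 1) N z‖ ^ 2
              ≤ (‖z * deriv (lacunary fun _ => 1) z‖ + 2 ^ N) ^ 2 := by gcongr
            _ ≤ _ := by nlinarith [sq_nonneg (‖z * deriv (lacunary fun _ => 1) z‖ - 2 ^ N)]
      _ = _ := by
          rw [lintegral_add_right _ measurable_const, lintegral_const_mul' _ _ (by simp),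
            lintegral_const, Measure.restrict_apply_univ, Real.volume_Ioc, add_sub_cancel_left,
            mul_comm (ENNReal.ofReal (2 * 4 ^ N)), ← ENNReal.ofReal_mul hL0.le]
  have hB : L * (2 * 4 ^ N) ≤ L / (128 * (1 - r) ^ 2) := by
    rw [div_eq_mul_one_div L]
    gcongr
    rw [le_div_iff₀ (by positivity)]
    have h12 : 2 ^ N * (1 - r) ≤ 1 / 16 := by
      calc 2 ^ N * (1 - r) ≤ 2 ^ N * ((1 / 2) ^ N / 16) := by gcongr
        _ = _ := by rw [one_div, inv_pow]; field_simp
    have h13 : (2 ^ N * (1 - r)) ^ 2 ≤ (1 / 16) ^ 2 := by gcongr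
    have h11 : (4 : ℝ) ^ N = (2 ^ N) ^ 2 := by rw [← pow_mul, mul_comm, pow_mul]; norm_num
    rw [h11]
    nlinarith
  have h14 := hlow.trans hup
  rw [← tsub_le_iff_right, ← ENNReal.ofReal_sub _ (by positivity)] at h14
  have h15 : ENNReal.ofReal (2 * (L / (256 * (1 - r) ^ 2))) ≤ 2 * X := by
    refine le_trans (ENNReal.ofReal_le_ofReal ?_) h14
    have : 2 * (L / (256 * (1 - r) ^ 2)) = L / (64 * (1 - r) ^ 2) - L / (128 * (1 - r) ^ 2) := by
      field_simp; ring
    linarith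
  rw [ENNReal.ofReal_mul (by norm_num), show ENNReal.ofReal 2 = 2 by simp] at h15
  exact (ENNReal.mul_le_mul_iff_right (by simp) (by simp)).1 h15

/-! ### A Bloch function outside 𝓒¹ for rapidly increasing weights. -/

theorem lacunary_one_mem_blochSpace : lacunary (fun _ => 1) ∈ blochSpace :=
  have ha : ∀ _ : ℕ, |(1 : ℝ)| ≤ 1 := fun _ => by simp
  mem_blochSpace_of_bound (lacunary_mem_analyticDisc ha) fun _ hz => norm_deriv_lacunary_mul_le ha hz

/-- The iterated tail is at least `M (1 - r)² ω(r)/2^(m+1)`, and the mean of `|z g'|²` cancels the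
factor `(1 - r)²`. The constant is `2 · 256 · 2^(m+1) = 2^(m+10)`, the 2 coming from the Jacobian.
-/
theorem le_energy_lacunary_one {ω : ℝ → ℝ} {m : ℕ} (h : IsAdmissible ω m) {N : ℕ} (hN : 3 ≤ N)
    {M : ℝ} (hM0 : 0 ≤ M) (hM : ∀ r ∈ Ioo (1 - (1 / 2) ^ N / 16) (1 : ℝ),
      M * (ω r * (1 - r)) ≤ tail ω r) :
    ENNReal.ofReal (Real.pi⁻¹ * (2 * Real.pi / 2 ^ N) * (M / 2 ^ (m + 10)) *
        tail ω (1 - (1 / 2) ^ N / 16)) ≤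
      energy ω (lacunary fun _ => 1) (carlesonSquare 0 (2 * Real.pi / 2 ^ N)) := by
  have hpi := Real.pi_gt_three
  have hpi4 := Real.pi_le_four
  have ha : ∀ _ : ℕ, |(1 : ℝ)| ≤ 1 := fun _ => by simp
  set g := lacunary fun _ => 1
  have hg : g ∈ AnalyticDisc := lacunary_mem_analyticDisc ha
  set L := 2 * Real.pi / 2 ^ N with hL
  have hL0 : 0 < L := by positivity
  have h8 : (8 : ℝ) ≤ 2 ^ N := by
    calc (8 : ℝ) = 2 ^ 3 := by norm_num
      _ ≤ 2 ^ N := pow_le_pow_right₀ (by norm_num) hN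
  have hL1 : L ≤ 1 := by rw [hL, div_le_one (by positivity)]; linarith
  set x := 1 - (1 / 2 : ℝ) ^ N / 16 with hx
  have hNinv : ((1 : ℝ) / 2) ^ N = 1 / 2 ^ N := by rw [one_div, inv_pow, one_div]
  have h8' : ((1 : ℝ) / 2) ^ N ≤ 1 / 8 := by
    rw [hNinv]; gcongr
  have hxL : 1 - L ≤ x := by
    have : ((1 : ℝ) / 2) ^ N / 16 ≤ L := by
      rw [hNinv, hL, div_div]
      gcongr
      · linarith
      · linarith [show (0 : ℝ) < 2 ^ N by positivity]
    linarith
  have hx12 : 1 / 2 ≤ x := by linarith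
  have hx1 : x < 1 := by have : (0 : ℝ) < (1 / 2) ^ N := by positivity
                         linarith
  set F : ℂ → ℝ≥0∞ := fun z => ENNReal.ofReal (‖z * deriv g z‖ ^ 2 * tailMoment ω ‖z‖) with hF
  have hFc : ContinuousOn F disc := by
    refine ENNReal.continuous_ofReal.comp_continuousOn (ContinuousOn.mul
      ((continuousOn_id.mul (continuousOn_deriv hg)).norm.pow 2)
      (h.continuousOn_tailMoment.comp (by fun_prop) fun z hz => norm_mem_Ico hz))
  have hE : ∫⁻ z in carlesonSquare 0 L, F z ∂areaDisc ≤ energy ω g (carlesonSquare 0 L) := by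
    refine setLIntegral_mono' (measurableSet_carlesonSquare hL0 (by linarith)) fun z hz => ?_
    have hzd := norm_mem_Ico (carlesonSquare_subset_disc _ _ hz)
    apply ENNReal.ofReal_le_ofReal
    by_cases hz0 : z = 0
    · simp [hz0, associatedWeight]
    have h2 := h.tailMoment_le_associatedWeight hz0 hzd.2
    have h3 := h.tailMoment_nonneg hzd
    gcongr
    rw [norm_mul]
    exact mul_le_of_le_one_left (norm_nonneg _) hzd.2.le
  refine le_trans ?_ hE
  rw [lintegral_carlesonSquare hFc 0 hL0 (by linarith), mul_assoc, mul_assoc,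
    ENNReal.ofReal_mul (p := Real.pi⁻¹) (by positivity)]
  gcongr ENNReal.ofReal Real.pi⁻¹ * ?_
  rw [max_eq_left (by linarith)]
  refine le_trans ?_ (lintegral_mono_set (Ioo_subset_Ioo_left hxL))
  rw [← mul_assoc, ENNReal.ofReal_mul (by positivity), h.ofReal_tail ⟨by linarith, hx1.le⟩,
    ← lintegral_const_mul' _ _ ENNReal.ofReal_ne_top]
  refine setLIntegral_mono' measurableSet_Ioo fun r hr => ?_
  have hr0 : 0 < r := by linarith [hr.1]
  have h1r : 0 < 1 - r := by linarith [hr.2]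
  have hωr := h.pos r ⟨hr0.le, hr.2⟩
  have hΦ := h.tailMoment_nonneg ⟨hr0.le, hr.2⟩
  have hlow := lintegral_norm_sq_lacunary_ge hr0 hr.2 (N := N) (by linarith [hr.1]) (0 - L / 2)
  rw [← hL, show (0 : ℝ) - L / 2 + L = 0 + L / 2 by ring] at hlow
  have e : ∀ t : ℝ, ENNReal.ofReal r * F (r * Complex.exp (t * Complex.I)) =
      ENNReal.ofReal (r * tailMoment ω r) * ENNReal.ofReal (‖(r * Complex.exp (t * Complex.I)) *
        deriv g (r * Complex.exp (t * Complex.I))‖ ^ 2) := fun t => by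
    simp only [hF]
    rw [norm_ofReal_mul_exp hr0.le, ← ENNReal.ofReal_mul hr0.le, ← ENNReal.ofReal_mul (by positivity)]
    congr 1
    ring
  simp_rw [e]
  rw [lintegral_const_mul' _ _ ENNReal.ofReal_ne_top]
  refine le_trans ?_ (mul_le_mul_right hlow _)
  rw [← ENNReal.ofReal_mul (by positivity), ← ENNReal.ofReal_mul (by positivity)]
  apply ENNReal.ofReal_le_ofReal
  have h4 := h.le_tailMoment ⟨hr0.le, hr.2⟩
  have h5 := hM r hr
  have h6 : M * ω r * (1 - r) ^ 2 ≤ 2 ^ (m + 1) * tailMoment ω r := by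
    calc M * ω r * (1 - r) ^ 2 = (1 - r) * (M * (ω r * (1 - r))) := by ring
      _ ≤ (1 - r) * tail ω r := by gcongr
      _ ≤ _ := h4
  calc L * (M / 2 ^ (m + 10)) * ω r
      = 1 / 2 * L / (256 * (1 - r) ^ 2) * (M * ω r * (1 - r) ^ 2 / 2 ^ (m + 1)) := by
        rw [pow_add, pow_add]; field_simp; norm_num
    _ ≤ 1 / 2 * L / (256 * (1 - r) ^ 2) * (2 ^ (m + 1) * tailMoment ω r / 2 ^ (m + 1)) := by gcongr
    _ = (1 / 2 * tailMoment ω r) * (L / (256 * (1 - r) ^ 2)) := by field_simp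
    _ ≤ _ := by
        gcongr
        linarith [hr.1]

theorem lacunary_one_notMem_cOneSpace {ω : ℝ → ℝ} (hω : IsRapidlyIncreasingWeight ω) :
    lacunary (fun _ => 1) ∉ cOneSpace ω := by
  intro hg
  obtain ⟨m, h⟩ := hω.exists_isAdmissible
  obtain ⟨-, K, hK⟩ := (mem_cOneSpace_iff h).1 hg
  have hpi := Real.pi_gt_three
  have hpi4 := Real.pi_le_four
  -- Chosen so that the lower bound for the energy exceeds `K` times the upper bound `128^m` for the
  -- mass, by one unit.
  set M : ℝ := (K * 128 ^ m + 1) * 2 ^ (m + 10) with hMdef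
  have hM0 : 0 < M := by positivity
  have h1 := hω.tendsto_distortion.eventually (eventually_ge_atTop M)
  obtain ⟨x₀, hx₀, hx₁⟩ := (mem_nhdsLT_iff_exists_Ioo_subset' (zero_lt_one' ℝ)).1 h1
  obtain ⟨n, hn⟩ := exists_pow_lt_of_lt_one (sub_pos.2 hx₀) (by norm_num : (1 / 2 : ℝ) < 1)
  set N := n + 3 with hN
  have hN2 : ((1 : ℝ) / 2) ^ N / 16 ≤ (1 / 2) ^ n := by
    rw [hN, pow_add]
    have : (0 : ℝ) < (1 / 2) ^ n := by positivity
    linarith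
  set x := 1 - (1 / 2 : ℝ) ^ N / 16 with hx
  have hNinv : ((1 : ℝ) / 2) ^ N = 1 / 2 ^ N := by rw [one_div, inv_pow, one_div]
  have h8 : (8 : ℝ) ≤ 2 ^ N := by
    calc (8 : ℝ) = 2 ^ 3 := by norm_num
      _ ≤ 2 ^ N := pow_le_pow_right₀ (by norm_num) (by omega)
  have h8' : ((1 : ℝ) / 2) ^ N ≤ 1 / 8 := by
    rw [hNinv]; gcongr
  have hx1 : x < 1 := by
    have : (0 : ℝ) < (1 / 2) ^ N := by positivity
    linarith
  have hlow := le_energy_lacunary_one h (by omega : 3 ≤ N) hM0.le fun r hr => by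
    have hr0 : 0 ≤ r := by linarith [hr.1]
    have h2 : M ≤ distortion ω r / (1 - r) := hx₁ ⟨by linarith [hr.1], hr.2⟩
    have hωr := h.pos r ⟨hr0, hr.2⟩
    rw [le_div_iff₀ (by linarith [hr.2])] at h2
    rw [← h.mul_distortion ⟨hr0, hr.2⟩]
    calc M * (ω r * (1 - r)) = ω r * (M * (1 - r)) := by ring
      _ ≤ _ := by gcongr
  set L := 2 * Real.pi / 2 ^ N with hL
  have hL0 : 0 < L := by positivity
  have hL1 : L ≤ 1 := by rw [hL, div_le_one (by positivity)]; linarith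
  have hup := hK 0 L ⟨hL0, by linarith⟩
  have hmass := weightMass_le h.toIsContinuousWeight 0 hL0 (by linarith)
  rw [max_eq_left (by linarith)] at hmass
  -- Here `L ≤ 8/2^N` and `1 - x = 1/(16 · 2^N)`, whence the ratio 128.
  have ht : tail ω (1 - L) ≤ 128 ^ m * tail ω x := by
    refine h.tail_le_const 128 (by linarith) ?_ hx1 ?_
    · have : ((1 : ℝ) / 2) ^ N / 16 ≤ L := by
        rw [hNinv, hL, div_div]
        gcongr
        · linarith
        · linarith [show (0 : ℝ) < 2 ^ N by positivity]
      linarith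
    · rw [hx, hL, hNinv, sub_sub_cancel, sub_sub_cancel, div_le_iff₀ (by positivity)]
      field_simp
      linarith
  have hfin : ENNReal.ofReal (Real.pi⁻¹ * L * (M / 2 ^ (m + 10)) * tail ω x) ≤
      ENNReal.ofReal (K * (Real.pi⁻¹ * L * (128 ^ m * tail ω x))) := by
    refine (hlow.trans hup).trans ?_
    rw [ENNReal.ofReal_mul (p := (K : ℝ)) K.2, ENNReal.ofReal_coe_nnreal]
    gcongr
    refine hmass.trans (ENNReal.ofReal_le_ofReal ?_)
    gcongr
  have htx := h.tail_pos (by linarith : 0 ≤ x) hx1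
  rw [ENNReal.ofReal_le_ofReal_iff (by positivity)] at hfin
  have e1 : M / 2 ^ (m + 10) = K * 128 ^ m + 1 := by rw [hMdef]; field_simp
  rw [e1] at hfin
  have hpos : 0 < Real.pi⁻¹ * L * tail ω x := by positivity
  nlinarith

/-! ### A lacunary series in 𝓒¹ outside BMOA. -/

theorem lintegral_nat_mul_pow_le (n : ℕ) :
    ∫⁻ r in Ioo (0 : ℝ) 1, ENNReal.ofReal (n * r ^ n) ≤ 1 := by
  have hi : IntervalIntegrable (fun r : ℝ => n * r ^ n) volume 0 1 :=
    (by fun_prop : Continuous fun r : ℝ => n * r ^ n).intervalIntegrable _ _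
  rw [← ofReal_integral_eq_lintegral_ofReal
    ((intervalIntegrable_iff_integrableOn_Ioo_of_le zero_le_one).1 hi)
    ((ae_restrict_iff' measurableSet_Ioo).2 (ae_of_all _ fun r hr => by have := hr.1; positivity)),
    ← integral_Ioc_eq_integral_Ioo, ← intervalIntegral.integral_of_le zero_le_one,
    intervalIntegral.integral_const_mul, integral_pow, ENNReal.ofReal_le_one]
  rw [one_pow, zero_pow (by omega), sub_zero, mul_one_div, div_le_one (by positivity)]
  linarith

theorem pow_mul_exp_neg_le {X : ℝ} (hX : 0 ≤ X) (n : ℕ) : X ^ n * Real.exp (-X) ≤ n.factorial := by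
  have h1 := Real.pow_div_factorial_le_exp X hX n
  rw [Real.exp_neg, ← div_eq_mul_inv, div_le_iff₀ (Real.exp_pos X)]
  rw [div_le_iff₀ (by positivity)] at h1
  linarith

/-- The integral concentrates where `1 - r` is about `2^(-k)`. With `X = 2^k (1 - r)`, doubling
gives `tail ω r ≤ (1 + X^m) W` and `r^(2^k) ≤ e^(-X)`. One such factor bounds the powers of `X`; the
other, `2^k r^(2^k)`, has integral at most 1. -/
theorem lintegral_pow_mul_tail_le {ω : ℝ → ℝ} {m : ℕ} (h : IsAdmissible ω m) (k : ℕ) :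
    ∫⁻ r in Ioo (0 : ℝ) 1, ENNReal.ofReal ((2 ^ k * r ^ 2 ^ k) ^ 2 * ((1 - r) * tail ω r)) ≤
      ENNReal.ofReal ((1 + (m + 1).factorial) * tail ω (1 - (1 / 2) ^ k)) := by
  set W := tail ω (1 - (1 / 2) ^ k) with hW
  have hk1 : ((1 : ℝ) / 2) ^ k ≤ 1 := pow_le_one₀ (by norm_num) (by norm_num)
  have hk0 : (0 : ℝ) < (1 / 2) ^ k := by positivity
  have hW0 : 0 ≤ W := h.tail_nonneg (by linarith) (by linarith)
  calc _ ≤ ∫⁻ r in Ioo (0 : ℝ) 1, ENNReal.ofReal ((1 + (m + 1).factorial) * W) *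
        ENNReal.ofReal ((2 ^ k : ℕ) * r ^ 2 ^ k) := by
        refine setLIntegral_mono' measurableSet_Ioo fun r hr => ?_
        have hr0 := hr.1
        rw [← ENNReal.ofReal_mul (by positivity)]
        apply ENNReal.ofReal_le_ofReal
        push_cast
        set X : ℝ := 2 ^ k * (1 - r) with hX
        have hX0 : 0 ≤ X := mul_nonneg (by positivity) (by linarith [hr.2])
        have ht : tail ω r ≤ (1 + X ^ m) * W := by
          rcases le_or_gt (1 - (1 / 2) ^ k) r with h1 | h1
          · have := h.tail_anti (by linarith) h1 hr.2.le
            nlinarith [mul_nonneg (pow_nonneg hX0 m) hW0]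
          · have h2 := h.tail_le hr0.le h1.le (by linarith)
            have h3 : (1 - r) / (1 - (1 - (1 / 2) ^ k)) = X := by
              rw [sub_sub_cancel, hX, one_div, inv_pow, div_inv_eq_mul, mul_comm]
            rw [h3] at h2
            linarith
        have he : r ^ 2 ^ k ≤ Real.exp (-X) := by
          have h4 : r ≤ Real.exp (r - 1) := by linarith [Real.add_one_le_exp (r - 1)]
          calc r ^ 2 ^ k ≤ Real.exp (r - 1) ^ 2 ^ k := by gcongr
            _ = _ := by rw [← Real.exp_nat_mul, hX]; congr 1; push_cast; ring
        have h5 := pow_mul_exp_neg_le hX0 1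
        have h6 := pow_mul_exp_neg_le hX0 (m + 1)
        have h7 := Real.exp_pos (-X)
        have ht0 := h.tail_nonneg hr0.le hr.2.le
        calc (2 ^ k * r ^ 2 ^ k) ^ 2 * ((1 - r) * tail ω r)
            = (X * r ^ 2 ^ k * tail ω r) * (2 ^ k * r ^ 2 ^ k) := by rw [hX]; ring
          _ ≤ (X * Real.exp (-X) * ((1 + X ^ m) * W)) * (2 ^ k * r ^ 2 ^ k) := by gcongr
          _ = ((X ^ 1 * Real.exp (-X) + X ^ (m + 1) * Real.exp (-X)) * W) *
              (2 ^ k * r ^ 2 ^ k) := by ring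
          _ ≤ _ := by
              gcongr
              simpa using h5
    _ = ENNReal.ofReal ((1 + (m + 1).factorial) * W) *
        ∫⁻ r in Ioo (0 : ℝ) 1, ENNReal.ofReal ((2 ^ k : ℕ) * r ^ 2 ^ k) :=
        lintegral_const_mul' _ _ ENNReal.ofReal_ne_top
    _ ≤ _ := mul_le_of_le_one_right (by simp) (lintegral_nat_mul_pow_le _)

theorem lintegral_norm_sq_lacunary_le {a : ℕ → ℝ} (ha : ∀ k, |a k| ≤ 1) {r : ℝ} (hr0 : 0 ≤ r)
    (hr1 : r < 1) (N : ℕ) (α : ℝ) :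
    ∫⁻ t in Ioc α (α + 2 * Real.pi / 2 ^ N),
      ENNReal.ofReal (‖(r * Complex.exp (t * Complex.I)) *
        deriv (lacunary a) (r * Complex.exp (t * Complex.I))‖ ^ 2) ≤
    ENNReal.ofReal (2 * (2 * Real.pi / 2 ^ N)) * (ENNReal.ofReal (4 ^ N) +
      ∑' k, ENNReal.ofReal ((a (k + N) * 2 ^ (k + N) * r ^ 2 ^ (k + N)) ^ 2)) := by
  have hT := lintegral_lacunaryTail ha hr0 hr1 N α
  set L := 2 * Real.pi / 2 ^ N with hL
  have hL0 : 0 < L := by positivity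
  calc _ ≤ ∫⁻ t in Ioc α (α + L), (ENNReal.ofReal (2 * 4 ^ N) + ENNReal.ofReal 2 *
        ENNReal.ofReal (‖lacunaryTail a N (r * Complex.exp (t * Complex.I))‖ ^ 2)) := by
        refine lintegral_mono fun t => ?_
        set z : ℂ := r * Complex.exp (t * Complex.I)
        have hz : z ∈ disc := ofReal_mem_disc ⟨hr0, hr1⟩ t
        have h9 := norm_lacunary_head_le ha hz N
        rw [mul_deriv_lacunary ha hz N, ← ENNReal.ofReal_mul (by norm_num),
          ← ENNReal.ofReal_add (by positivity) (by positivity)]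
        apply ENNReal.ofReal_le_ofReal
        have h11 : (4 : ℝ) ^ N = (2 ^ N) ^ 2 := by rw [← pow_mul, mul_comm, pow_mul]; norm_num
        rw [h11]
        set H := ∑ k ∈ Finset.range N, ((a k * 2 ^ k : ℝ) : ℂ) * z ^ 2 ^ k
        calc ‖H + lacunaryTail a N z‖ ^ 2 ≤ (2 ^ N + ‖lacunaryTail a N z‖) ^ 2 := by
              gcongr
              exact (norm_add_le _ _).trans (by gcongr)
          _ ≤ _ := by nlinarith [sq_nonneg (2 ^ N - ‖lacunaryTail a N z‖)]
    _ = _ := by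
        rw [lintegral_add_left measurable_const, lintegral_const_mul' _ _ ENNReal.ofReal_ne_top,
          hT, lintegral_const, Measure.restrict_apply_univ, Real.volume_Ioc, add_sub_cancel_left,
          ← mul_assoc, ← ENNReal.ofReal_mul (by norm_num), mul_add,
          ← ENNReal.ofReal_mul (by positivity), ← ENNReal.ofReal_mul (by positivity)]
        congr 2
        ring

theorem BMOA.lintegral_lt_top {g : ℂ → ℂ} (hg : g ∈ BMOA) :
    ∫⁻ z in disc, ENNReal.ofReal (‖deriv g z‖ ^ 2 * (1 - ‖z‖ ^ 2)) ∂areaDisc < ∞ := by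
  obtain ⟨K, hK⟩ := BMOA.exists_bound hg
  obtain ⟨C, hC0, hC⟩ := exists_bound_deriv hg.1 (by norm_num : (1 / 2 : ℝ) < 1)
  refine lt_of_le_of_lt (lintegral_mono_set disc_subset_iUnion_carlesonSquare) ?_
  refine lt_of_le_of_lt (lintegral_union_le _ _ _) (ENNReal.add_lt_top.2 ⟨?_, ?_⟩)
  · calc ∫⁻ z in Metric.closedBall 0 (1 / 2),
          ENNReal.ofReal (‖deriv g z‖ ^ 2 * (1 - ‖z‖ ^ 2)) ∂areaDisc
        ≤ ∫⁻ z in Metric.closedBall 0 (1 / 2), ENNReal.ofReal (C ^ 2) ∂areaDisc := by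
          refine setLIntegral_mono' Metric.isClosed_closedBall.measurableSet fun z hz => ?_
          have hz' : ‖z‖ ≤ 1 / 2 := by simpa using hz
          apply ENNReal.ofReal_le_ofReal
          have h1 := hC z hz'
          have h2 : ‖deriv g z‖ ^ 2 ≤ C ^ 2 := by gcongr
          nlinarith [sq_nonneg ‖z‖, sq_nonneg ‖deriv g z‖]
      _ < ∞ := by
          rw [lintegral_const, Measure.restrict_apply_univ]
          refine ENNReal.mul_lt_top ENNReal.ofReal_lt_top ?_
          unfold areaDisc
          rw [Measure.smul_apply, smul_eq_mul]
          exact ENNReal.mul_lt_top ENNReal.ofReal_lt_top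
            ((Measure.restrict_apply_le _ _).trans_lt measure_closedBall_lt_top)
  · refine lt_of_le_of_lt (lintegral_iUnion_le _ _) ?_
    rw [tsum_fintype]
    exact ENNReal.sum_lt_top.2 fun j _ => (hK _ (1 / 2) ⟨by norm_num, by norm_num⟩).trans_lt
      (ENNReal.mul_lt_top ENNReal.coe_lt_top ENNReal.ofReal_lt_top)

/-- Keep only `2^(-k)/2 < 1 - r < 2^(-k)`, where `r^(2^k)` is bounded below; `k ≥ 1` ensures `r ≥
1/2` there. -/
theorem le_lintegral_pow_two_pow {k : ℕ} (hk : 1 ≤ k) :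
    ENNReal.ofReal (1 / 128) ≤ ∫⁻ r in Ioo (0 : ℝ) 1,
      ENNReal.ofReal (r * (1 - r) * (2 ^ k * r ^ 2 ^ k) ^ 2) := by
  set δ : ℝ := (1 / 2) ^ k with hδ
  have hδ0 : 0 < δ := by positivity
  have hδ1 : δ ≤ 1 / 2 := by
    rw [hδ]
    exact pow_le_of_le_one (by norm_num) (by norm_num) (by omega)
  have h2k : (2 : ℝ) ^ k = δ⁻¹ := by rw [hδ, one_div, inv_pow, inv_inv]
  calc ENNReal.ofReal (1 / 128)
      = ∫⁻ r in Ioo (1 - δ) (1 - δ / 2), ENNReal.ofReal (1 / (64 * δ)) := by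
        rw [lintegral_const, Measure.restrict_apply_univ, Real.volume_Ioo,
          ← ENNReal.ofReal_mul (by positivity)]
        congr 1
        field_simp
        ring
    _ ≤ ∫⁻ r in Ioo (1 - δ) (1 - δ / 2),
          ENNReal.ofReal (r * (1 - r) * (2 ^ k * r ^ 2 ^ k) ^ 2) := by
        refine setLIntegral_mono' measurableSet_Ioo fun r hr => ?_
        apply ENNReal.ofReal_le_ofReal
        have hr1 := hr.1
        have hr2 := hr.2
        have h1 := one_div_le_pow_two_pow (by linarith : 0 ≤ r) hk (by linarith)
        rw [mul_pow, h2k]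
        calc 1 / (64 * δ) = 1 / 2 * (δ / 2) * ((δ⁻¹) ^ 2 * (1 / 16)) := by field_simp; norm_num
          _ ≤ r * (1 - r) * ((δ⁻¹) ^ 2 * (r ^ 2 ^ k) ^ 2) := by
              have h2 : 0 ≤ r := by linarith
              have h3 : 1 / 2 * (δ / 2) ≤ r * (1 - r) := by
                gcongr <;> linarith
              have h4 : 0 ≤ r * (1 - r) := le_trans (by positivity) h3
              gcongr
    _ ≤ _ := lintegral_mono_set (Ioo_subset_Ioo (by linarith) (by linarith))

/-- Only finiteness of the integral over the whole disc is used: by Parseval on full circles (`N =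
0`) it dominates a multiple of `∑ a_k²`. The shift avoids `k = 0`, where the lower bound on the
radial integral is not available. -/
theorem summable_sq_of_lacunary_mem_BMOA {a : ℕ → ℝ} (ha : ∀ k, |a k| ≤ 1)
    (hg : lacunary a ∈ BMOA) : Summable fun k => a (k + 1) ^ 2 := by
  have h1 := BMOA.lintegral_lt_top hg
  set g := lacunary a
  set F : ℂ → ℝ≥0∞ := fun z => ENNReal.ofReal (‖z * deriv g z‖ ^ 2 * (1 - ‖z‖)) with hF
  have hFc : ContinuousOn F disc := by
    refine ENNReal.continuous_ofReal.comp_continuousOn (ContinuousOn.mul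
      ((continuousOn_id.mul (continuousOn_deriv hg.1)).norm.pow 2) (by fun_prop))
  have h2 : ∫⁻ z in disc, F z ∂areaDisc < ∞ := by
    refine lt_of_le_of_lt (setLIntegral_mono' measurableSet_disc fun z hz => ?_) h1
    have hz1 := norm_mem_Ico hz
    apply ENNReal.ofReal_le_ofReal
    rw [norm_mul]
    have h3 : 0 ≤ 1 - ‖z‖ := by linarith [hz1.2]
    gcongr
    · exact mul_le_of_le_one_left (norm_nonneg _) hz1.2.le
    · nlinarith [hz1.1]
  rw [lintegral_disc hFc] at h2
  have h3 : ∫⁻ r in Ioo (0 : ℝ) 1, ∫⁻ t in Ioc (-Real.pi) (-Real.pi + 2 * Real.pi),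
      ENNReal.ofReal r * F (r * Complex.exp (t * Complex.I)) =
      ∫⁻ r in Ioo (0 : ℝ) 1, ∑' k, ENNReal.ofReal (2 * Real.pi * a k ^ 2) *
        ENNReal.ofReal (r * (1 - r) * (2 ^ k * r ^ 2 ^ k) ^ 2) := by
    refine setLIntegral_congr_fun measurableSet_Ioo fun r hr => ?_
    have hr0 := hr.1.le
    have hr1 : 0 ≤ 1 - r := by linarith [hr.2]
    have e : ∀ t : ℝ, ENNReal.ofReal r * F (r * Complex.exp (t * Complex.I)) =
        ENNReal.ofReal (r * (1 - r)) * ENNReal.ofReal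
          (‖lacunaryTail a 0 (r * Complex.exp (t * Complex.I))‖ ^ 2) := fun t => by
      simp only [hF]
      rw [mul_deriv_lacunary ha (ofReal_mem_disc ⟨hr0, hr.2⟩ t) 0, Finset.range_zero,
        Finset.sum_empty, zero_add, norm_ofReal_mul_exp hr0, ← ENNReal.ofReal_mul hr0,
        ← ENNReal.ofReal_mul (by positivity)]
      congr 1
      ring
    simp_rw [e]
    have hT := lintegral_lacunaryTail ha hr0 hr.2 0 (-Real.pi)
    rw [pow_zero, div_one] at hT
    rw [lintegral_const_mul' _ _ ENNReal.ofReal_ne_top, hT, ← mul_assoc, ← ENNReal.tsum_mul_left]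
    congr 1
    ext k
    rw [← ENNReal.ofReal_mul (by positivity), ← ENNReal.ofReal_mul (by positivity),
      ← ENNReal.ofReal_mul (by positivity)]
    congr 1
    simp only [add_zero]
    ring
  rw [h3, lintegral_tsum fun k => by fun_prop] at h2
  have hpi := Real.pi_pos
  have h4 := ENNReal.lt_top_of_mul_ne_top_right h2.ne (by simpa using hpi)
  have h5 : ∑' k, ENNReal.ofReal (2 * Real.pi * a (k + 1) ^ 2) * ENNReal.ofReal (1 / 128) < ∞ := by
    refine lt_of_le_of_lt ?_ h4
    refine le_trans (ENNReal.tsum_le_tsum fun k => ?_)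
      (ENNReal.tsum_comp_le_tsum_of_injective (add_left_injective 1) _)
    rw [lintegral_const_mul' _ _ ENNReal.ofReal_ne_top]
    gcongr
    exact le_lintegral_pow_two_pow (by omega)
  have h6 := (ENNReal.summable_toReal h5.ne).mul_left (128 / (2 * Real.pi))
  refine h6.congr fun k => ?_
  rw [← ENNReal.ofReal_mul (by positivity), ENNReal.toReal_ofReal (by positivity)]
  field_simp

/-- Match `2^(-N)` with the arc length `ℓ`. The head has square at most `4^N` and contributes a
bounded multiple of `4^N ℓ² tail ω (1 - ℓ)`, with `4^N ℓ² ≤ 4`. The tail contributes the sum in the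
hypothesis. -/
theorem lacunary_mem_cOneSpace {ω : ℝ → ℝ} {m : ℕ} (h : IsAdmissible ω m) {a : ℕ → ℝ}
    (ha : ∀ k, |a k| ≤ 1) (hB : ∀ N, ∑' k, ENNReal.ofReal (a (k + N) ^ 2 *
      tail ω (1 - (1 / 2) ^ (k + N))) ≤ ENNReal.ofReal (tail ω (1 - (1 / 2) ^ N))) :
    lacunary a ∈ cOneSpace ω := by
  have hpi := Real.pi_gt_three
  have hpi4 := Real.pi_le_four
  have hg : lacunary a ∈ AnalyticDisc := lacunary_mem_analyticDisc ha
  set g := lacunary a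
  set C : ℝ := 1 + (m + 1).factorial with hCdef
  have hC0 : 0 ≤ C := by positivity
  refine mem_cOneSpace_of_small h hg
    (K := (128 * (4 + C) * 2 ^ (m + 1)).toNNReal) fun θ ℓ hℓ => ?_
  have hℓ0 := hℓ.1
  have hℓ2 := hℓ.2
  obtain ⟨n, hn1, hn2⟩ := exists_nat_pow_near_of_lt_one hℓ.1 (by linarith)
    (by norm_num : (0 : ℝ) < 1 / 2) (by norm_num)
  set N := n + 1 with hN
  have hδ : (0 : ℝ) < (1 / 2) ^ N := by positivity
  have hℓN : ℓ ≤ 2 * (1 / 2) ^ N := by rw [hN, pow_succ]; linarith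
  have h2N : (2 : ℝ) ^ N = ((1 / 2) ^ N)⁻¹ := by rw [one_div, inv_pow, inv_inv]
  -- Since `2^(-N) < ℓ ≤ 2 · 2^(-N)`, enlarging the arc to the Parseval length `L` costs a factor at
  -- most 8.
  set L := 2 * Real.pi / 2 ^ N with hL
  have hL' : L = 2 * Real.pi * (1 / 2) ^ N := by rw [hL, h2N, div_inv_eq_mul]
  have hL0 : 0 < L := by positivity
  have hℓL : ℓ ≤ L := by rw [hL']; nlinarith
  have hLℓ : L ≤ 8 * ℓ := by rw [hL']; nlinarith
  set T := tail ω (1 - ℓ) with hT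
  have hT0 : 0 ≤ T := h.tail_nonneg (by linarith) (by linarith)
  have hWT : tail ω (1 - (1 / 2) ^ N) ≤ T := h.tail_anti (by linarith) (by linarith) (by linarith)
  set F : ℂ → ℝ≥0∞ := fun z =>
    ENNReal.ofReal (8 * (‖z * deriv g z‖ ^ 2 * ((1 - ‖z‖) * tail ω ‖z‖))) with hF
  have hFc : ContinuousOn F disc := by
    refine ENNReal.continuous_ofReal.comp_continuousOn (continuousOn_const.mul
      (((continuousOn_id.mul (continuousOn_deriv hg)).norm.pow 2).mul
        (ContinuousOn.mul (by fun_prop)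
          (h.continuousOn_tail.comp (by fun_prop) fun z hz => ?_))))
    exact Ico_subset_Icc_self (norm_mem_Ico hz)
  have hE : energy ω g (carlesonSquare θ ℓ) ≤ ∫⁻ z in carlesonSquare θ ℓ, F z ∂areaDisc := by
    refine setLIntegral_mono' (measurableSet_carlesonSquare hℓ0 (by linarith)) fun z hz => ?_
    obtain ⟨h1, h2⟩ := one_sub_le_norm_of_mem hz
    apply ENNReal.ofReal_le_ofReal
    have h3 := h.associatedWeight_le_two (by linarith) h2
    have h4 : 0 ≤ (1 - ‖z‖) * tail ω ‖z‖ :=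
      mul_nonneg (by linarith) (h.tail_nonneg (norm_nonneg z) h2.le)
    have h5 : 1 / 4 ≤ ‖z‖ ^ 2 := by
      have : (1 / 2 : ℝ) ^ 2 ≤ ‖z‖ ^ 2 := by gcongr; linarith
      linarith
    calc ‖deriv g z‖ ^ 2 * associatedWeight ω z
        ≤ ‖deriv g z‖ ^ 2 * (2 * ((1 - ‖z‖) * tail ω ‖z‖)) := by gcongr
      _ = 8 * ((1 / 4 * ‖deriv g z‖ ^ 2) * ((1 - ‖z‖) * tail ω ‖z‖)) := by ring
      _ ≤ 8 * ((‖z‖ ^ 2 * ‖deriv g z‖ ^ 2) * ((1 - ‖z‖) * tail ω ‖z‖)) := by gcongr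
      _ = _ := by rw [norm_mul, mul_pow]
  set S : ℝ → ℝ≥0∞ := fun r => ∑' k, ENNReal.ofReal (a (k + N) ^ 2) *
    ENNReal.ofReal ((2 ^ (k + N) * r ^ 2 ^ (k + N)) ^ 2 * ((1 - r) * tail ω r)) with hS
  have hinner : ∀ r ∈ Ioo (1 - ℓ) 1, ∫⁻ t in Ioc (θ - ℓ / 2) (θ + ℓ / 2),
      ENNReal.ofReal r * F (r * Complex.exp (t * Complex.I)) ≤
      ENNReal.ofReal (16 * L) * (ENNReal.ofReal (4 ^ N * ℓ * T) + S r) := by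
    intro r hr
    have hr0 : 0 ≤ r := by linarith [hr.1]
    have h1r : 0 ≤ 1 - r := by linarith [hr.2]
    have htr := h.tail_nonneg hr0 hr.2.le
    have htT : tail ω r ≤ T := h.tail_anti (by linarith) hr.1.le hr.2.le
    have hX := lintegral_norm_sq_lacunary_le ha hr0 hr.2 N (θ - ℓ / 2)
    rw [← hL] at hX
    calc _ ≤ ∫⁻ t in Ioc (θ - ℓ / 2) (θ - ℓ / 2 + L), ENNReal.ofReal (8 * ((1 - r) * tail ω r)) *
          ENNReal.ofReal (‖(r * Complex.exp (t * Complex.I)) *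
            deriv g (r * Complex.exp (t * Complex.I))‖ ^ 2) := by
          refine le_trans (lintegral_mono fun t => ?_)
            (lintegral_mono_set (Ioc_subset_Ioc_right (by linarith)))
          refine (mul_le_of_le_one_left (by simp) (ENNReal.ofReal_le_one.2 hr.2.le)).trans ?_
          simp only [hF]
          rw [norm_ofReal_mul_exp hr0, ← ENNReal.ofReal_mul (by positivity)]
          apply ENNReal.ofReal_le_ofReal
          apply le_of_eq
          ring
      _ ≤ ENNReal.ofReal (8 * ((1 - r) * tail ω r)) * (ENNReal.ofReal (2 * L) *
          (ENNReal.ofReal (4 ^ N) +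
            ∑' k, ENNReal.ofReal ((a (k + N) * 2 ^ (k + N) * r ^ 2 ^ (k + N)) ^ 2))) := by
          rw [lintegral_const_mul' _ _ ENNReal.ofReal_ne_top]
          gcongr
      _ = ENNReal.ofReal (16 * L) * (ENNReal.ofReal ((1 - r) * tail ω r) * (ENNReal.ofReal (4 ^ N) +
            ∑' k, ENNReal.ofReal ((a (k + N) * 2 ^ (k + N) * r ^ 2 ^ (k + N)) ^ 2))) := by
          rw [← mul_assoc (ENNReal.ofReal _), ← mul_assoc (ENNReal.ofReal _),
            ← ENNReal.ofReal_mul (by positivity), ← ENNReal.ofReal_mul (by positivity)]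
          congr 2
          ring
      _ ≤ _ := by
          rw [mul_add]
          gcongr
          · rw [← ENNReal.ofReal_mul (by positivity)]
            apply ENNReal.ofReal_le_ofReal
            calc (1 - r) * tail ω r * 4 ^ N ≤ ℓ * T * 4 ^ N := by
                  gcongr
                  linarith [hr.1]
              _ = _ := by ring
          · rw [← ENNReal.tsum_mul_left]
            refine ENNReal.tsum_le_tsum fun k => le_of_eq ?_
            rw [← ENNReal.ofReal_mul (by positivity), ← ENNReal.ofReal_mul (by positivity)]
            congr 1
            ring
  have hSint : ∫⁻ r in Ioo (1 - ℓ) 1, S r ≤ ENNReal.ofReal (C * T) := by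
    have hmeas : ∀ k : ℕ, AEMeasurable (fun r : ℝ => ENNReal.ofReal (a (k + N) ^ 2) *
        ENNReal.ofReal ((2 ^ (k + N) * r ^ 2 ^ (k + N)) ^ 2 * ((1 - r) * tail ω r)))
        (volume.restrict (Ioo 0 1)) := fun k => by
      refine AEMeasurable.const_mul (ContinuousOn.aemeasurable ?_ measurableSet_Ioo) _
      exact ENNReal.continuous_ofReal.comp_continuousOn (ContinuousOn.mul (by fun_prop)
        (ContinuousOn.mul (by fun_prop) (h.continuousOn_tail.mono Ioo_subset_Icc_self)))
    calc ∫⁻ r in Ioo (1 - ℓ) 1, S r ≤ ∫⁻ r in Ioo (0 : ℝ) 1, S r :=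
          lintegral_mono_set (Ioo_subset_Ioo_left (by linarith))
      _ ≤ ∑' k, ENNReal.ofReal C *
          ENNReal.ofReal (a (k + N) ^ 2 * tail ω (1 - (1 / 2) ^ (k + N))) := by
          rw [lintegral_tsum hmeas]
          refine ENNReal.tsum_le_tsum fun k => ?_
          rw [lintegral_const_mul' _ _ ENNReal.ofReal_ne_top]
          refine (mul_le_mul_right (lintegral_pow_mul_tail_le h (k + N)) _).trans (le_of_eq ?_)
          rw [← ENNReal.ofReal_mul (by positivity), ← ENNReal.ofReal_mul hC0]
          congr 1
          ring
      _ ≤ ENNReal.ofReal C * ENNReal.ofReal T := by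
          rw [ENNReal.tsum_mul_left]
          gcongr
          exact (hB N).trans (ENNReal.ofReal_le_ofReal hWT)
      _ = _ := (ENNReal.ofReal_mul hC0).symm
  have h4N : 4 ^ N * ℓ * ℓ ≤ 4 := by
    have h11 : (4 : ℝ) ^ N = (2 ^ N) ^ 2 := by rw [← pow_mul, mul_comm, pow_mul]; norm_num
    have h12 : 2 ^ N * ℓ ≤ 2 := by
      rw [h2N, inv_mul_le_iff₀ hδ]; linarith
    have h13 : (2 ^ N * ℓ) ^ 2 ≤ 2 ^ 2 := by gcongr
    rw [h11]
    linarith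
  refine hE.trans ?_
  rw [lintegral_carlesonSquare hFc θ hℓ0 (by linarith), max_eq_left (by linarith)]
  calc _ ≤ ENNReal.ofReal Real.pi⁻¹ * ∫⁻ r in Ioo (1 - ℓ) 1,
        ENNReal.ofReal (16 * L) * (ENNReal.ofReal (4 ^ N * ℓ * T) + S r) := by
        gcongr ENNReal.ofReal Real.pi⁻¹ * ?_
        exact setLIntegral_mono' measurableSet_Ioo hinner
    _ ≤ ENNReal.ofReal Real.pi⁻¹ * (ENNReal.ofReal (16 * L) *
        (ENNReal.ofReal (4 * T) + ENNReal.ofReal (C * T))) := by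
        rw [lintegral_const_mul' _ _ ENNReal.ofReal_ne_top, lintegral_add_left measurable_const]
        gcongr
        rw [lintegral_const, Measure.restrict_apply_univ, Real.volume_Ioo, sub_sub_cancel,
          ← ENNReal.ofReal_mul (by positivity)]
        apply ENNReal.ofReal_le_ofReal
        nlinarith
    _ = ENNReal.ofReal (Real.pi⁻¹ * (16 * L * ((4 + C) * T))) := by
        rw [← ENNReal.ofReal_add (by positivity) (by positivity),
          ← ENNReal.ofReal_mul (by positivity), ← ENNReal.ofReal_mul (by positivity)]
        congr 3
        ring
    _ ≤ ENNReal.ofReal (128 * (4 + C) * 2 ^ (m + 1)) *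
        ENNReal.ofReal (Real.pi⁻¹ * ℓ * ((2 ^ (m + 1))⁻¹ * tail ω (max (1 - ℓ) 0))) := by
        rw [max_eq_left (by linarith), ← ENNReal.ofReal_mul (by positivity)]
        apply ENNReal.ofReal_le_ofReal
        calc Real.pi⁻¹ * (16 * L * ((4 + C) * T)) ≤ Real.pi⁻¹ * (16 * (8 * ℓ) * ((4 + C) * T)) := by
              gcongr
          _ = _ := by field_simp; ring
    _ ≤ _ := mul_le_mul_right (le_weightMass h θ hℓ0 (by linarith)) _

/-- The coefficients `√(1 - ω̂(r_{k+1}) / ω̂(r_k))`, where `r_k = 1 - 2^{-k}`. -/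
noncomputable def tailCoeff (ω : ℝ → ℝ) (k : ℕ) : ℝ :=
  √(1 - tail ω (1 - (1 / 2) ^ (k + 1)) / tail ω (1 - (1 / 2) ^ k))

theorem one_sub_half_pow_mem (k : ℕ) : 1 - (1 / 2 : ℝ) ^ k ∈ Ico (0 : ℝ) 1 := by
  have h1 : ((1 : ℝ) / 2) ^ k ≤ 1 := pow_le_one₀ (by norm_num) (by norm_num)
  have h2 : (0 : ℝ) < (1 / 2) ^ k := by positivity
  constructor <;> linarith

namespace IsContinuousWeight

variable {ω : ℝ → ℝ} (h : IsContinuousWeight ω)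
include h

theorem tail_half_pow_pos (k : ℕ) : 0 < tail ω (1 - (1 / 2) ^ k) :=
  h.tail_pos (one_sub_half_pow_mem k).1 (one_sub_half_pow_mem k).2

theorem antitone_tail_half_pow : Antitone fun k : ℕ => tail ω (1 - (1 / 2) ^ k) := by
  intro i j hij
  have h1 : ((1 : ℝ) / 2) ^ j ≤ (1 / 2) ^ i :=
    pow_le_pow_of_le_one (by norm_num) (by norm_num) hij
  exact h.tail_anti (one_sub_half_pow_mem i).1 (by linarith) (one_sub_half_pow_mem j).2.le

theorem tendsto_tail_half_pow : Tendsto (fun k : ℕ => tail ω (1 - (1 / 2) ^ k)) atTop (𝓝 0) := by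
  have h1 := h.continuousOn_tail 1 ⟨zero_le_one, le_rfl⟩
  rw [ContinuousWithinAt, tail_one] at h1
  refine h1.comp (tendsto_nhdsWithin_iff.2 ⟨?_, Eventually.of_forall fun k =>
    Ico_subset_Icc_self (one_sub_half_pow_mem k)⟩)
  simpa using (tendsto_pow_atTop_nhds_zero_of_lt_one (by norm_num : (0 : ℝ) ≤ 1 / 2)
    (by norm_num)).const_sub 1

theorem tailCoeff_sq (k : ℕ) : tailCoeff ω k ^ 2 =
    1 - tail ω (1 - (1 / 2) ^ (k + 1)) / tail ω (1 - (1 / 2) ^ k) := by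
  rw [tailCoeff, Real.sq_sqrt]
  rw [sub_nonneg, div_le_one (h.tail_half_pow_pos k)]
  exact h.antitone_tail_half_pow (Nat.le_succ k)

theorem tailCoeff_sq_mul (k : ℕ) : tailCoeff ω k ^ 2 * tail ω (1 - (1 / 2) ^ k) =
    tail ω (1 - (1 / 2) ^ k) - tail ω (1 - (1 / 2) ^ (k + 1)) := by
  rw [h.tailCoeff_sq]
  have := (h.tail_half_pow_pos k).ne'
  field_simp

theorem abs_tailCoeff_le (k : ℕ) : |tailCoeff ω k| ≤ 1 := by
  rw [← sq_le_one_iff_abs_le_one, h.tailCoeff_sq, sub_le_self_iff]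
  exact (div_pos (h.tail_half_pow_pos _) (h.tail_half_pow_pos _)).le

theorem hasSum_tailCoeff_sq_mul (N : ℕ) : HasSum (fun k => tailCoeff ω (k + N) ^ 2 *
    tail ω (1 - (1 / 2) ^ (k + N))) (tail ω (1 - (1 / 2) ^ N)) := by
  have h0 : ∀ k, 0 ≤ tailCoeff ω (k + N) ^ 2 * tail ω (1 - (1 / 2) ^ (k + N)) := fun k =>
    mul_nonneg (sq_nonneg _) (h.tail_half_pow_pos _).le
  rw [hasSum_iff_tendsto_nat_of_nonneg h0]
  have h1 : ∀ n, ∑ k ∈ Finset.range n, tailCoeff ω (k + N) ^ 2 * tail ω (1 - (1 / 2) ^ (k + N)) =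
      tail ω (1 - (1 / 2) ^ N) - tail ω (1 - (1 / 2) ^ (n + N)) := fun n => by
    have := Finset.sum_range_sub' (fun k => tail ω (1 - (1 / 2) ^ (k + N))) n
    simp only [zero_add] at this
    rw [← this]
    refine Finset.sum_congr rfl fun k _ => ?_
    rw [h.tailCoeff_sq_mul, add_right_comm]
  simp_rw [h1]
  simpa using ((tendsto_add_atTop_iff_nat N).2 h.tendsto_tail_half_pow).const_sub
    (tail ω (1 - (1 / 2) ^ N))

/-- By telescoping, the sum of `a_k² W_k/W_N` over `k ≥ N` is 1, and `W_k ≤ W_N`. So every remainder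
of `∑ a_k²` is at least 1. -/
theorem not_summable_tailCoeff_sq : ¬ Summable fun k => tailCoeff ω k ^ 2 := by
  intro hs
  have h1 := tendsto_sum_nat_add fun k => tailCoeff ω k ^ 2
  refine absurd (ge_of_tendsto' h1 fun N => ?_) (not_le.2 (zero_lt_one' ℝ))
  have hW := h.tail_half_pow_pos N
  have h2 := (h.hasSum_tailCoeff_sq_mul N).div_const (tail ω (1 - (1 / 2) ^ N))
  rw [div_self hW.ne'] at h2
  refine hasSum_le (fun k => ?_) h2 ((summable_nat_add_iff N).2 hs).hasSum
  rw [div_le_iff₀ hW]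
  exact mul_le_mul_of_nonneg_left (h.antitone_tail_half_pow (Nat.le_add_left N k)) (sq_nonneg _)

end IsContinuousWeight

theorem lacunary_tailCoeff_mem_cOneSpace {ω : ℝ → ℝ} {m : ℕ} (h : IsAdmissible ω m) :
    lacunary (tailCoeff ω) ∈ cOneSpace ω := by
  refine lacunary_mem_cOneSpace h h.abs_tailCoeff_le fun N => ?_
  have h1 := h.hasSum_tailCoeff_sq_mul N
  rw [← ENNReal.ofReal_tsum_of_nonneg
    (fun k => mul_nonneg (sq_nonneg _) (h.tail_half_pow_pos _).le) h1.summable, h1.tsum_eq]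

theorem lacunary_tailCoeff_notMem_BMOA {ω : ℝ → ℝ} (h : IsContinuousWeight ω) :
    lacunary (tailCoeff ω) ∉ BMOA := fun hg =>
  h.not_summable_tailCoeff_sq
    ((summable_nat_add_iff 1).1 (summable_sq_of_lacunary_mem_BMOA h.abs_tailCoeff_le hg))

end RadialBergman

theorem mainTheorem7 (ω : ℝ → ℝ) :
    ((RadialBergman.IsRapidlyIncreasingWeight ω ∨ RadialBergman.IsRegularWeight ω) →
      RadialBergman.cOneSpace ω ⊆
        ⋂ (p : ℝ) (_ : 0 < p), RadialBergman.bergmanSpace p ω) ∧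
    ((RadialBergman.IsRapidlyIncreasingWeight ω ∨ RadialBergman.IsRegularWeight ω) →
      RadialBergman.BMOA ⊆ RadialBergman.cOneSpace ω ∧
      RadialBergman.cOneSpace ω ⊆ RadialBergman.blochSpace) ∧
    (RadialBergman.IsRegularWeight ω →
      RadialBergman.cOneSpace ω = RadialBergman.blochSpace) ∧
    (RadialBergman.IsRapidlyIncreasingWeight ω →
      RadialBergman.cOneSpace ω ⊂ RadialBergman.blochSpace) ∧
    (RadialBergman.IsRapidlyIncreasingWeight ω →
      RadialBergman.EssentiallyIncreasing ω →
      RadialBergman.EssentiallyIncreasing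
        (fun r => RadialBergman.distortion ω r / (1 - r)) →
      RadialBergman.BMOA ⊂ RadialBergman.cOneSpace ω) := by
  have hadm : (RadialBergman.IsRapidlyIncreasingWeight ω ∨ RadialBergman.IsRegularWeight ω) →
      ∃ m, RadialBergman.IsAdmissible ω m := fun h =>
    h.elim (fun h => h.exists_isAdmissible) fun h => h.exists_isAdmissible
  refine ⟨fun hω => ?_, fun hω => ?_, fun hω => ?_, fun hω => ?_, fun hω _ _ => ?_⟩
  · obtain ⟨m, h⟩ := hadm hω
    exact subset_iInter₂ fun p hp => RadialBergman.cOneSpace_subset_bergmanSpace h hp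
  · obtain ⟨m, h⟩ := hadm hω
    exact ⟨RadialBergman.BMOA_subset_cOneSpace h, RadialBergman.cOneSpace_subset_blochSpace h⟩
  · obtain ⟨m, h⟩ := hω.exists_isAdmissible
    exact (RadialBergman.cOneSpace_subset_blochSpace h).antisymm
      (RadialBergman.blochSpace_subset_cOneSpace hω)
  · obtain ⟨m, h⟩ := hω.exists_isAdmissible
    exact (ssubset_iff_of_subset (RadialBergman.cOneSpace_subset_blochSpace h)).2
      ⟨_, RadialBergman.lacunary_one_mem_blochSpace, RadialBergman.lacunary_one_notMem_cOneSpace hω⟩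
  · obtain ⟨m, h⟩ := hω.exists_isAdmissible
    exact (ssubset_iff_of_subset (RadialBergman.BMOA_subset_cOneSpace h)).2
      ⟨_, RadialBergman.lacunary_tailCoeff_mem_cOneSpace h,
        RadialBergman.lacunary_tailCoeff_notMem_BMOA h.toIsContinuousWeight⟩
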